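/- Theorem. Let $\mathsf{P}_0$ be the classical system $\textsf{E-PRA}^{\omega*}+\mathcal{T}^*_{\rm st}+\textsf{HAC}_{\rm int}+\textsf{I}+\textsf{QF-AC}^{1,0}$ of nonstandard arithmetic in all finite types: primitive recursive arithmetic in all finite types (with types $\rho^*$ of finite sequences, full extensionality, recursion of type $0$ and quantifier-free induction), the axioms saying that all constants are standard and that standardness is preserved by equality and application, the Herbrandised axiom of choice and idealisation for internal formulas, and quantifier-free choice from type $1$ to type $0$. A set $X^{\rho\to 0}$ is given by its characteristic function, a real number by a fast converging sequence of rationals, $d(\cdot,\cdot)=|\cdot-\cdot|_X$ is a real-valued metric on $X$ given by a functional of type $\rho\to\rho\to 1$ (points at distance $0$ count as equal), and $x\approx y$ means that $|x-y|_X$ is infinitesimal. For every finite type $\rho$, $\mathsf{P}_0$ proves that for every set $X^{\rho\to0}$ and every metric $|\cdot-\cdot|_X$ on $X$: (a) If $X$ is nonstandard compact, i.e. $(\forall x\in X)(\exists^{\rm st}y\in X)(x\approx y)$, then $X$ is effectively totally bounded: $$(\exists^{\rm st}h^{0\to\rho^*})(\forall^{\rm st}k>0)(\forall x\in X)(\exists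 i<|h(k)|)\big(h(k)(i)\in X\ \wedge\ |x-h(k)(i)|_X\le \tfrac1k\big).$$ (b) If $X$ is effectively totally bounded, as displayed in (a), then there is a standard $\psi_0^{0\to\rho^*}$ such that for all infinite $M^0$, i.e. all $M$ with $(\forall^{\rm st}n)(n\le M)$, $$(\forall x\in X)(\exists i<|\psi_0(M)|)\big(\psi_0(M)(i)\in X\ \wedge\ x\approx\psi_0(M)(i)\big).$$ (c) If $X$ is nonstandard compact and $X$ and its metric are standard, then there is a standard $\psi_0^{0\to\rho^*}$ for which the formula displayed in (b) holds for all $M\in\Omega$, i.e. for all $M^0$ with $\neg{\rm st}(M)$. If $X$ is standard, then 'effectively totally bounded' includes in (a) and (b) that all entries of all $h(k)$ are in $X$, and the $\psi_0$ in (b) and (c) has all entries of all $\psi_0(M)$ in $X$. -/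

import Mathlib

namespace NSArith

/-! Finite types, terms and formulas of the many-sorted language. -/

/-- The finite types: `0`, function types `σ ⇒ τ`, and the type `σ.seq` of finite sequences of
objects of type `σ`. -/
inductive Ty : Type
  | nat : Ty
  | arr : Ty → Ty → Ty
  | seq : Ty → Ty

infixr:60 " ⇒ " => Ty.arr

/-- Type `1`, i.e. `0 → 0`. -/
abbrev Ty.one : Ty := Ty.nat ⇒ Ty.nat

/-- A context lists the types of the variables that may occur free (de Bruijn style). -/
abbrev Ctx : Type := List Ty

/-- `Var Γ σ`: a variable of type `σ` declared in `Γ`. -/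
inductive Var : Ctx → Ty → Type
  | z {Γ : Ctx} {σ : Ty} : Var (σ :: Γ) σ
  | s {Γ : Ctx} {σ τ : Ty} : Var Γ σ → Var (τ :: Γ) σ

/-- The constants: zero, successor, the combinators `Π` and `Σ`, the recursor of type `0` only,
and for finite sequences the length `|s|`, the projection `s(i)`, and the operation
`(n, f) ↦ ⟨f(0), …, f(n-1)⟩`. -/
inductive Con : Ty → Type
  | zero : Con Ty.nat
  | succ : Con (Ty.nat ⇒ Ty.nat)
  | k (σ τ : Ty) : Con (σ ⇒ τ ⇒ σ)
  | s (ρ σ τ : Ty) : Con ((ρ ⇒ σ ⇒ τ) ⇒ (ρ ⇒ σ) ⇒ ρ ⇒ τ)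
  | rec0 : Con (Ty.nat ⇒ Ty.nat ⇒ (Ty.nat ⇒ Ty.nat ⇒ Ty.nat) ⇒ Ty.nat)
  | len (σ : Ty) : Con (σ.seq ⇒ Ty.nat)
  | proj (σ : Ty) : Con (σ.seq ⇒ Ty.nat ⇒ σ)
  | mk (σ : Ty) : Con (Ty.nat ⇒ (Ty.nat ⇒ σ) ⇒ σ.seq)

inductive Tm (Γ : Ctx) : Ty → Type
  | var {σ : Ty} : Var Γ σ → Tm Γ σ
  | con {σ : Ty} : Con σ → Tm Γ σ
  | app {σ τ : Ty} : Tm Γ (σ ⇒ τ) → Tm Γ σ → Tm Γ τ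

infixl:90 " ⬝ₜ " => Tm.app

/-- Formulas of classical logic over `⊥`, `→`, `∀`; the atoms are equations between terms of
type `0` and the standardness predicates `st_σ`. -/
inductive Fml : Ctx → Type
  | bot {Γ : Ctx} : Fml Γ
  | eq {Γ : Ctx} : Tm Γ Ty.nat → Tm Γ Ty.nat → Fml Γ
  | st {Γ : Ctx} {σ : Ty} : Tm Γ σ → Fml Γ
  | imp {Γ : Ctx} : Fml Γ → Fml Γ → Fml Γ
  | all {Γ : Ctx} (σ : Ty) : Fml (σ :: Γ) → Fml Γ

infixr:25 " →ᶠ " => Fml.imp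

/-! Renaming and substitution. -/

abbrev Ren (Γ Δ : Ctx) : Type := ∀ σ : Ty, Var Γ σ → Var Δ σ

abbrev Sub (Γ Δ : Ctx) : Type := ∀ σ : Ty, Var Γ σ → Tm Δ σ

def Ren.wk {Γ : Ctx} {τ : Ty} : Ren Γ (τ :: Γ) := fun _ x => Var.s x

def Ren.lift {Γ Δ : Ctx} {τ : Ty} (r : Ren Γ Δ) : Ren (τ :: Γ) (τ :: Δ)
  | _, Var.z => Var.z
  | _, Var.s x => Var.s (r _ x)

def Tm.ren {Γ Δ : Ctx} (r : Ren Γ Δ) : {σ : Ty} → Tm Γ σ → Tm Δ σ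
  | _, Tm.var x => Tm.var (r _ x)
  | _, Tm.con c => Tm.con c
  | _, Tm.app f a => Tm.app (f.ren r) (a.ren r)

/-- Weakening of a term by one new variable. -/
def Tm.wk {Γ : Ctx} {σ τ : Ty} (t : Tm Γ σ) : Tm (τ :: Γ) σ := t.ren Ren.wk

def Sub.lift {Γ Δ : Ctx} {τ : Ty} (s : Sub Γ Δ) : Sub (τ :: Γ) (τ :: Δ)
  | _, Var.z => Tm.var Var.z
  | _, Var.s x => (s _ x).wk

def Tm.subst {Γ Δ : Ctx} (s : Sub Γ Δ) : {σ : Ty} → Tm Γ σ → Tm Δ σ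
  | _, Tm.var x => s _ x
  | _, Tm.con c => Tm.con c
  | _, Tm.app f a => Tm.app (f.subst s) (a.subst s)

def Fml.ren : {Γ Δ : Ctx} → Ren Γ Δ → Fml Γ → Fml Δ
  | _, _, _, Fml.bot => Fml.bot
  | _, _, r, Fml.eq a b => Fml.eq (a.ren r) (b.ren r)
  | _, _, r, Fml.st a => Fml.st (a.ren r)
  | _, _, r, Fml.imp A B => Fml.imp (A.ren r) (B.ren r)
  | _, _, r, Fml.all σ A => Fml.all σ (A.ren r.lift)

def Fml.subst : {Γ Δ : Ctx} → Sub Γ Δ → Fml Γ → Fml Δ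
  | _, _, _, Fml.bot => Fml.bot
  | _, _, s, Fml.eq a b => Fml.eq (a.subst s) (b.subst s)
  | _, _, s, Fml.st a => Fml.st (a.subst s)
  | _, _, s, Fml.imp A B => Fml.imp (A.subst s) (B.subst s)
  | _, _, s, Fml.all σ A => Fml.all σ (A.subst s.lift)

def Fml.wk {Γ : Ctx} {τ : Ty} (A : Fml Γ) : Fml (τ :: Γ) := A.ren Ren.wk

/-- The substitution of `t` for the last variable. -/
def Sub.one {Γ : Ctx} {τ : Ty} (t : Tm Γ τ) : Sub (τ :: Γ) Γ
  | _, Var.z => t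
  | _, Var.s x => Tm.var x

/-- `A[t]`. -/
def Fml.inst {Γ : Ctx} {τ : Ty} (A : Fml (τ :: Γ)) (t : Tm Γ τ) : Fml Γ := A.subst (Sub.one t)

/-! Defined logical symbols. -/

def Fml.not {Γ : Ctx} (A : Fml Γ) : Fml Γ := A →ᶠ Fml.bot

def Fml.and {Γ : Ctx} (A B : Fml Γ) : Fml Γ := (A →ᶠ B.not).not

infixr:35 " ∧ᶠ " => Fml.and

def Fml.ex {Γ : Ctx} (σ : Ty) (A : Fml (σ :: Γ)) : Fml Γ := (Fml.all σ A.not).not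

/-- The last, the last but one, … variable of a context. -/
abbrev v0 {Γ : Ctx} {a : Ty} : Tm (a :: Γ) a := Tm.var Var.z
abbrev v1 {Γ : Ctx} {a b : Ty} : Tm (b :: a :: Γ) a := Tm.var (Var.s Var.z)
abbrev v2 {Γ : Ctx} {a b c : Ty} : Tm (c :: b :: a :: Γ) a := Tm.var (Var.s (Var.s Var.z))

/-- `(∀^st x^σ) A`. -/
def Fml.allSt {Γ : Ctx} (σ : Ty) (A : Fml (σ :: Γ)) : Fml Γ := Fml.all σ (Fml.st v0 →ᶠ A)

/-- `(∃^st x^σ) A`. -/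
def Fml.exSt {Γ : Ctx} (σ : Ty) (A : Fml (σ :: Γ)) : Fml Γ := Fml.ex σ (Fml.st v0 ∧ᶠ A)

/-- A formula is internal if `st` does not occur in it. -/
def Fml.Internal : {Γ : Ctx} → Fml Γ → Prop
  | _, Fml.bot => True
  | _, Fml.eq _ _ => True
  | _, Fml.st _ => False
  | _, Fml.imp A B => A.Internal ∧ B.Internal
  | _, Fml.all _ A => A.Internal

/-- Quantifier-free internal formulas. -/
def Fml.QF : {Γ : Ctx} → Fml Γ → Prop
  | _, Fml.bot => True
  | _, Fml.eq _ _ => True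
  | _, Fml.st _ => False
  | _, Fml.imp A B => A.QF ∧ B.QF
  | _, Fml.all _ _ => False

/-! Primitive recursive arithmetic by terms. -/

/-- `λ x. t`, by the usual bracket abstraction with the combinators. -/
def Tm.lam {Γ : Ctx} {σ : Ty} : {τ : Ty} → Tm (σ :: Γ) τ → Tm Γ (σ ⇒ τ)
  | _, Tm.var Var.z =>
      Tm.con (Con.s σ (σ ⇒ σ) σ) ⬝ₜ Tm.con (Con.k σ (σ ⇒ σ)) ⬝ₜ Tm.con (Con.k σ σ)
  | τ, Tm.var (Var.s x) => Tm.con (Con.k τ σ) ⬝ₜ Tm.var x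
  | τ, Tm.con c => Tm.con (Con.k τ σ) ⬝ₜ Tm.con c
  | _, Tm.app (σ := ρ) (τ := τ) f a => Tm.con (Con.s σ ρ τ) ⬝ₜ Tm.lam f ⬝ₜ Tm.lam a

section Terms

variable {Γ : Ctx}

def Tm.zero : Tm Γ Ty.nat := Tm.con Con.zero

def Tm.succ (t : Tm Γ Ty.nat) : Tm Γ Ty.nat := Tm.con Con.succ ⬝ₜ t

/-- `rec0 n a f` is the recursor: `rec0 0 a f = a`, `rec0 (n+1) a f = f (rec0 n a f) n`. -/
def Tm.rec0 (n a : Tm Γ Ty.nat) (f : Tm Γ (Ty.nat ⇒ Ty.nat ⇒ Ty.nat)) : Tm Γ Ty.nat :=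
  Tm.con Con.rec0 ⬝ₜ n ⬝ₜ a ⬝ₜ f

/-- Recursion whose step is given by a term in the previous value `v1` and the index `v0`. -/
def Tm.primRec (n a : Tm Γ Ty.nat) (step : Tm (Ty.nat :: Ty.nat :: Γ) Ty.nat) : Tm Γ Ty.nat :=
  Tm.rec0 n a step.lam.lam

/-- `a` if `c = 0`, and `b` otherwise. -/
def Tm.cond (c a b : Tm Γ Ty.nat) : Tm Γ Ty.nat := Tm.primRec c a b.wk.wk

def Tm.pred (n : Tm Γ Ty.nat) : Tm Γ Ty.nat := Tm.primRec n Tm.zero v0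

def Tm.add (a b : Tm Γ Ty.nat) : Tm Γ Ty.nat := Tm.primRec b a (Tm.succ v1)

/-- Truncated subtraction. -/
def Tm.sub (a b : Tm Γ Ty.nat) : Tm Γ Ty.nat := Tm.primRec b a (Tm.pred v1)

def Tm.mul (a b : Tm Γ Ty.nat) : Tm Γ Ty.nat := Tm.primRec b Tm.zero (Tm.add v1 a.wk.wk)

def Tm.pow2 (n : Tm Γ Ty.nat) : Tm Γ Ty.nat := Tm.primRec n (Tm.succ Tm.zero) (Tm.add v1 v1)

/-- Triangular numbers. -/
def Tm.tri (n : Tm Γ Ty.nat) : Tm Γ Ty.nat := Tm.primRec n Tm.zero (Tm.add v1 (Tm.succ v0))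

/-- Cantor's pairing bijection. -/
def Tm.pair (a b : Tm Γ Ty.nat) : Tm Γ Ty.nat := Tm.add (Tm.tri (Tm.add a b)) b

/-- The largest `w` with `tri w ≤ z`. -/
def Tm.diag (z : Tm Γ Ty.nat) : Tm Γ Ty.nat :=
  Tm.primRec z Tm.zero
    (Tm.cond (Tm.sub (Tm.tri (Tm.succ v1)) (Tm.succ v0)) (Tm.succ v1) v1)

def Tm.snd (z : Tm Γ Ty.nat) : Tm Γ Ty.nat := Tm.sub z (Tm.tri (Tm.diag z))

def Tm.fst (z : Tm Γ Ty.nat) : Tm Γ Ty.nat := Tm.sub (Tm.diag z) (Tm.snd z)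

/-- `a ≤ b`. -/
def leF (a b : Tm Γ Ty.nat) : Fml Γ := Fml.eq (Tm.sub a b) Tm.zero

/-- `a < b`. -/
def ltF (a b : Tm Γ Ty.nat) : Fml Γ := leF (Tm.succ a) b

/-! Finite sequences. -/

def Tm.len {σ : Ty} (s : Tm Γ σ.seq) : Tm Γ Ty.nat := Tm.con (Con.len σ) ⬝ₜ s

def Tm.proj {σ : Ty} (s : Tm Γ σ.seq) (i : Tm Γ Ty.nat) : Tm Γ σ := Tm.con (Con.proj σ) ⬝ₜ s ⬝ₜ i

def Tm.mk {σ : Ty} (n : Tm Γ Ty.nat) (f : Tm Γ (Ty.nat ⇒ σ)) : Tm Γ σ.seq :=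
  Tm.con (Con.mk σ) ⬝ₜ n ⬝ₜ f

/-- The zero object of each type. -/
def Tm.default : (σ : Ty) → Tm Γ σ
  | Ty.nat => Tm.zero
  | Ty.arr σ τ => Tm.con (Con.k τ σ) ⬝ₜ Tm.default τ
  | Ty.seq σ => Tm.mk Tm.zero (Tm.con (Con.k σ Ty.nat) ⬝ₜ Tm.default σ)

end Terms

/-- Equality at every type, defined from equality at type `0`: extensionally at function types,
and as equal length with equal entries at sequence types. -/
def eqF : (σ : Ty) → {Γ : Ctx} → Tm Γ σ → Tm Γ σ → Fml Γ
  | Ty.nat, _, a, b => Fml.eq a b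
  | Ty.arr σ τ, _, f, g => Fml.all σ (eqF τ (f.wk ⬝ₜ v0) (g.wk ⬝ₜ v0))
  | Ty.seq σ, _, s, t =>
      Fml.eq s.len t.len ∧ᶠ
        Fml.all Ty.nat (ltF v0 s.wk.len →ᶠ eqF σ (s.wk.proj v0) (t.wk.proj v0))

/-- `x ∈ s`, i.e. `(∃ i < |s|) (s(i) = x)`. -/
def memF {σ : Ty} {Γ : Ctx} (x : Tm Γ σ) (s : Tm Γ σ.seq) : Fml Γ :=
  Fml.ex Ty.nat (ltF v0 s.wk.len ∧ᶠ eqF σ (s.wk.proj v0) x.wk)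

/-! The axioms, in open form with arbitrary terms and parameters. -/

/-- Replacement of the last variable by its successor. -/
def Sub.succ {Γ : Ctx} : Sub (Ty.nat :: Γ) (Ty.nat :: Γ)
  | _, Var.z => Tm.succ v0
  | _, Var.s x => Tm.var (Var.s x)

/-- Replacement of `y` by `F(x)` in a formula in `x, y`. -/
def Sub.choice {Γ : Ctx} {σ τ : Ty} : Sub (τ :: σ :: Γ) (σ :: (σ ⇒ τ) :: Γ)
  | _, Var.z => v1 ⬝ₜ v0
  | _, Var.s Var.z => v0
  | _, Var.s (Var.s x) => Tm.var (Var.s (Var.s x))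

/-- Insertion of an unused variable below the last two. -/
def Ren.under2 {Γ : Ctx} {a b c : Ty} : Ren (a :: b :: Γ) (a :: b :: c :: Γ) := Ren.wk.lift.lift

/-- The system `E-PRA^{ω*}`: equality at type `0`, successor, combinators, the recursor of type
`0`, finite sequences, full extensionality, and quantifier-free induction. -/
inductive EPRA : {Γ : Ctx} → Fml Γ → Prop
  | eq_refl {Γ : Ctx} (a : Tm Γ Ty.nat) : EPRA (Fml.eq a a)
  | eq_eucl {Γ : Ctx} (a b c : Tm Γ Ty.nat) : EPRA (Fml.eq a b →ᶠ Fml.eq a c →ᶠ Fml.eq b c)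
  | ext {Γ : Ctx} {σ τ : Ty} (f : Tm Γ (σ ⇒ τ)) (x y : Tm Γ σ) :
      EPRA (eqF σ x y →ᶠ eqF τ (f ⬝ₜ x) (f ⬝ₜ y))
  | succ_ne_zero {Γ : Ctx} (a : Tm Γ Ty.nat) : EPRA (Fml.eq (Tm.succ a) Tm.zero).not
  | succ_inj {Γ : Ctx} (a b : Tm Γ Ty.nat) :
      EPRA (Fml.eq (Tm.succ a) (Tm.succ b) →ᶠ Fml.eq a b)
  | k {Γ : Ctx} {σ τ : Ty} (x : Tm Γ σ) (y : Tm Γ τ) :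
      EPRA (eqF σ (Tm.con (Con.k σ τ) ⬝ₜ x ⬝ₜ y) x)
  | s {Γ : Ctx} {ρ σ τ : Ty} (x : Tm Γ (ρ ⇒ σ ⇒ τ)) (y : Tm Γ (ρ ⇒ σ)) (z : Tm Γ ρ) :
      EPRA (eqF τ (Tm.con (Con.s ρ σ τ) ⬝ₜ x ⬝ₜ y ⬝ₜ z) (x ⬝ₜ z ⬝ₜ (y ⬝ₜ z)))
  | rec_zero {Γ : Ctx} (a : Tm Γ Ty.nat) (f : Tm Γ (Ty.nat ⇒ Ty.nat ⇒ Ty.nat)) :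
      EPRA (Fml.eq (Tm.rec0 Tm.zero a f) a)
  | rec_succ {Γ : Ctx} (n a : Tm Γ Ty.nat) (f : Tm Γ (Ty.nat ⇒ Ty.nat ⇒ Ty.nat)) :
      EPRA (Fml.eq (Tm.rec0 (Tm.succ n) a f) (f ⬝ₜ Tm.rec0 n a f ⬝ₜ n))
  | len_mk {Γ : Ctx} {σ : Ty} (n : Tm Γ Ty.nat) (f : Tm Γ (Ty.nat ⇒ σ)) :
      EPRA (Fml.eq (Tm.mk n f).len n)
  | proj_mk {Γ : Ctx} {σ : Ty} (n i : Tm Γ Ty.nat) (f : Tm Γ (Ty.nat ⇒ σ)) :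
      EPRA (ltF i n →ᶠ eqF σ ((Tm.mk n f).proj i) (f ⬝ₜ i))
  | proj_default {Γ : Ctx} {σ : Ty} (s : Tm Γ σ.seq) (i : Tm Γ Ty.nat) :
      EPRA (leF s.len i →ᶠ eqF σ (s.proj i) (Tm.default σ))
  | induction {Γ : Ctx} (A : Fml (Ty.nat :: Γ)) (hA : A.QF) :
      EPRA (A.inst Tm.zero →ᶠ Fml.all Ty.nat (A →ᶠ A.subst Sub.succ) →ᶠ Fml.all Ty.nat A)

/-- The system `P₀`: `E-PRA^{ω*}`, the basic axioms on `st`, the Herbrandised axiom of choice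
`HAC_int`, idealisation `I`, and `QF-AC^{1,0}`. There is no external induction and no transfer. -/
inductive P0 : {Γ : Ctx} → Fml Γ → Prop
  | epra {Γ : Ctx} {A : Fml Γ} (h : EPRA A) : P0 A
  | st_eq {Γ : Ctx} {σ : Ty} (x y : Tm Γ σ) : P0 (Fml.st x →ᶠ eqF σ x y →ᶠ Fml.st y)
  | st_con {Γ : Ctx} {σ : Ty} (c : Con σ) : P0 (Fml.st (Tm.con (Γ := Γ) c))
  | st_app {Γ : Ctx} {σ τ : Ty} (f : Tm Γ (σ ⇒ τ)) (x : Tm Γ σ) :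
      P0 (Fml.st f →ᶠ Fml.st x →ᶠ Fml.st (f ⬝ₜ x))
  /-- `(∀^st x)(∃^st y) A(x,y) → (∃^st F)(∀^st x)(∃ y ∈ F(x)) A(x,y)`. -/
  | hac {Γ : Ctx} {ρ τ : Ty} (A : Fml (τ :: ρ :: Γ)) (hA : A.Internal) :
      P0 (Fml.allSt ρ (Fml.exSt τ A) →ᶠ
        Fml.exSt (ρ ⇒ τ.seq)
          (Fml.allSt ρ (Fml.ex τ (memF v0 (v2 ⬝ₜ v1) ∧ᶠ A.ren Ren.under2))))
  /-- `(∀^st x^{σ*})(∃ y)(∀ z ∈ x) A(z,y) → (∃ y)(∀^st x^σ) A(x,y)`. -/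
  | ideal {Γ : Ctx} {σ τ : Ty} (A : Fml (σ :: τ :: Γ)) (hA : A.Internal) :
      P0 (Fml.allSt σ.seq (Fml.ex τ (Fml.all σ (memF v0 v2 →ᶠ A.ren Ren.under2))) →ᶠ
        Fml.ex τ (Fml.allSt σ A))
  | qfac {Γ : Ctx} (A : Fml (Ty.nat :: Ty.one :: Γ)) (hA : A.QF) :
      P0 (Fml.all Ty.one (Fml.ex Ty.nat A) →ᶠ
        Fml.ex (Ty.one ⇒ Ty.nat) (Fml.all Ty.one (A.subst Sub.choice)))

/-- Derivability from the axioms `T` and the hypotheses `H` in classical many-sorted predicate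
logic, by natural deduction. -/
inductive Derives (T : {Γ : Ctx} → Fml Γ → Prop) : {Γ : Ctx} → List (Fml Γ) → Fml Γ → Prop
  | ax {Γ : Ctx} {H : List (Fml Γ)} {A : Fml Γ} : T A → Derives T H A
  | hyp {Γ : Ctx} {H : List (Fml Γ)} {A : Fml Γ} : A ∈ H → Derives T H A
  | impI {Γ : Ctx} {H : List (Fml Γ)} {A B : Fml Γ} :
      Derives T (A :: H) B → Derives T H (A →ᶠ B)
  | impE {Γ : Ctx} {H : List (Fml Γ)} {A B : Fml Γ} :
      Derives T H (A →ᶠ B) → Derives T H A → Derives T H B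
  | raa {Γ : Ctx} {H : List (Fml Γ)} {A : Fml Γ} :
      Derives T (A.not :: H) Fml.bot → Derives T H A
  | allI {Γ : Ctx} {H : List (Fml Γ)} {σ : Ty} {A : Fml (σ :: Γ)} :
      Derives T (H.map Fml.wk) A → Derives T H (Fml.all σ A)
  | allE {Γ : Ctx} {H : List (Fml Γ)} {σ : Ty} {A : Fml (σ :: Γ)} (t : Tm Γ σ) :
      Derives T H (Fml.all σ A) → Derives T H (A.inst t)

/-- `P₀ ⊢ A` for a sentence `A`. -/
def P0Proves (A : Fml []) : Prop := Derives P0 [] A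

/-! Rational and real numbers, and metric spaces, in the language of `P₀`. -/

section Reals

variable {Γ : Ctx}

/-- The code of the rational number `(a - b) / (c + 1)`. Every number is such a code. -/
def qCode (a b c : Tm Γ Ty.nat) : Tm Γ Ty.nat := Tm.pair (Tm.pair a b) c

def qPos (q : Tm Γ Ty.nat) : Tm Γ Ty.nat := Tm.fst (Tm.fst q)

def qNeg (q : Tm Γ Ty.nat) : Tm Γ Ty.nat := Tm.snd (Tm.fst q)

/-- The denominator, which is positive. -/
def qDen (q : Tm Γ Ty.nat) : Tm Γ Ty.nat := Tm.succ (Tm.snd q)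

def qAdd (q r : Tm Γ Ty.nat) : Tm Γ Ty.nat :=
  qCode (Tm.add (Tm.mul (qPos q) (qDen r)) (Tm.mul (qPos r) (qDen q)))
    (Tm.add (Tm.mul (qNeg q) (qDen r)) (Tm.mul (qNeg r) (qDen q)))
    (Tm.pred (Tm.mul (qDen q) (qDen r)))

/-- The two sides of `q ≤ r` after multiplication by both denominators. -/
def qLhs (q r : Tm Γ Ty.nat) : Tm Γ Ty.nat :=
  Tm.add (Tm.mul (qPos q) (qDen r)) (Tm.mul (qNeg r) (qDen q))

/-- A term that vanishes exactly if `q < r`. -/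
def qLtTest (q r : Tm Γ Ty.nat) : Tm Γ Ty.nat := Tm.sub (Tm.succ (qLhs q r)) (qLhs r q)

/-- `q ≤ r` for rationals. -/
def qLe (q r : Tm Γ Ty.nat) : Fml Γ := leF (qLhs q r) (qLhs r q)

/-- The rational number `2^{-n}`. -/
def qTwoNeg (n : Tm Γ Ty.nat) : Tm Γ Ty.nat :=
  qCode (Tm.succ Tm.zero) Tm.zero (Tm.pred (Tm.pow2 n))

/-- The rational number `1/k`, for `k > 0`. -/
def qInv (k : Tm Γ Ty.nat) : Tm Γ Ty.nat := qCode (Tm.succ Tm.zero) Tm.zero (Tm.pred k)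

/-- The largest `m ≤ n` such that `|x(k) - x(k+1)| < 2^{-k-1}` for all `k < m`. -/
def hatIdx (x : Tm Γ Ty.one) (n : Tm Γ Ty.nat) : Tm Γ Ty.nat :=
  Tm.primRec n Tm.zero
    (Tm.cond
      (Tm.add (Tm.add (Tm.sub v1 v0) (Tm.sub v0 v1))
        (Tm.add
          (qLtTest (x.wk.wk ⬝ₜ v0) (qAdd (x.wk.wk ⬝ₜ Tm.succ v0) (qTwoNeg (Tm.succ v0))))
          (qLtTest (x.wk.wk ⬝ₜ Tm.succ v0) (qAdd (x.wk.wk ⬝ₜ v0) (qTwoNeg (Tm.succ v0))))))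
      (Tm.succ v0) v1)

/-- The `n`-th rational approximation `[x](n)` of the real number given by `x^1`. Through this hat
function every `x^1` is a fast converging sequence of rationals, hence a real number. -/
def apx (x : Tm Γ Ty.one) (n : Tm Γ Ty.nat) : Tm Γ Ty.nat := x ⬝ₜ hatIdx x n

/-- A rational as a real number. -/
def realOf (q : Tm Γ Ty.nat) : Tm Γ Ty.one := Tm.lam q.wk

def realZero : Tm Γ Ty.one := realOf (qCode Tm.zero Tm.zero Tm.zero)

def realAdd (x y : Tm Γ Ty.one) : Tm Γ Ty.one :=
  Tm.lam (qAdd (apx x.wk (Tm.succ v0)) (apx y.wk (Tm.succ v0)))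

/-- `x ≤ y` for reals: `[x](n+1) ≤ [y](n+1) + 2^{-n}` for all `n`. -/
def realLe (x y : Tm Γ Ty.one) : Fml Γ :=
  Fml.all Ty.nat
    (qLe (apx x.wk (Tm.succ v0)) (qAdd (apx y.wk (Tm.succ v0)) (qTwoNeg v0)))

def realEq (x y : Tm Γ Ty.one) : Fml Γ := realLe x y ∧ᶠ realLe y x

/-- `x ≈ y` for reals: `|[x](n+1) - [y](n+1)| ≤ 2^{-n}` for all standard `n`. -/
def realApprox (x y : Tm Γ Ty.one) : Fml Γ :=
  Fml.allSt Ty.nat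
    (qLe (apx x.wk (Tm.succ v0)) (qAdd (apx y.wk (Tm.succ v0)) (qTwoNeg v0)) ∧ᶠ
      qLe (apx y.wk (Tm.succ v0)) (qAdd (apx x.wk (Tm.succ v0)) (qTwoNeg v0)))

variable {ρ : Ty}

/-- `x ∈ X`, for a set `X` given by its characteristic function. -/
def inSet (X : Tm Γ (ρ ⇒ Ty.nat)) (x : Tm Γ ρ) : Fml Γ := Fml.eq (X ⬝ₜ x) (Tm.succ Tm.zero)

/-- `(∀ x ∈ X) A`. -/
def allIn (X : Tm Γ (ρ ⇒ Ty.nat)) (A : Fml (ρ :: Γ)) : Fml Γ :=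
  Fml.all ρ (inSet X.wk v0 →ᶠ A)

/-- `d` is a metric on `X`. As usual for spaces of represented objects, equality of the points
`x, y` of the space is by definition `d(x,y) = 0`. -/
def isMetric (X : Tm Γ (ρ ⇒ Ty.nat)) (d : Tm Γ (ρ ⇒ ρ ⇒ Ty.one)) : Fml Γ :=
  allIn X (realEq (d.wk ⬝ₜ v0 ⬝ₜ v0) realZero) ∧ᶠ
  allIn X (allIn X.wk (realEq (d.wk.wk ⬝ₜ v1 ⬝ₜ v0) (d.wk.wk ⬝ₜ v0 ⬝ₜ v1))) ∧ᶠ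
  allIn X (allIn X.wk (allIn X.wk.wk
    (realLe (d.wk.wk.wk ⬝ₜ v2 ⬝ₜ v0)
      (realAdd (d.wk.wk.wk ⬝ₜ v2 ⬝ₜ v1) (d.wk.wk.wk ⬝ₜ v1 ⬝ₜ v0)))))

/-- `x ≈ y` for points of a metric space: `d(x,y) ≈ 0`. -/
def near (d : Tm Γ (ρ ⇒ ρ ⇒ Ty.one)) (x y : Tm Γ ρ) : Fml Γ := realApprox (d ⬝ₜ x ⬝ₜ y) realZero

/-- Nonstandard compactness: `(∀ x ∈ X)(∃^st y ∈ X)(x ≈ y)`. -/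
def nsCompact (X : Tm Γ (ρ ⇒ Ty.nat)) (d : Tm Γ (ρ ⇒ ρ ⇒ Ty.one)) : Fml Γ :=
  allIn X (Fml.exSt ρ (inSet X.wk.wk v0 ∧ᶠ near d.wk.wk v1 v0))

/-- `h : 0 → X*`, i.e. all entries of all `h(k)` are in `X`. -/
def valuesIn (X : Tm Γ (ρ ⇒ Ty.nat)) (h : Tm Γ (Ty.nat ⇒ ρ.seq)) : Fml Γ :=
  Fml.all Ty.nat (Fml.all Ty.nat
    (ltF v0 (h.wk.wk ⬝ₜ v1).len →ᶠ inSet X.wk.wk ((h.wk.wk ⬝ₜ v1).proj v0)))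

/-- `(∀ x ∈ X)(∃ i < |s|)(s(i) ∈ X ∧ d(x, s(i)) ≤ 1/k)`. -/
def isNet (X : Tm Γ (ρ ⇒ Ty.nat)) (d : Tm Γ (ρ ⇒ ρ ⇒ Ty.one)) (s : Tm Γ ρ.seq)
    (k : Tm Γ Ty.nat) : Fml Γ :=
  allIn X (Fml.ex Ty.nat (ltF v0 s.wk.wk.len ∧ᶠ inSet X.wk.wk (s.wk.wk.proj v0) ∧ᶠ
    realLe (d.wk.wk ⬝ₜ v1 ⬝ₜ s.wk.wk.proj v0) (realOf (qInv k.wk.wk))))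

/-- `(∀ x ∈ X)(∃ i < |s|)(s(i) ∈ X ∧ x ≈ s(i))`. -/
def isInfNet (X : Tm Γ (ρ ⇒ Ty.nat)) (d : Tm Γ (ρ ⇒ ρ ⇒ Ty.one)) (s : Tm Γ ρ.seq) : Fml Γ :=
  allIn X (Fml.ex Ty.nat (ltF v0 s.wk.wk.len ∧ᶠ inSet X.wk.wk (s.wk.wk.proj v0) ∧ᶠ
    near d.wk.wk v1 (s.wk.wk.proj v0)))

/-- Effective total boundedness: there is a standard `h` such that, for every standard `k > 0`,
`h(k)` is a net of mesh `1/k`. If `X` is standard, then moreover `h : 0 → X*`. -/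
def effTotallyBounded (X : Tm Γ (ρ ⇒ Ty.nat)) (d : Tm Γ (ρ ⇒ ρ ⇒ Ty.one)) : Fml Γ :=
  Fml.exSt (Ty.nat ⇒ ρ.seq)
    ((Fml.st X.wk →ᶠ valuesIn X.wk v0) ∧ᶠ
      Fml.allSt Ty.nat (ltF Tm.zero v0 →ᶠ isNet X.wk.wk d.wk.wk (v1 ⬝ₜ v0) v0))

/-- `M` exceeds all standard numbers. -/
def exceedsStandard (M : Tm Γ Ty.nat) : Fml Γ := Fml.allSt Ty.nat (leF v0 M.wk)

/-- There is a standard `ψ` such that `ψ(M)` is a net of infinitesimal mesh for all `M` that exceed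
all standard numbers. If `X` is standard, then moreover `ψ : 0 → X*`. -/
def gridLarge (X : Tm Γ (ρ ⇒ Ty.nat)) (d : Tm Γ (ρ ⇒ ρ ⇒ Ty.one)) : Fml Γ :=
  Fml.exSt (Ty.nat ⇒ ρ.seq)
    ((Fml.st X.wk →ᶠ valuesIn X.wk v0) ∧ᶠ
      Fml.all Ty.nat (exceedsStandard v0 →ᶠ isInfNet X.wk.wk d.wk.wk (v1 ⬝ₜ v0)))

/-- The same for all `M ∈ Ω`, i.e. for all nonstandard `M`. -/
def gridOmega (X : Tm Γ (ρ ⇒ Ty.nat)) (d : Tm Γ (ρ ⇒ ρ ⇒ Ty.one)) : Fml Γ :=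
  Fml.exSt (Ty.nat ⇒ ρ.seq)
    ((Fml.st X.wk →ᶠ valuesIn X.wk v0) ∧ᶠ
      Fml.all Ty.nat ((Fml.st v0).not →ᶠ isInfNet X.wk.wk d.wk.wk (v1 ⬝ₜ v0)))

end Reals

end NSArith

open NSArith

namespace NSArith

/-! Substitution calculus. -/

/-! The argument is semantic. `exists_model_of_not_derives` is a Henkin completeness theorem for the
many-sorted calculus, and `P0Proves.of_models` adds a quotient by extensional equality, so that it
suffices to argue in models `M` where defined equality is identity. There the numbers `M.N` form a
discretely ordered semiring, codes of rationals have values in an ordered field `M.Q`, and distances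
are handled through their rational upper bounds. Only quantifier-free induction and recursion of
type 0 are available; bounded search (`Struc.mu`) turns bounded quantifiers into equations.

(a) If every x in X has a standard y ≈ x in X, then for standard k > 0 every x has a standard y in X
within 1/k, and idealisation, read contrapositively, collects such y into one standard finite
sequence. Herbrandised choice then gives a standard functional with finitely many candidate nets for
each k, which are flattened into one sequence (`Struc.exists_nets_of_nsCompact`).

(b) Let s(m) collect the entries of h(0), …, h(m). For fixed x, the statement that some entry of
h(k) lies in X at approximate distance at most 2/k from x is quantifier-free and true for all
standard k > 0. By overspill it holds for some infinite k ≤ m, and the entry found is infinitely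
close to x (`Struc.exists_near`, `Struc.exists_grid`).

(c) Without external induction a nonstandard number m may lie below a standard n. If there is no
such m, all nonstandard numbers are infinite and (b) applies. If there is one, a constant ψ₀ works.
For suppose that no standard sequence in X were an infinitesimal net. Then standard search would
produce a standard sequence of points, those with indices 0, …, n lying in X and being pairwise
separated by a standard 3/K. A standard y infinitely close to the m-th point singles out m as the
least index whose point is approximately close to y. Such a least index is the value of a term with
standard parameters, hence standard: a contradiction (`Struc.Metric.st_of_separated`,
`Struc.Metric.exists_st_infNet`). -/

theorem Tm.ren_eq_subst {Γ Δ : Ctx} (r : Ren Γ Δ) {σ : Ty} (t : Tm Γ σ) :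
    t.ren r = t.subst (fun _ x => Tm.var (r _ x)) := by
  induction t with
  | var x => rfl
  | con c => rfl
  | app f a hf ha => simp [Tm.ren, Tm.subst, hf, ha]

theorem Sub.lift_var {Γ Δ : Ctx} {τ : Ty} (r : Ren Γ Δ) :
    (Sub.lift (τ := τ) (fun _ x => Tm.var (r _ x)) : Sub (τ :: Γ) (τ :: Δ)) =
      fun _ x => Tm.var (r.lift _ x) := by
  funext σ x
  cases x <;> rfl

theorem Fml.ren_eq_subst {Γ Δ : Ctx} (r : Ren Γ Δ) (A : Fml Γ) :
    A.ren r = A.subst (fun _ x => Tm.var (r _ x)) := by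
  induction A generalizing Δ with
  | bot => rfl
  | eq a b => simp [Fml.ren, Fml.subst, Tm.ren_eq_subst]
  | st a => simp [Fml.ren, Fml.subst, Tm.ren_eq_subst]
  | imp A B hA hB => simp [Fml.ren, Fml.subst, hA, hB]
  | all σ A hA => simp [Fml.ren, Fml.subst, hA, Sub.lift_var]

/-- Composition of substitutions. -/
def Sub.comp {Γ Δ Θ : Ctx} (s : Sub Γ Δ) (t : Sub Δ Θ) : Sub Γ Θ := fun _ x => (s _ x).subst t

/-- The substitution of `a` for the last variable and of `s` for the others. -/
def Sub.cons {Γ Δ : Ctx} {τ : Ty} (a : Tm Δ τ) (s : Sub Γ Δ) : Sub (τ :: Γ) Δ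
  | _, Var.z => a
  | _, Var.s x => s _ x

theorem Tm.subst_subst {Γ Δ Θ : Ctx} (s : Sub Γ Δ) (t : Sub Δ Θ) {σ : Ty} (a : Tm Γ σ) :
    (a.subst s).subst t = a.subst (s.comp t) := by
  induction a with
  | var x => rfl
  | con c => rfl
  | app f a hf ha => simp [Tm.subst, hf, ha]

theorem Tm.subst_var {Γ : Ctx} {σ : Ty} (a : Tm Γ σ) : a.subst (fun _ x => Tm.var x) = a := by
  induction a with
  | var x => rfl
  | con c => rfl
  | app f a hf ha => simp [Tm.subst, hf, ha]

theorem Tm.wk_eq_subst {Γ : Ctx} {σ τ : Ty} (t : Tm Γ σ) :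
    (t.wk : Tm (τ :: Γ) σ) = t.subst (fun _ x => Tm.var (Var.s x)) :=
  Tm.ren_eq_subst _ t

theorem Fml.wk_eq_subst {Γ : Ctx} {τ : Ty} (A : Fml Γ) :
    (A.wk : Fml (τ :: Γ)) = A.subst (fun _ x => Tm.var (Var.s x)) :=
  Fml.ren_eq_subst _ A

theorem Tm.wk_subst {Γ Δ : Ctx} {σ τ : Ty} (s : Sub (τ :: Γ) Δ) (t : Tm Γ σ) :
    (t.wk : Tm (τ :: Γ) σ).subst s = t.subst (fun _ x => s _ (Var.s x)) := by
  rw [Tm.wk_eq_subst, Tm.subst_subst]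
  rfl

theorem Tm.wk_subst_lift {Γ Δ : Ctx} {σ τ : Ty} (s : Sub Γ Δ) (t : Tm Γ σ) :
    (t.wk : Tm (τ :: Γ) σ).subst s.lift = (t.subst s).wk := by
  rw [Tm.wk_subst, Tm.wk_eq_subst, Tm.subst_subst]
  congr 1
  funext σ x
  exact Tm.wk_eq_subst _

theorem Sub.lift_comp_lift {Γ Δ Θ : Ctx} {τ : Ty} (s : Sub Γ Δ) (t : Sub Δ Θ) :
    (Sub.lift (τ := τ) s).comp t.lift = (s.comp t).lift := by
  funext σ x
  cases x with
  | z => rfl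
  | s x => exact Tm.wk_subst_lift t (s _ x)

theorem Fml.subst_subst {Γ Δ Θ : Ctx} (s : Sub Γ Δ) (t : Sub Δ Θ) (A : Fml Γ) :
    (A.subst s).subst t = A.subst (s.comp t) := by
  induction A generalizing Δ Θ with
  | bot => rfl
  | eq a b => simp [Fml.subst, Tm.subst_subst]
  | st a => simp [Fml.subst, Tm.subst_subst]
  | imp A B hA hB => simp [Fml.subst, hA, hB]
  | all σ A hA => simp [Fml.subst, hA, Sub.lift_comp_lift]

theorem Sub.lift_id {Γ : Ctx} {τ : Ty} :
    (Sub.lift (fun _ x => Tm.var x) : Sub (τ :: Γ) (τ :: Γ)) = fun _ x => Tm.var x := by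
  funext σ x
  cases x <;> rfl

theorem Fml.subst_var {Γ : Ctx} (A : Fml Γ) : A.subst (fun _ x => Tm.var x) = A := by
  induction A with
  | bot => rfl
  | eq a b => simp [Fml.subst, Tm.subst_var]
  | st a => simp [Fml.subst, Tm.subst_var]
  | imp A B hA hB => simp [Fml.subst, hA, hB]
  | all σ A hA => simp [Fml.subst, hA, Sub.lift_id]

theorem Sub.lift_comp_one {Γ Δ : Ctx} {τ : Ty} (s : Sub Γ Δ) (t : Tm Δ τ) :
    (Sub.lift s).comp (Sub.one t) = Sub.cons t s := by
  funext σ x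
  cases x with
  | z => rfl
  | s x => exact (Tm.wk_subst _ _).trans (Tm.subst_var _)

theorem Sub.one_comp {Γ Δ : Ctx} {τ : Ty} (s : Sub Γ Δ) (t : Tm Γ τ) :
    (Sub.one t).comp s = Sub.cons (t.subst s) s := by
  funext σ x
  cases x <;> rfl

theorem Fml.subst_lift_inst {Γ Δ : Ctx} {τ : Ty} (s : Sub Γ Δ) (A : Fml (τ :: Γ)) (t : Tm Δ τ) :
    (A.subst s.lift).inst t = A.subst (Sub.cons t s) := by
  rw [Fml.inst, Fml.subst_subst, Sub.lift_comp_one]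

theorem Fml.inst_subst {Γ Δ : Ctx} {τ : Ty} (s : Sub Γ Δ) (A : Fml (τ :: Γ)) (t : Tm Γ τ) :
    (A.inst t).subst s = (A.subst s.lift).inst (t.subst s) := by
  rw [Fml.subst_lift_inst, Fml.inst, Fml.subst_subst, Sub.one_comp]

theorem Fml.QF.subst {Γ Δ : Ctx} (s : Sub Γ Δ) {A : Fml Γ} (h : A.QF) : (A.subst s).QF := by
  induction A generalizing Δ with
  | bot => trivial
  | eq a b => trivial
  | st a => exact h.elim
  | imp A B hA hB => exact ⟨hA s h.1, hB s h.2⟩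
  | all σ A hA => exact h.elim

theorem Fml.Internal.subst {Γ Δ : Ctx} (s : Sub Γ Δ) {A : Fml Γ} (h : A.Internal) :
    (A.subst s).Internal := by
  induction A generalizing Δ with
  | bot => trivial
  | eq a b => trivial
  | st a => exact h.elim
  | imp A B hA hB => exact ⟨hA s h.1, hB s h.2⟩
  | all σ A hA => exact hA _ h

/-! The axioms are closed under substitution. -/

section Subst

variable {Γ Δ : Ctx} (s : Sub Γ Δ)

@[simp] theorem Tm.subst_app {σ τ : Ty} (f : Tm Γ (σ ⇒ τ)) (a : Tm Γ σ) :
    (f ⬝ₜ a).subst s = f.subst s ⬝ₜ a.subst s := rfl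

@[simp] theorem Tm.subst_con {σ : Ty} (c : Con σ) : (Tm.con c).subst s = Tm.con c := rfl

@[simp] theorem Tm.subst_zero : (Tm.zero : Tm Γ Ty.nat).subst s = Tm.zero := rfl

@[simp] theorem Tm.subst_len {σ : Ty} (a : Tm Γ σ.seq) : a.len.subst s = (a.subst s).len := rfl

@[simp] theorem Tm.subst_proj {σ : Ty} (a : Tm Γ σ.seq) (i : Tm Γ Ty.nat) :
    (a.proj i).subst s = (a.subst s).proj (i.subst s) := rfl

@[simp] theorem Tm.subst_mk {σ : Ty} (n : Tm Γ Ty.nat) (f : Tm Γ (Ty.nat ⇒ σ)) :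
    (Tm.mk n f).subst s = Tm.mk (n.subst s) (f.subst s) := rfl

@[simp] theorem Fml.subst_eq (a b : Tm Γ Ty.nat) :
    (Fml.eq a b).subst s = Fml.eq (a.subst s) (b.subst s) := rfl

@[simp] theorem Fml.subst_st {σ : Ty} (a : Tm Γ σ) :
    (Fml.st a).subst s = Fml.st (a.subst s) := rfl

@[simp] theorem Fml.subst_imp (A B : Fml Γ) :
    (A →ᶠ B).subst s = (A.subst s →ᶠ B.subst s) := rfl

@[simp] theorem Fml.subst_and (A B : Fml Γ) :
    (A ∧ᶠ B).subst s = (A.subst s ∧ᶠ B.subst s) := rfl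

@[simp] theorem Fml.subst_all {σ : Ty} (A : Fml (σ :: Γ)) :
    (Fml.all σ A).subst s = Fml.all σ (A.subst s.lift) := rfl

@[simp] theorem Fml.subst_ex {σ : Ty} (A : Fml (σ :: Γ)) :
    (Fml.ex σ A).subst s = Fml.ex σ (A.subst s.lift) := rfl

@[simp] theorem Fml.subst_allSt {σ : Ty} (A : Fml (σ :: Γ)) :
    (Fml.allSt σ A).subst s = Fml.allSt σ (A.subst s.lift) := rfl

@[simp] theorem Fml.subst_exSt {σ : Ty} (A : Fml (σ :: Γ)) :
    (Fml.exSt σ A).subst s = Fml.exSt σ (A.subst s.lift) := rfl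

@[simp] theorem leF_subst (a b : Tm Γ Ty.nat) :
    (leF a b).subst s = leF (a.subst s) (b.subst s) := rfl

@[simp] theorem ltF_subst (a b : Tm Γ Ty.nat) :
    (ltF a b).subst s = ltF (a.subst s) (b.subst s) := rfl

@[simp] theorem Tm.default_subst (σ : Ty) :
    (Tm.default σ : Tm Γ σ).subst s = Tm.default σ := by
  induction σ with
  | nat => rfl
  | arr σ τ _ h => simp [Tm.default, h]
  | seq σ h => simp [Tm.default, h]

@[simp] theorem Sub.lift_z {τ : Ty} : (Sub.lift s : Sub (τ :: Γ) (τ :: Δ)) _ Var.z = v0 := rfl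

@[simp] theorem Sub.lift_s {σ τ : Ty} (x : Var Γ σ) :
    (Sub.lift s : Sub (τ :: Γ) (τ :: Δ)) _ (Var.s x) = (s _ x).wk := rfl

@[simp] theorem Tm.subst_of_var {σ : Ty} (x : Var Γ σ) : (Tm.var x).subst s = s _ x := rfl

@[simp] theorem Tm.wk_var {σ τ : Ty} (x : Var Γ σ) :
    ((Tm.var x).wk : Tm (τ :: Γ) σ) = Tm.var (Var.s x) := rfl

theorem eqF_subst (σ : Ty) {Γ Δ : Ctx} (s : Sub Γ Δ) (a b : Tm Γ σ) :
    (eqF σ a b).subst s = eqF σ (a.subst s) (b.subst s) := by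
  induction σ generalizing Γ Δ with
  | nat => rfl
  | arr σ τ _ h => simp [eqF, h, Tm.wk_subst_lift]
  | seq σ h => simp [eqF, h, Tm.wk_subst_lift]

theorem memF_subst {σ : Ty} (x : Tm Γ σ) (a : Tm Γ σ.seq) :
    (memF x a).subst s = memF (x.subst s) (a.subst s) := by
  simp [memF, eqF_subst, Tm.wk_subst_lift]

end Subst

theorem EPRA.subst {Γ Δ : Ctx} (s : Sub Γ Δ) {A : Fml Γ} (h : EPRA A) : EPRA (A.subst s) := by
  cases h with
  | eq_refl a => exact EPRA.eq_refl _
  | eq_eucl a b c => exact EPRA.eq_eucl _ _ _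
  | ext f x y => simpa [eqF_subst] using EPRA.ext _ _ _
  | succ_ne_zero a => exact EPRA.succ_ne_zero _
  | succ_inj a b => exact EPRA.succ_inj _ _
  | k x y => simpa [eqF_subst] using EPRA.k _ _
  | s x y z => simpa [eqF_subst] using EPRA.s _ _ _
  | rec_zero a f => exact EPRA.rec_zero _ _
  | rec_succ n a f => exact EPRA.rec_succ _ _ _
  | len_mk n f => exact EPRA.len_mk _ _
  | proj_mk n i f => simpa [eqF_subst] using EPRA.proj_mk _ _ _
  | proj_default a i => simpa [eqF_subst] using EPRA.proj_default _ _
  | induction A hA =>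
    have h := EPRA.induction (A.subst s.lift) (hA.subst _)
    have e : (A.subst Sub.succ).subst s.lift = (A.subst s.lift).subst Sub.succ := by
      rw [Fml.subst_subst, Fml.subst_subst]
      congr 1
      funext σ x
      cases x with
      | z => rfl
      | s x =>
        simp only [Sub.comp, Sub.lift_s]
        rw [Tm.wk_subst]
        exact Tm.wk_eq_subst _
    simpa [Fml.inst_subst, e] using h

theorem Fml.under2_subst {Γ Δ : Ctx} {a b c : Ty} (s : Sub Γ Δ) (A : Fml (a :: b :: Γ)) :
    (A.ren (Ren.under2 (c := c))).subst s.lift.lift.lift =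
      (A.subst s.lift.lift).ren Ren.under2 := by
  rw [Fml.ren_eq_subst, Fml.ren_eq_subst, Fml.subst_subst, Fml.subst_subst]
  congr 1
  funext σ x
  rcases x with _ | _ | x
  · rfl
  · rfl
  · simp only [Sub.comp, Sub.lift_s, Ren.under2]
    rw [Tm.wk_subst, Tm.wk_subst]
    simp only [Tm.subst, Ren.lift, Ren.wk, Sub.lift_s, Tm.wk_eq_subst, Tm.subst_subst]
    rfl

/-- The truth of an axiom in the term model, at an environment of terms, amounts to the derivability
of its substitution instances. Closure under substitution makes these instances axioms again. -/
theorem P0.subst {Γ Δ : Ctx} (s : Sub Γ Δ) {A : Fml Γ} (h : P0 A) : P0 (A.subst s) := by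
  cases h with
  | epra h => exact P0.epra (h.subst s)
  | st_eq x y => simpa [eqF_subst] using P0.st_eq _ _
  | st_con c => exact P0.st_con c
  | st_app f x => exact P0.st_app _ _
  | hac A hA =>
    simpa [memF_subst, Fml.under2_subst] using P0.hac (A.subst s.lift.lift) (hA.subst _)
  | ideal A hA =>
    simpa [memF_subst, Fml.under2_subst] using P0.ideal (A.subst s.lift.lift) (hA.subst _)
  | qfac A hA =>
    have h := P0.qfac (A.subst s.lift.lift) (hA.subst _)
    have e : (A.subst Sub.choice).subst s.lift.lift = (A.subst s.lift.lift).subst Sub.choice := by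
      rw [Fml.subst_subst, Fml.subst_subst]
      congr 1
      funext σ x
      rcases x with _ | _ | x
      · rfl
      · rfl
      · simp only [Sub.comp, Sub.lift_s, Sub.choice, Tm.subst_of_var]
        rw [Tm.wk_subst, Tm.wk_subst]
        simp only [Tm.wk_eq_subst, Tm.subst_subst]
        rfl
    simpa [e] using h

/-! Countability of the language. -/

def Ty.code : Ty → ℕ
  | Ty.nat => 0
  | Ty.arr σ τ => 2 * Nat.pair σ.code τ.code + 1
  | Ty.seq σ => 2 * σ.code + 2

theorem Ty.code_injective : Function.Injective Ty.code := by
  intro a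
  induction a with
  | nat => intro b h; cases b <;> simp [Ty.code] at h ⊢
  | arr σ τ hσ hτ =>
    intro b h
    cases b with
    | nat => simp [Ty.code] at h
    | arr σ' τ' =>
      have h' : Nat.pair σ.code τ.code = Nat.pair σ'.code τ'.code := by
        simp only [Ty.code] at h; omega
      obtain ⟨h1, h2⟩ := Nat.pair_eq_pair.1 h'
      rw [hσ h1, hτ h2]
    | seq σ' => simp only [Ty.code] at h; omega
  | seq σ hσ =>
    intro b h
    cases b with
    | nat => simp [Ty.code] at h
    | arr σ' τ' => simp only [Ty.code] at h; omega
    | seq σ' =>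
      have h' : σ.code = σ'.code := by simp only [Ty.code] at h; omega
      rw [hσ h']

instance : Countable Ty := Ty.code_injective.countable

instance : Inhabited Ty := ⟨Ty.nat⟩

def Var.pred? {Γ : Ctx} {σ τ : Ty} : Var (τ :: Γ) σ → Option (Var Γ σ)
  | Var.z => none
  | Var.s x => some x

instance Var.instCountable (Γ : Ctx) (σ : Ty) : Countable (Var Γ σ) := by
  induction Γ with
  | nil => exact @Finite.to_countable _ (@Finite.of_subsingleton _ ⟨fun x => by cases x⟩)
  | cons τ Γ h =>
    refine Function.Injective.countable (f := Var.pred?) ?_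
    intro x y hxy
    cases x <;> cases y <;> simp_all [Var.pred?]

def Con.ofCode : ℕ × Ty × Ty × Ty → Σ σ, Con σ
  | (0, _, _, _) => ⟨_, Con.zero⟩
  | (1, _, _, _) => ⟨_, Con.succ⟩
  | (2, a, b, _) => ⟨_, Con.k a b⟩
  | (3, a, b, c) => ⟨_, Con.s a b c⟩
  | (4, _, _, _) => ⟨_, Con.rec0⟩
  | (5, a, _, _) => ⟨_, Con.len a⟩
  | (6, a, _, _) => ⟨_, Con.proj a⟩
  | (_, a, _, _) => ⟨_, Con.mk a⟩

theorem Con.ofCode_surjective : Function.Surjective Con.ofCode := by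
  rintro ⟨_, c⟩
  cases c with
  | zero => exact ⟨(0, default, default, default), rfl⟩
  | succ => exact ⟨(1, default, default, default), rfl⟩
  | k a b => exact ⟨(2, a, b, default), rfl⟩
  | s a b c => exact ⟨(3, a, b, c), rfl⟩
  | rec0 => exact ⟨(4, default, default, default), rfl⟩
  | len a => exact ⟨(5, a, default, default), rfl⟩
  | proj a => exact ⟨(6, a, default, default), rfl⟩
  | mk a => exact ⟨(7, a, default, default), rfl⟩

instance (σ : Ty) : Countable (Con σ) := by
  have : Countable (Σ σ, Con σ) := Con.ofCode_surjective.countable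
  exact (sigma_mk_injective (i := σ)).countable

def Tm.depth {Γ : Ctx} {σ : Ty} : Tm Γ σ → ℕ
  | Tm.var _ => 0
  | Tm.con _ => 0
  | Tm.app f a => max f.depth a.depth + 1

/-- An application hides the argument type, so terms of bounded depth are a union over the countably
many possible hidden types of images of countable sets. -/
theorem Tm.countable_depth (Γ : Ctx) (n : ℕ) (σ : Ty) :
    {t : Tm Γ σ | t.depth < n}.Countable := by
  induction n generalizing σ with
  | zero => simp
  | succ n ih =>
    refine Set.Countable.mono (s₂ := (Set.range Tm.var ∪ Set.range Tm.con) ∪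
      ⋃ τ : Ty, Set.image2 Tm.app {t : Tm Γ (τ ⇒ σ) | t.depth < n} {t : Tm Γ τ | t.depth < n}) ?_
      (((Set.countable_range _).union (Set.countable_range _)).union
        (Set.countable_iUnion fun τ => (ih _).image2 (ih _) _))
    intro t ht
    cases t with
    | var x => exact Or.inl (Or.inl ⟨x, rfl⟩)
    | con c => exact Or.inl (Or.inr ⟨c, rfl⟩)
    | app f a =>
      simp only [Set.mem_ofPred_eq, Tm.depth] at ht
      exact Or.inr (Set.mem_iUnion.2 ⟨_, f, by simp only [Set.mem_ofPred_eq]; omega, a,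
        by simp only [Set.mem_ofPred_eq]; omega, rfl⟩)

instance (Γ : Ctx) (σ : Ty) : Countable (Tm Γ σ) := by
  rw [← Set.countable_univ_iff]
  refine (Set.countable_iUnion fun n => Tm.countable_depth Γ n σ).mono fun t _ => ?_
  exact Set.mem_iUnion.2 ⟨t.depth + 1, Nat.lt_succ_self _⟩

def Fml.depth : {Γ : Ctx} → Fml Γ → ℕ
  | _, Fml.bot => 0
  | _, Fml.eq _ _ => 0
  | _, Fml.st _ => 0
  | _, Fml.imp A B => max A.depth B.depth + 1
  | _, Fml.all _ A => A.depth + 1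

theorem Fml.countable_depth (n : ℕ) (Γ : Ctx) : {A : Fml Γ | A.depth < n}.Countable := by
  induction n generalizing Γ with
  | zero => simp
  | succ n ih =>
    refine Set.Countable.mono (s₂ := (({Fml.bot} ∪ Set.image2 Fml.eq Set.univ Set.univ) ∪
        ⋃ σ : Ty, Set.range (Fml.st (σ := σ))) ∪
      (Set.image2 Fml.imp {A : Fml Γ | A.depth < n} {A : Fml Γ | A.depth < n} ∪
        ⋃ σ : Ty, Fml.all σ '' {A : Fml (σ :: Γ) | A.depth < n})) ?_
      ((((Set.countable_singleton _).union
        ((Set.countable_univ).image2 Set.countable_univ _)).union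
        (Set.countable_iUnion fun σ => Set.countable_range _)).union
        (((ih _).image2 (ih _) _).union (Set.countable_iUnion fun σ => (ih _).image _)))
    intro A hA
    cases A with
    | bot => exact Or.inl (Or.inl (Or.inl rfl))
    | eq a b => exact Or.inl (Or.inl (Or.inr ⟨a, trivial, b, trivial, rfl⟩))
    | st a => exact Or.inl (Or.inr (Set.mem_iUnion.2 ⟨_, a, rfl⟩))
    | imp A B =>
      simp only [Set.mem_ofPred_eq, Fml.depth] at hA
      exact Or.inr (Or.inl ⟨A, by simp only [Set.mem_ofPred_eq]; omega, B,
        by simp only [Set.mem_ofPred_eq]; omega, rfl⟩)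
    | all σ A =>
      simp only [Set.mem_ofPred_eq, Fml.depth] at hA
      exact Or.inr (Or.inr (Set.mem_iUnion.2 ⟨σ, A, by simp only [Set.mem_ofPred_eq]; omega, rfl⟩))

instance (Γ : Ctx) : Countable (Fml Γ) := by
  rw [← Set.countable_univ_iff]
  refine (Set.countable_iUnion fun n => Fml.countable_depth n Γ).mono fun A _ => ?_
  exact Set.mem_iUnion.2 ⟨A.depth + 1, Nat.lt_succ_self _⟩

/-! Structures for the language. -/

/-- A structure; equality at type `0` may be interpreted by any relation. -/
structure Struc where
  carrier : Ty → Type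
  app : {σ τ : Ty} → carrier (σ ⇒ τ) → carrier σ → carrier τ
  con : {σ : Ty} → Con σ → carrier σ
  eq : carrier Ty.nat → carrier Ty.nat → Prop
  st : {σ : Ty} → carrier σ → Prop

abbrev Struc.Env (M : Struc) (Γ : Ctx) : Type := ∀ σ : Ty, Var Γ σ → M.carrier σ

def Struc.nil (M : Struc) : M.Env [] := fun _ x => nomatch x

def Struc.cons {M : Struc} {Γ : Ctx} {σ : Ty} (a : M.carrier σ) (e : M.Env Γ) : M.Env (σ :: Γ)
  | _, Var.z => a
  | _, Var.s x => e _ x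

infixr:67 " ∷ " => Struc.cons

def Tm.eval (M : Struc) {Γ : Ctx} (e : M.Env Γ) : {σ : Ty} → Tm Γ σ → M.carrier σ
  | _, Tm.var x => e _ x
  | _, Tm.con c => M.con c
  | _, Tm.app f a => M.app (f.eval M e) (a.eval M e)

def Fml.eval (M : Struc) : {Γ : Ctx} → M.Env Γ → Fml Γ → Prop
  | _, _, Fml.bot => False
  | _, e, Fml.eq a b => M.eq (a.eval M e) (b.eval M e)
  | _, e, Fml.st a => M.st (a.eval M e)
  | _, e, Fml.imp A B => A.eval M e → B.eval M e
  | _, e, Fml.all σ A => ∀ a : M.carrier σ, A.eval M (a ∷ e)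

/-- `M` satisfies all instances of the axioms `T`. -/
def Struc.Models (M : Struc) (T : {Γ : Ctx} → Fml Γ → Prop) : Prop :=
  ∀ {Γ : Ctx} (A : Fml Γ), T A → ∀ e : M.Env Γ, A.eval M e

/-! The completeness theorem. -/

section Completeness

variable {T : {Γ : Ctx} → Fml Γ → Prop}

theorem Derives.mono {Γ : Ctx} {H H' : List (Fml Γ)} {A : Fml Γ} (h : Derives T H A)
    (hH : H ⊆ H') : Derives T H' A := by
  induction h with
  | ax h => exact Derives.ax h
  | hyp h => exact Derives.hyp (hH h)
  | impI _ ih => exact Derives.impI (ih (List.cons_subset_cons _ hH))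
  | impE _ _ ih₁ ih₂ => exact Derives.impE (ih₁ hH) (ih₂ hH)
  | raa _ ih => exact Derives.raa (ih (List.cons_subset_cons _ hH))
  | allI _ ih => exact Derives.allI (ih (List.map_subset _ hH))
  | allE t _ ih => exact Derives.allE t (ih hH)

theorem Derives.exfalso {Γ : Ctx} {H : List (Fml Γ)} {A : Fml Γ} (h : Derives T H Fml.bot) :
    Derives T H A :=
  Derives.raa (h.mono (List.subset_cons_self _ _))

/-- Every type has a closed term, so a fresh variable cannot produce a contradiction: it could be
generalised and then instantiated by `Tm.default`. -/
theorem not_derives_map_wk {Γ : Ctx} {σ : Ty} {H : List (Fml Γ)} (h : ¬ Derives T H Fml.bot) :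
    ¬ Derives T (H.map (Fml.wk (τ := σ))) Fml.bot :=
  fun h' => h (Derives.allE (Tm.default σ) (Derives.allI h'))

/-- The fresh variable serves as the counterexample when a universal formula over its type is
refuted; in all other cases it is idle. -/
theorem henkin_step {Γ : Ctx} {H : List (Fml Γ)} (hH : ¬ Derives T H Fml.bot) (B : Fml Γ)
    (σ : Ty) : ∃ H' : List (Fml (σ :: Γ)), ¬ Derives T H' Fml.bot ∧ (∀ A ∈ H, A.wk ∈ H') ∧
      (B.wk ∈ H' ∨ B.not.wk ∈ H') ∧
      ∀ A : Fml (σ :: Γ), B = Fml.all σ A → B.not.wk ∈ H' → A.not ∈ H' := by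
  by_cases h : Derives T (B :: H) Fml.bot
  · have hn : ¬ Derives T (B.not :: H) Fml.bot := fun h' =>
      hH (Derives.impE (Derives.impI h') (Derives.impI h))
    by_cases hB : ∃ A : Fml (σ :: Γ), B = Fml.all σ A
    · obtain ⟨A, rfl⟩ := hB
      refine ⟨A.not :: ((Fml.all σ A).not :: H).map Fml.wk, fun h' => ?_, ?_, ?_, ?_⟩
      -- If the counterexample were inconsistent, `A` would be derivable for the fresh variable, and
      -- generalisation would contradict the assumed negation.
      · exact hn (Derives.impE (Derives.hyp List.mem_cons_self) (Derives.allI (Derives.raa h')))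
      · intro C hC
        exact List.mem_cons_of_mem _ (List.mem_map_of_mem (List.mem_cons_of_mem _ hC))
      · exact Or.inr (List.mem_cons_of_mem _ (List.mem_map_of_mem List.mem_cons_self))
      · intro A' hA' _
        cases hA'
        exact List.mem_cons_self
    · refine ⟨(B.not :: H).map Fml.wk, not_derives_map_wk hn, ?_, ?_, ?_⟩
      · intro C hC
        exact List.mem_map_of_mem (List.mem_cons_of_mem _ hC)
      · exact Or.inr (List.mem_map_of_mem List.mem_cons_self)
      · intro A hA
        exact (hB ⟨A, hA⟩).elim
  · refine ⟨(B :: H).map Fml.wk, not_derives_map_wk h, ?_, ?_, ?_⟩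
    · intro C hC
      exact List.mem_map_of_mem (List.mem_cons_of_mem _ hC)
    · exact Or.inl (List.mem_map_of_mem List.mem_cons_self)
    -- The witness condition is vacuous here: `B` is in the list, so its negation cannot be.
    · intro A _ hA
      exact (not_derives_map_wk h (Derives.impE (Derives.hyp hA)
        (Derives.hyp (List.mem_map_of_mem List.mem_cons_self)))).elim

/-- The context of the first `n` variables, the type of the `n`-th one being `g n`. -/
def stageCtx (g : ℕ → Ty) : ℕ → Ctx
  | 0 => []
  | n + 1 => g n :: stageCtx g n

/-- A sequence of formulas that is eventually constant up to weakening. -/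
def FmlCoherent {g : ℕ → Ty} (B : ∀ n, Fml (stageCtx g n)) : Prop :=
  ∃ N, ∀ n, N ≤ n → B (n + 1) = (B n).wk

/-- Coherent sequences stand for elements of the direct limit of the term sets along weakening,
without forming a quotient. -/
def TmCoherent {g : ℕ → Ty} {σ : Ty} (t : ∀ n, Tm (stageCtx g n) σ) : Prop :=
  ∃ N, ∀ n, N ≤ n → t (n + 1) = (t n).wk

open Classical in
/-- The weakening of a formula of stage `c.1` to stage `n`, if `c.1 ≤ n`. -/
noncomputable def weakenTo {g : ℕ → Ty} (c : Σ k, Fml (stageCtx g k)) (n : ℕ) :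
    Fml (stageCtx g n) :=
  if h : c.1 ≤ n then
    Nat.leRecOn (C := fun k => Fml (stageCtx g k)) h (fun {_} A => A.wk) c.2
  else Fml.bot

theorem weakenTo_eq {g : ℕ → Ty} {B : ∀ n, Fml (stageCtx g n)} {K : ℕ}
    (hK : ∀ n, K ≤ n → B (n + 1) = (B n).wk) {n : ℕ} (hn : K ≤ n) :
    weakenTo ⟨K, B K⟩ n = B n := by
  rw [weakenTo, dif_pos hn]
  induction n, hn using Nat.le_induction with
  | base => exact Nat.leRecOn_self _
  | succ n hn ih =>
    rw [hK n hn, ← ih]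
    exact Nat.leRecOn_succ (C := fun k => Fml (stageCtx g k)) hn _

/-- The stage number codes a type, a formula of some stage, and a counter. Thus every combination of
type and formula recurs beyond any given stage, in particular after the formula has become coherent.
-/
theorem exists_enumeration : ∃ (g : ℕ → Ty) (b : ∀ n, Fml (stageCtx g n)),
    ∀ (σ : Ty) (B : ∀ n, Fml (stageCtx g n)), FmlCoherent B →
      ∀ N, ∃ n, N ≤ n ∧ g n = σ ∧ b n = B n := by
  obtain ⟨τ, hτ⟩ := exists_surjective_nat Ty
  let g : ℕ → Ty := fun n => τ n.unpair.1
  have : Nonempty (Σ k, Fml (stageCtx g k)) := ⟨⟨0, Fml.bot⟩⟩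
  obtain ⟨f, hf⟩ := exists_surjective_nat (Σ k, Fml (stageCtx g k))
  refine ⟨g, fun n => weakenTo (f n.unpair.2.unpair.1) n, ?_⟩
  rintro σ B ⟨K, hK⟩ N
  obtain ⟨i, rfl⟩ := hτ σ
  obtain ⟨j, hj⟩ := hf ⟨K, B K⟩
  have hn : K + N ≤ Nat.pair i (Nat.pair j (K + N)) :=
    (Nat.right_le_pair _ _).trans (Nat.right_le_pair _ _)
  refine ⟨Nat.pair i (Nat.pair j (K + N)), by omega, by simp [g], ?_⟩
  have e : f (Nat.pair i (Nat.pair j (K + N))).unpair.2.unpair.1 = ⟨K, B K⟩ := by simpa using hj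
  simp only [e]
  exact weakenTo_eq hK (by omega)

theorem exists_henkin_chain {G : Fml []} (hG : ¬ Derives T [] G) :
    ∃ (g : ℕ → Ty) (H : ∀ n, List (Fml (stageCtx g n))), (∀ n, ¬ Derives T (H n) Fml.bot) ∧
      G.not ∈ H 0 ∧ (∀ n, ∀ A ∈ H n, A.wk ∈ H (n + 1)) ∧
      ∀ B : ∀ n, Fml (stageCtx g n), FmlCoherent B → ∀ σ N, ∃ n, N ≤ n ∧ g n = σ ∧
        ((B n).wk ∈ H (n + 1) ∨ (B n).not.wk ∈ H (n + 1) ∧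
          ∀ A : Fml (g n :: stageCtx g n), B n = Fml.all (g n) A → A.not ∈ H (n + 1)) := by
  obtain ⟨g, b, hb⟩ := exists_enumeration
  choose S hS using fun (n : ℕ) (H : {H : List (Fml (stageCtx g n)) // ¬ Derives T H Fml.bot}) =>
    henkin_step H.2 (b n) (g n)
  let F : ∀ n, {H : List (Fml (stageCtx g n)) // ¬ Derives T H Fml.bot} := fun n =>
    Nat.rec ⟨[G.not], fun h => hG (Derives.raa h)⟩ (fun n H => ⟨S n H, (hS n H).1⟩) n
  refine ⟨g, fun n => (F n).1, fun n => (F n).2, List.mem_cons_self,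
    fun n => (hS n (F n)).2.1, fun B hB σ N => ?_⟩
  obtain ⟨n, hn, hσ, hbn⟩ := hb σ B hB N
  refine ⟨n, hn, hσ, ?_⟩
  obtain ⟨-, -, h1, h2⟩ := hS n (F n)
  rw [hbn] at h1 h2
  rcases h1 with h1 | h1
  · exact Or.inl h1
  · exact Or.inr ⟨h1, fun A hA => h2 A hA h1⟩

section Henkin

variable {g : ℕ → Ty}

/-- The formulas belonging to the stages `H n` from some stage on. -/
def Forced (H : ∀ n, List (Fml (stageCtx g n))) (B : ∀ n, Fml (stageCtx g n)) : Prop :=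
  ∃ N, ∀ n, N ≤ n → B n ∈ H n

/-- The structure of terms in the variables of all stages. -/
def henkinStruc (H : ∀ n, List (Fml (stageCtx g n))) : Struc where
  carrier σ := {t : ∀ n, Tm (stageCtx g n) σ // TmCoherent t}
  app f a := ⟨fun n => f.1 n ⬝ₜ a.1 n, by
    obtain ⟨N, hN⟩ := f.2
    obtain ⟨K, hK⟩ := a.2
    refine ⟨N + K, fun n hn => ?_⟩
    exact congrArg₂ Tm.app (hN n (by omega)) (hK n (by omega))⟩
  con c := ⟨fun _ => Tm.con c, 0, fun _ _ => rfl⟩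
  eq a b := Forced H fun n => Fml.eq (a.1 n) (b.1 n)
  st a := Forced H fun n => Fml.st (a.1 n)

variable {H : ∀ n, List (Fml (stageCtx g n))}

/-- The substitution given at stage `n` by an environment of terms. -/
def stageSub {Γ : Ctx} (e : (henkinStruc H).Env Γ) (n : ℕ) : Sub Γ (stageCtx g n) :=
  fun _ x => (e _ x).1 n

/-- A context is finite, so a single stage suffices for the coherence of all its entries. -/
theorem stageSub_coherent {Γ : Ctx} (e : (henkinStruc H).Env Γ) :
    ∃ N, ∀ n, N ≤ n → ∀ σ (x : Var Γ σ), stageSub e (n + 1) σ x = (stageSub e n σ x).wk := by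
  induction Γ with
  | nil => exact ⟨0, fun _ _ _ x => nomatch x⟩
  | cons τ Γ ih =>
    obtain ⟨N, hN⟩ := ih (fun _ x => e _ (Var.s x))
    obtain ⟨K, hK⟩ := (e _ Var.z).2
    refine ⟨N + K, fun n hn σ x => ?_⟩
    cases x with
    | z => exact hK n (by omega)
    | s x => exact hN n (by omega) _ x

theorem fmlCoherent_subst {Γ : Ctx} (A : Fml Γ) (e : (henkinStruc H).Env Γ) :
    FmlCoherent fun n => A.subst (stageSub e n) := by
  obtain ⟨N, hN⟩ := stageSub_coherent e
  refine ⟨N, fun n hn => ?_⟩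
  change A.subst _ = Fml.wk _
  rw [Fml.wk_eq_subst, Fml.subst_subst]
  congr 1
  funext σ x
  exact (hN n hn σ x).trans (Tm.wk_eq_subst _)

theorem henkinStruc_eval_tm {Γ : Ctx} (e : (henkinStruc H).Env Γ) {σ : Ty} (t : Tm Γ σ) (n : ℕ) :
    (t.eval _ e).1 n = t.subst (stageSub e n) := by
  induction t with
  | var x => rfl
  | con c => rfl
  | app f a hf ha => rw [Tm.subst, ← hf, ← ha]; rfl

theorem forced_of_mem (hH : ∀ n, ∀ A ∈ H n, A.wk ∈ H (n + 1)) {B : ∀ n, Fml (stageCtx g n)}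
    {N : ℕ} (hB : ∀ n, N ≤ n → B (n + 1) = (B n).wk) (h : B N ∈ H N) : Forced H B := by
  refine ⟨N, fun n hn => ?_⟩
  induction n, hn using Nat.le_induction with
  | base => exact h
  | succ n hn ih => rw [hB n hn]; exact hH n _ ih

/-- The variable added at stage `n`. -/
noncomputable def stageVar (g : ℕ → Ty) (n m : ℕ) : Tm (stageCtx g m) (g n) :=
  if h : n + 1 ≤ m then
    Nat.leRecOn (C := fun k => Tm (stageCtx g k) (g n)) h (fun {_} t => t.wk) v0
  else Tm.default _

theorem stageVar_self (n : ℕ) : stageVar g n (n + 1) = v0 := by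
  rw [stageVar, dif_pos le_rfl]
  exact Nat.leRecOn_self _

theorem stageVar_succ {n m : ℕ} (h : n + 1 ≤ m) : stageVar g n (m + 1) = (stageVar g n m).wk := by
  rw [stageVar, stageVar, dif_pos h, dif_pos (h.trans (Nat.le_succ m))]
  exact Nat.leRecOn_succ (C := fun k => Tm (stageCtx g k) (g n)) h _

end Henkin

/-- The conditions on a chain of theories under which the terms form a model. -/
structure HenkinChain (T : {Γ : Ctx} → Fml Γ → Prop) (g : ℕ → Ty)
    (H : ∀ n, List (Fml (stageCtx g n))) : Prop where
  consistent : ∀ n, ¬ Derives T (H n) Fml.bot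
  wk_mem : ∀ n, ∀ A ∈ H n, A.wk ∈ H (n + 1)
  decides : ∀ B : ∀ n, Fml (stageCtx g n), FmlCoherent B → ∀ σ N, ∃ n, N ≤ n ∧ g n = σ ∧
    ((B n).wk ∈ H (n + 1) ∨ (B n).not.wk ∈ H (n + 1) ∧
      ∀ A : Fml (g n :: stageCtx g n), B n = Fml.all (g n) A → A.not ∈ H (n + 1))

namespace HenkinChain

variable {g : ℕ → Ty} {H : ∀ n, List (Fml (stageCtx g n))}

/-- The limit theory is complete: a coherent formula is decided at some stage past its coherence,
and the decision is carried along by weakening. -/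
theorem forced_or (h : HenkinChain T g H) {B : ∀ n, Fml (stageCtx g n)} (hB : FmlCoherent B) :
    Forced H B ∨ Forced H fun n => (B n).not := by
  obtain ⟨N, hN⟩ := id hB
  obtain ⟨n, hn, -, h1 | h1⟩ := h.decides B hB Ty.nat N
  · refine Or.inl (forced_of_mem h.wk_mem (N := n + 1) (fun m hm => hN m (by omega)) ?_)
    rwa [hN n hn]
  · refine Or.inr (forced_of_mem h.wk_mem (N := n + 1)
      (fun m hm => congrArg Fml.not (hN m (by omega))) ?_)
    rw [hN n hn]
    exact h1.1

/-- The limit theory is deductively closed: otherwise the negation would be forced and a late stage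
would be inconsistent. -/
theorem forced_of_derives (h : HenkinChain T g H) {B : ∀ n, Fml (stageCtx g n)} (hB : FmlCoherent B) (N : ℕ)
    (hd : ∀ n, N ≤ n → Derives T (H n) (B n)) : Forced H B := by
  refine (h.forced_or hB).resolve_right ?_
  rintro ⟨K, hK⟩
  exact h.consistent (N + K) (Derives.impE (Derives.hyp (hK _ (by omega))) (hd _ (by omega)))

/-- The truth lemma. Completeness of the limit theory handles implication; the counterexample
variables handle the universal quantifier. -/
theorem eval_iff (h : HenkinChain T g H) {Γ : Ctx} (A : Fml Γ) (e : (henkinStruc H).Env Γ) :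
    A.eval _ e ↔ Forced H fun n => A.subst (stageSub e n) := by
  induction A with
  | bot =>
    refine ⟨False.elim, ?_⟩
    rintro ⟨N, hN⟩
    exact h.consistent N (Derives.hyp (hN N le_rfl))
  | eq a b =>
    simp only [Fml.subst, ← henkinStruc_eval_tm]
    rfl
  | st a =>
    simp only [Fml.subst, ← henkinStruc_eval_tm]
    rfl
  | imp A B hA hB =>
    have hc := fmlCoherent_subst (A.imp B) e
    constructor
    · intro hAB
      rcases h.forced_or (fmlCoherent_subst A e) with h1 | ⟨N, hN⟩
      · obtain ⟨N, hN⟩ := (hB e).1 (hAB ((hA e).2 h1))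
        exact h.forced_of_derives hc N fun n hn =>
          Derives.impI (Derives.hyp (List.mem_cons_of_mem _ (hN n hn)))
      · exact h.forced_of_derives hc N fun n hn => Derives.impI (Derives.exfalso
          (Derives.impE (Derives.hyp (List.mem_cons_of_mem _ (hN n hn)))
            (Derives.hyp List.mem_cons_self)))
    · rintro ⟨N, hN⟩ h1
      obtain ⟨K, hK⟩ := (hA e).1 h1
      exact (hB e).2 (h.forced_of_derives (fmlCoherent_subst B e) (N + K) fun n hn =>
        Derives.impE (Derives.hyp (hN n (by omega))) (Derives.hyp (hK n (by omega))))
  | @all Γ σ A hA =>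
    constructor
    · intro hall
      obtain ⟨N, hN⟩ := id (fmlCoherent_subst (Fml.all σ A) e)
      obtain ⟨K, hK⟩ := stageSub_coherent e
      -- The universal formula is decided at a stage whose fresh variable has type `σ`. If it is
      -- refuted there, the evaluation at this very variable gives both the instance and its
      -- negation.
      obtain ⟨n, hn, rfl, h1 | ⟨-, h1⟩⟩ :=
        h.decides _ (fmlCoherent_subst (Fml.all σ A) e) σ (N + K)
      · refine forced_of_mem h.wk_mem (N := n + 1) (fun m hm => hN m (by omega)) ?_
        exact (congrArg (· ∈ H (n + 1)) (hN n (by omega))).mpr h1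
      · exfalso
        have h2 := h1 _ rfl
        obtain ⟨L, hL⟩ := (hA (⟨stageVar g n, n + 1, fun m hm => stageVar_succ hm⟩ ∷ e)).1 (hall _)
        have h3 : A.subst (stageSub e n).lift = A.subst (stageSub (H := H)
            (⟨stageVar g n, n + 1, fun m hm => stageVar_succ hm⟩ ∷ e) (n + 1)) := by
          congr 1
          funext σ x
          cases x with
          | z => exact (stageVar_self n).symm
          | s x => exact (hK n (by omega) _ x).symm
        rw [h3] at h2
        have hco : ∀ m, n + 1 ≤ m → A.not.subst (stageSub (H := H)
            (⟨stageVar g n, n + 1, fun m hm => stageVar_succ hm⟩ ∷ e) (m + 1)) =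
            (A.not.subst (stageSub (H := H)
              (⟨stageVar g n, n + 1, fun m hm => stageVar_succ hm⟩ ∷ e) m)).wk := by
          intro m hm
          rw [Fml.wk_eq_subst, Fml.subst_subst]
          congr 1
          funext σ x
          refine Eq.trans ?_ (Tm.wk_eq_subst _)
          cases x with
          | z => exact stageVar_succ hm
          | s x => exact hK m (by omega) _ x
        obtain ⟨L', hL'⟩ := forced_of_mem (B := fun m => A.not.subst (stageSub (H := H)
          (⟨stageVar g n, n + 1, fun m hm => stageVar_succ hm⟩ ∷ e) m)) h.wk_mem hco h2
        exact h.consistent (L + L') (Derives.impE (Derives.hyp (hL' _ (by omega)))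
          (Derives.hyp (hL _ (by omega))))
    · rintro ⟨N, hN⟩ a
      refine (hA _).2 (h.forced_of_derives (fmlCoherent_subst A _) N fun n hn => ?_)
      have h1 := Derives.allE (a.1 n) (Derives.hyp (T := T) (hN n hn))
      rw [Fml.subst_lift_inst] at h1
      convert h1 using 2
      funext σ x
      cases x <;> rfl

end HenkinChain

/-- Gödel's completeness theorem, for axioms closed under substitution. -/
theorem exists_model_of_not_derives
    (hT : ∀ {Γ Δ : Ctx} (s : Sub Γ Δ) {A : Fml Γ}, T A → T (A.subst s)) {G : Fml []}
    (hG : ¬ Derives T [] G) : ∃ M : Struc, M.Models T ∧ ¬ G.eval M M.nil := by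
  obtain ⟨g, H, h1, h2, h3, h4⟩ := exists_henkin_chain hG
  have h : HenkinChain T g H := ⟨h1, h3, h4⟩
  refine ⟨henkinStruc H, fun A hA e => ?_, fun hGe => ?_⟩
  · exact (h.eval_iff A e).2 (h.forced_of_derives (fmlCoherent_subst A e) 0 fun n _ =>
      Derives.ax (hT _ hA))
  · have h5 : G.not.eval _ (henkinStruc H).nil := by
      refine (h.eval_iff G.not _).2 ?_
      have hc : ∀ n, (G.not.subst (stageSub (henkinStruc H).nil (n + 1)) : Fml (stageCtx g (n + 1)))
          = Fml.wk (G.not.subst (stageSub (henkinStruc H).nil n)) := by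
        intro n
        rw [Fml.wk_eq_subst, Fml.subst_subst]
        congr 1
        funext σ x
        cases x
      refine forced_of_mem h.wk_mem (N := 0) (fun n _ => hc n) ?_
      have h6 : (stageSub (henkinStruc H).nil 0 : Sub [] []) = fun _ x => Tm.var x := by
        funext σ x
        cases x
      simp only [h6]
      exact (Fml.subst_var G.not).symm ▸ h2
    exact h5 hGe

end Completeness

/-! Evaluation and substitution. -/

section Eval

variable {M : Struc} {Γ Δ : Ctx}

@[simp] theorem Tm.eval_var (e : M.Env Γ) {σ : Ty} (x : Var Γ σ) : (Tm.var x).eval M e = e _ x :=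
  rfl

@[simp] theorem Tm.eval_con (e : M.Env Γ) {σ : Ty} (c : Con σ) : (Tm.con c).eval M e = M.con c :=
  rfl

@[simp] theorem Tm.eval_app (e : M.Env Γ) {σ τ : Ty} (f : Tm Γ (σ ⇒ τ)) (a : Tm Γ σ) :
    (f ⬝ₜ a).eval M e = M.app (f.eval M e) (a.eval M e) := rfl

@[simp] theorem Struc.cons_z {σ : Ty} (a : M.carrier σ) (e : M.Env Γ) : (a ∷ e) _ Var.z = a := rfl

@[simp] theorem Struc.cons_s {σ τ : Ty} (a : M.carrier σ) (e : M.Env Γ) (x : Var Γ τ) :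
    (a ∷ e) _ (Var.s x) = e _ x := rfl

theorem Tm.eval_subst (s : Sub Γ Δ) (e : M.Env Δ) {σ : Ty} (t : Tm Γ σ) :
    (t.subst s).eval M e = t.eval M fun _ x => (s _ x).eval M e := by
  induction t with
  | var x => rfl
  | con c => rfl
  | app f a hf ha => simp [hf, ha]

@[simp] theorem Tm.eval_wk {σ τ : Ty} (t : Tm Γ σ) (a : M.carrier τ) (e : M.Env Γ) :
    t.wk.eval M (a ∷ e) = t.eval M e := by
  rw [Tm.wk_eq_subst, Tm.eval_subst]
  rfl

theorem Struc.lift_env (s : Sub Γ Δ) (e : M.Env Δ) {σ : Ty} (a : M.carrier σ) :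
    (fun τ x => (s.lift τ x).eval M (a ∷ e)) = a ∷ fun τ x => (s τ x).eval M e := by
  funext τ x
  cases x with
  | z => rfl
  | s x => exact Tm.eval_wk _ _ _

theorem Fml.eval_subst (s : Sub Γ Δ) (e : M.Env Δ) (A : Fml Γ) :
    (A.subst s).eval M e ↔ A.eval M fun _ x => (s _ x).eval M e := by
  induction A generalizing Δ with
  | bot => rfl
  | eq a b => simp [Fml.eval, Tm.eval_subst]
  | st a => simp [Fml.eval, Tm.eval_subst]
  | imp A B hA hB => simp [Fml.eval, hA, hB]
  | all σ A hA => simp [Fml.eval, hA, Struc.lift_env]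

theorem Fml.eval_ren (r : Ren Γ Δ) (e : M.Env Δ) (A : Fml Γ) :
    (A.ren r).eval M e ↔ A.eval M fun _ x => e _ (r _ x) := by
  rw [Fml.ren_eq_subst, Fml.eval_subst]
  rfl

theorem Fml.eval_inst {σ : Ty} (A : Fml (σ :: Γ)) (t : Tm Γ σ) (e : M.Env Γ) :
    (A.inst t).eval M e ↔ A.eval M (t.eval M e ∷ e) := by
  rw [Fml.inst, Fml.eval_subst]
  apply iff_of_eq
  congr 1
  funext τ x
  cases x <;> rfl

variable (e : M.Env Γ)

@[simp] theorem Fml.eval_bot : (Fml.bot : Fml Γ).eval M e ↔ False := Iff.rfl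

@[simp] theorem Fml.eval_imp (A B : Fml Γ) :
    (A →ᶠ B).eval M e ↔ (A.eval M e → B.eval M e) := Iff.rfl

@[simp] theorem Fml.eval_st {σ : Ty} (a : Tm Γ σ) : (Fml.st a).eval M e ↔ M.st (a.eval M e) :=
  Iff.rfl

@[simp] theorem Fml.eval_not (A : Fml Γ) : A.not.eval M e ↔ ¬ A.eval M e := Iff.rfl

@[simp] theorem Fml.eval_and (A B : Fml Γ) :
    (A ∧ᶠ B).eval M e ↔ A.eval M e ∧ B.eval M e := by
  simp [Fml.and]

@[simp] theorem Fml.eval_all {σ : Ty} (A : Fml (σ :: Γ)) :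
    (Fml.all σ A).eval M e ↔ ∀ a, A.eval M (a ∷ e) := Iff.rfl

@[simp] theorem Fml.eval_ex {σ : Ty} (A : Fml (σ :: Γ)) :
    (Fml.ex σ A).eval M e ↔ ∃ a, A.eval M (a ∷ e) := by
  simp [Fml.ex]

@[simp] theorem Fml.eval_allSt {σ : Ty} (A : Fml (σ :: Γ)) :
    (Fml.allSt σ A).eval M e ↔ ∀ a, M.st a → A.eval M (a ∷ e) := Iff.rfl

@[simp] theorem Fml.eval_exSt {σ : Ty} (A : Fml (σ :: Γ)) :
    (Fml.exSt σ A).eval M e ↔ ∃ a, M.st a ∧ A.eval M (a ∷ e) := by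
  simp [Fml.exSt]

end Eval

/-! Passage to the quotient by extensional equality. -/

section Quotient

variable (M : Struc)

def Struc.ltRel (i n : M.carrier Ty.nat) : Prop := (ltF v1 v0).eval M (n ∷ i ∷ M.nil)

theorem Fml.eval_ltF {Γ : Ctx} (e : M.Env Γ) (a b : Tm Γ Ty.nat) :
    (ltF a b).eval M e ↔ M.ltRel (a.eval M e) (b.eval M e) := Iff.rfl

/-- The interpretation of `eqF`. -/
def Struc.extEq : (σ : Ty) → M.carrier σ → M.carrier σ → Prop
  | Ty.nat, a, b => M.eq a b
  | Ty.arr _ τ, f, g => ∀ x, Struc.extEq τ (M.app f x) (M.app g x)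
  | Ty.seq σ, s, t => M.eq (M.app (M.con (Con.len σ)) s) (M.app (M.con (Con.len σ)) t) ∧
      ∀ i, M.ltRel i (M.app (M.con (Con.len σ)) s) →
        Struc.extEq σ (M.app (M.app (M.con (Con.proj σ)) s) i)
          (M.app (M.app (M.con (Con.proj σ)) t) i)

theorem Fml.eval_eqF {σ : Ty} {Γ : Ctx} (e : M.Env Γ) (a b : Tm Γ σ) :
    (eqF σ a b).eval M e ↔ M.extEq σ (a.eval M e) (b.eval M e) := by
  induction σ generalizing Γ with
  | nat => rfl
  | arr σ τ _ h => simp [eqF, Struc.extEq, h]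
  | seq σ h =>
    simp only [eqF, Fml.eval_and, Fml.eval_all, Fml.eval_imp, h, Fml.eval_ltF]
    simp only [Tm.len, Tm.proj, Tm.eval_app, Tm.eval_wk]
    exact Iff.rfl

variable {M}

namespace Struc.Models

theorem eq_refl (hM : M.Models P0) (a : M.carrier Ty.nat) : M.eq a a :=
  hM _ (P0.epra (EPRA.eq_refl (Γ := [Ty.nat]) v0)) (a ∷ M.nil)

theorem eq_eucl (hM : M.Models P0) {a b c : M.carrier Ty.nat} (h : M.eq a b) (h' : M.eq a c) :
    M.eq b c :=
  hM _ (P0.epra (EPRA.eq_eucl (Γ := [Ty.nat, Ty.nat, Ty.nat]) v0 v1 v2)) (a ∷ b ∷ c ∷ M.nil) h h'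

theorem app_extEq (hM : M.Models P0) {σ τ : Ty} (f : M.carrier (σ ⇒ τ)) {x y : M.carrier σ}
    (h : M.extEq σ x y) : M.extEq τ (M.app f x) (M.app f y) := by
  have := hM _ (P0.epra (EPRA.ext (Γ := [σ ⇒ τ, σ, σ]) v0 v1 v2)) (f ∷ x ∷ y ∷ M.nil)
  simp only [Fml.eval_imp, Fml.eval_eqF] at this
  exact this h

theorem ltRel_congr (hM : M.Models P0) {i n n' : M.carrier Ty.nat} (h : M.eq n n')
    (hi : M.ltRel i n) : M.ltRel i n' :=
  -- Truncated subtraction recurses on its second argument, so `n` is the first argument of the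
  -- recursor, and extensionality of the constant `rec0` replaces it.
  hM.eq_eucl (hM.app_extEq (M.con Con.rec0) (x := n) (y := n') h _ _) hi

theorem extEq_refl (hM : M.Models P0) {σ : Ty} (a : M.carrier σ) : M.extEq σ a a := by
  induction σ with
  | nat => exact hM.eq_refl a
  | arr _ _ _ h => exact fun x => h _
  | seq _ h => exact ⟨hM.eq_refl _, fun i _ => h _⟩

theorem extEq_eucl (hM : M.Models P0) {σ : Ty} {a b c : M.carrier σ} (h : M.extEq σ a b)
    (h' : M.extEq σ a c) : M.extEq σ b c := by
  induction σ with
  | nat => exact hM.eq_eucl h h'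
  | arr _ _ _ ih => exact fun x => ih (h x) (h' x)
  | seq _ ih =>
    refine ⟨hM.eq_eucl h.1 h'.1, fun i hi => ?_⟩
    have hi' := hM.ltRel_congr (hM.eq_eucl h.1 (hM.eq_refl _)) hi
    exact ih (h.2 i hi') (h'.2 i hi')

theorem extEq_symm (hM : M.Models P0) {σ : Ty} {a b : M.carrier σ} (h : M.extEq σ a b) :
    M.extEq σ b a :=
  hM.extEq_eucl h (hM.extEq_refl a)

theorem extEq_app (hM : M.Models P0) {σ τ : Ty} {f g : M.carrier (σ ⇒ τ)} {x y : M.carrier σ}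
    (hf : M.extEq _ f g) (hx : M.extEq σ x y) : M.extEq τ (M.app f x) (M.app g y) :=
  hM.extEq_eucl (hM.extEq_symm (hf x)) (hM.app_extEq g hx)

theorem st_extEq (hM : M.Models P0) {σ : Ty} {x y : M.carrier σ} (hx : M.st x)
    (h : M.extEq σ x y) : M.st y := by
  have := hM _ (P0.st_eq (Γ := [σ, σ]) v0 v1) (x ∷ y ∷ M.nil)
  simp only [Fml.eval_imp, Fml.eval_eqF] at this
  exact this hx h

def setoid (hM : M.Models P0) (σ : Ty) : Setoid (M.carrier σ) where
  r := M.extEq σ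
  iseqv := ⟨hM.extEq_refl, hM.extEq_symm, fun h h' => hM.extEq_eucl (hM.extEq_symm h) h'⟩

/-- The quotient of a model by extensional equality. -/
def quot (hM : M.Models P0) : Struc where
  carrier σ := Quotient (hM.setoid σ)
  app {_ τ} := Quotient.lift₂ (fun f a => Quotient.mk (hM.setoid τ) (M.app f a))
    fun _ _ _ _ hf ha => Quotient.sound (s := hM.setoid τ) (hM.extEq_app hf ha)
  con c := Quotient.mk _ (M.con c)
  eq a b := a = b
  st := Quotient.lift M.st fun _ _ h => propext
    ⟨fun hx => hM.st_extEq hx h, fun hx => hM.st_extEq hx (hM.extEq_symm h)⟩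

/-- The class of an environment. -/
def quotEnv (hM : M.Models P0) {Γ : Ctx} (e : M.Env Γ) : hM.quot.Env Γ :=
  fun σ x => Quotient.mk (hM.setoid σ) (e σ x)

theorem quotEnv_cons (hM : M.Models P0) {Γ : Ctx} {σ : Ty} (a : M.carrier σ) (e : M.Env Γ) :
    hM.quotEnv (a ∷ e) = Struc.cons (M := hM.quot) (Quotient.mk (hM.setoid σ) a) (hM.quotEnv e) := by
  funext τ x
  cases x <;> rfl

theorem quot_eval_tm (hM : M.Models P0) {Γ : Ctx} {σ : Ty} (t : Tm Γ σ) (e : M.Env Γ) :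
    t.eval hM.quot (hM.quotEnv e) = Quotient.mk (hM.setoid σ) (t.eval M e) := by
  induction t with
  | var x => rfl
  | con c => rfl
  | app f a hf ha => rw [Tm.eval_app, hf, ha]; rfl

theorem quot_eval (hM : M.Models P0) {Γ : Ctx} (A : Fml Γ) (e : M.Env Γ) :
    A.eval hM.quot (hM.quotEnv e) ↔ A.eval M e := by
  induction A with
  | bot => rfl
  | eq a b =>
    simp only [Fml.eval, quot_eval_tm]
    exact Quotient.eq (r := hM.setoid Ty.nat)
  | st a =>
    simp only [Fml.eval, quot_eval_tm]
    rfl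
  | imp A B hA hB => simp only [Fml.eval, hA, hB]
  | all σ A hA =>
    simp only [Fml.eval]
    constructor
    · intro h a
      have := h (Quotient.mk (hM.setoid σ) a)
      rwa [← quotEnv_cons, hA] at this
    · intro h a
      induction a using Quotient.ind with
      | _ a =>
        rw [← quotEnv_cons, hA]
        exact h a

theorem exists_quotEnv (hM : M.Models P0) {Γ : Ctx} (e : hM.quot.Env Γ) :
    ∃ e', hM.quotEnv e' = e :=
  ⟨fun σ x => (e σ x).out, funext fun _ => funext fun _ => Quotient.out_eq _⟩

theorem quot_models (hM : M.Models P0) : hM.quot.Models P0 := by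
  intro Γ A hA e
  obtain ⟨e, rfl⟩ := hM.exists_quotEnv e
  exact (hM.quot_eval A e).2 (hM _ hA e)

theorem quot_extEq (hM : M.Models P0) {σ : Ty} {a b : hM.quot.carrier σ}
    (h : hM.quot.extEq σ a b) : a = b := by
  induction a using Quotient.ind with
  | _ a =>
  induction b using Quotient.ind with
  | _ b =>
  have h1 := (Fml.eval_eqF hM.quot (hM.quotEnv (a ∷ b ∷ M.nil)) (σ := σ) v0 v1).2 h
  rw [quot_eval, Fml.eval_eqF] at h1
  exact Quotient.sound (s := hM.setoid σ) h1

end Struc.Models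

/-- The models of `P₀` in which extensionally equal objects are equal. -/
class Struc.Extensional (M : Struc) : Prop where
  models : M.Models P0
  eq_iff : ∀ a b, M.eq a b ↔ a = b
  ext : ∀ {σ : Ty} {a b : M.carrier σ}, M.extEq σ a b → a = b

/-- A sentence is provable in `P₀` if it holds in all extensional models. -/
theorem P0Proves.of_models {G : Fml []} (h : ∀ M : Struc, M.Extensional → G.eval M M.nil) :
    P0Proves G := by
  by_contra hG
  obtain ⟨M, hM, hMG⟩ := exists_model_of_not_derives P0.subst hG
  refine hMG ((hM.quot_eval G M.nil).1 ?_)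
  have := h hM.quot ⟨hM.quot_models, fun _ _ => Iff.rfl, hM.quot_extEq⟩
  convert this using 1
  funext σ x
  cases x

end Quotient

/-! Arithmetic in extensional models. -/

notation:90 f:90 " ⬝ₘ " a:91 => Struc.app _ f a

/-- The natural numbers of a structure. -/
abbrev Struc.N (M : Struc) : Type := M.carrier Ty.nat

namespace Struc

variable {M : Struc}

def suc (n : M.N) : M.N := M.con Con.succ ⬝ₘ n

def recN (n a : M.N) (f : M.carrier (Ty.nat ⇒ Ty.nat ⇒ Ty.nat)) : M.N :=
  M.con Con.rec0 ⬝ₘ n ⬝ₘ a ⬝ₘ f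

def len {σ : Ty} (s : M.carrier σ.seq) : M.N := M.con (Con.len σ) ⬝ₘ s

def proj {σ : Ty} (s : M.carrier σ.seq) (i : M.N) : M.carrier σ := M.con (Con.proj σ) ⬝ₘ s ⬝ₘ i

def mkSeq {σ : Ty} (n : M.N) (f : M.carrier (Ty.nat ⇒ σ)) : M.carrier σ.seq :=
  M.con (Con.mk σ) ⬝ₘ n ⬝ₘ f

instance : Zero M.N := ⟨M.con Con.zero⟩

end Struc

section Extensional

variable {M : Struc} {Γ Δ : Ctx}

section

variable (e : M.Env Γ)

@[simp] theorem Tm.eval_zero : (Tm.zero : Tm Γ Ty.nat).eval M e = 0 := rfl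

theorem Tm.eval_succ' (t : Tm Γ Ty.nat) : (Tm.succ t).eval M e = Struc.suc (t.eval M e) := rfl

@[simp] theorem Tm.eval_len {σ : Ty} (t : Tm Γ σ.seq) : t.len.eval M e = Struc.len (t.eval M e) :=
  rfl

@[simp] theorem Tm.eval_proj {σ : Ty} (t : Tm Γ σ.seq) (i : Tm Γ Ty.nat) :
    (t.proj i).eval M e = Struc.proj (t.eval M e) (i.eval M e) := rfl

@[simp] theorem Tm.eval_mk {σ : Ty} (n : Tm Γ Ty.nat) (f : Tm Γ (Ty.nat ⇒ σ)) :
    (Tm.mk n f).eval M e = Struc.mkSeq (n.eval M e) (f.eval M e) := rfl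

theorem Tm.eval_rec0 (n a : Tm Γ Ty.nat) (f : Tm Γ (Ty.nat ⇒ Ty.nat ⇒ Ty.nat)) :
    (Tm.rec0 n a f).eval M e = Struc.recN (n.eval M e) (a.eval M e) (f.eval M e) := rfl

theorem Tm.eval_primRec (n a : Tm Γ Ty.nat) (s : Tm (Ty.nat :: Ty.nat :: Γ) Ty.nat) :
    (Tm.primRec n a s).eval M e = Struc.recN (n.eval M e) (a.eval M e) (s.lam.lam.eval M e) := rfl

end

variable [hM : M.Extensional]

theorem Struc.app_ext {σ τ : Ty} {f g : M.carrier (σ ⇒ τ)} (h : ∀ x, f ⬝ₘ x = g ⬝ₘ x) : f = g :=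
  hM.ext fun x => by rw [h]; exact Struc.Models.extEq_refl hM.models _

theorem Struc.extEq_iff {σ : Ty} {a b : M.carrier σ} : M.extEq σ a b ↔ a = b :=
  ⟨hM.ext, fun h => h ▸ Struc.Models.extEq_refl hM.models _⟩

theorem Struc.holds {A : Fml Γ} (h : P0 A) (e : M.Env Γ) : A.eval M e := hM.models A h e

@[simp] theorem Fml.eval_eq (e : M.Env Γ) (a b : Tm Γ Ty.nat) :
    (Fml.eq a b).eval M e ↔ a.eval M e = b.eval M e := hM.eq_iff _ _

@[simp] theorem Fml.eval_eqF_iff (e : M.Env Γ) {σ : Ty} (a b : Tm Γ σ) :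
    (eqF σ a b).eval M e ↔ a.eval M e = b.eval M e := by
  rw [Fml.eval_eqF, Struc.extEq_iff]

@[simp] theorem Struc.k_app {σ τ : Ty} (x : M.carrier σ) (y : M.carrier τ) :
    M.con (Con.k σ τ) ⬝ₘ x ⬝ₘ y = x := by
  simpa using Struc.holds (P0.epra (EPRA.k (Γ := [σ, τ]) v0 v1)) (x ∷ y ∷ M.nil)

@[simp] theorem Struc.s_app {ρ σ τ : Ty} (x : M.carrier (ρ ⇒ σ ⇒ τ)) (y : M.carrier (ρ ⇒ σ))
    (z : M.carrier ρ) : M.con (Con.s ρ σ τ) ⬝ₘ x ⬝ₘ y ⬝ₘ z = x ⬝ₘ z ⬝ₘ (y ⬝ₘ z) := by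
  simpa using Struc.holds (P0.epra (EPRA.s (Γ := [ρ ⇒ σ ⇒ τ, ρ ⇒ σ, ρ]) v0 v1 v2))
    (x ∷ y ∷ z ∷ M.nil)

@[simp] theorem Tm.eval_lam {σ : Ty} : {τ : Ty} → (t : Tm (σ :: Γ) τ) → (e : M.Env Γ) →
    (a : M.carrier σ) → t.lam.eval M e ⬝ₘ a = t.eval M (a ∷ e)
  | _, Tm.var Var.z, _, _ => by simp [Tm.lam]
  | _, Tm.var (Var.s _), _, _ => by simp [Tm.lam]
  | _, Tm.con _, _, _ => by simp [Tm.lam]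
  | _, Tm.app f b, e, a => by simp [Tm.lam, Tm.eval_lam f e a, Tm.eval_lam b e a]

theorem Struc.rec_zero (a : M.N) (f : M.carrier (Ty.nat ⇒ Ty.nat ⇒ Ty.nat)) :
    Struc.recN 0 a f = a := by
  simpa [Tm.eval_rec0, Tm.eval_succ'] using Struc.holds (P0.epra (EPRA.rec_zero (Γ := [_, _]) v0 v1)) (a ∷ f ∷ M.nil)

theorem Struc.rec_suc (n a : M.N) (f : M.carrier (Ty.nat ⇒ Ty.nat ⇒ Ty.nat)) :
    Struc.recN (Struc.suc n) a f = f ⬝ₘ Struc.recN n a f ⬝ₘ n := by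
  simpa [Tm.eval_rec0, Tm.eval_succ'] using Struc.holds (P0.epra (EPRA.rec_succ (Γ := [_, _, _]) v0 v1 v2))
    (n ∷ a ∷ f ∷ M.nil)

theorem Struc.ind' {A : Fml (Ty.nat :: Γ)} (hA : A.QF) (e : M.Env Γ) (h0 : A.eval M (0 ∷ e))
    (hs : ∀ n, A.eval M (n ∷ e) → A.eval M (Struc.suc n ∷ e)) (n : M.N) : A.eval M (n ∷ e) := by
  have h := Struc.holds (P0.epra (EPRA.induction A hA)) e
  simp only [Fml.eval_imp, Fml.eval_inst, Fml.eval_all, Fml.eval_subst] at h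
  refine h h0 (fun a ha => ?_) n
  convert hs a ha using 1
  funext τ x
  cases x <;> rfl

/-- Bracket abstraction does not commute syntactically with substitution, so the same recursion
written in two contexts gives different combinator terms. Extensionality identifies their values.
Hence operations can be defined by terms in one fixed context and used in all others. -/
theorem Tm.eval_primRec_congr {e : M.Env Γ} {e' : M.Env Δ} {n a : Tm Γ Ty.nat} {n' a' : Tm Δ Ty.nat}
    {s : Tm (Ty.nat :: Ty.nat :: Γ) Ty.nat} {s' : Tm (Ty.nat :: Ty.nat :: Δ) Ty.nat}
    (hn : n.eval M e = n'.eval M e') (ha : a.eval M e = a'.eval M e')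
    (hs : ∀ i p : M.N, s.eval M (i ∷ p ∷ e) = s'.eval M (i ∷ p ∷ e')) :
    (Tm.primRec n a s).eval M e = (Tm.primRec n' a' s').eval M e' := by
  rw [Tm.eval_primRec, Tm.eval_primRec, hn, ha]
  congr 1
  exact Struc.app_ext fun p => Struc.app_ext fun i => by simp [hs]

/-- The recursion equation, for the recursion variable in the context. -/
theorem Tm.eval_primRec_suc (e : M.Env Γ) (n : M.N) {a : Tm Γ Ty.nat}
    {s : Tm (Ty.nat :: Ty.nat :: Γ) Ty.nat} :
    Struc.recN (Struc.suc n) (a.eval M e) (s.lam.lam.eval M e) =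
      s.eval M (n ∷ Struc.recN n (a.eval M e) (s.lam.lam.eval M e) ∷ e) := by
  rw [Struc.rec_suc, Tm.eval_lam, Tm.eval_lam]

namespace Struc

instance : One M.N := ⟨suc 0⟩
instance : Add M.N := ⟨fun a b => (Tm.add v1 v0).eval M (b ∷ a ∷ M.nil)⟩
instance : Mul M.N := ⟨fun a b => (Tm.mul v1 v0).eval M (b ∷ a ∷ M.nil)⟩
instance : _root_.Sub M.N := ⟨fun a b => (Tm.sub v1 v0).eval M (b ∷ a ∷ M.nil)⟩
def prd (a : M.N) : M.N := (Tm.pred v0).eval M (a ∷ M.nil)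

end Struc

section

variable (e : M.Env Γ)

@[simp] theorem Tm.eval_add (a b : Tm Γ Ty.nat) :
    (Tm.add a b).eval M e = a.eval M e + b.eval M e :=
  Tm.eval_primRec_congr rfl rfl fun _ _ => rfl

@[simp] theorem Tm.eval_pred (a : Tm Γ Ty.nat) : (Tm.pred a).eval M e = Struc.prd (a.eval M e) :=
  Tm.eval_primRec_congr rfl rfl fun _ _ => rfl

@[simp] theorem Tm.eval_sub (a b : Tm Γ Ty.nat) :
    (Tm.sub a b).eval M e = a.eval M e - b.eval M e :=
  Tm.eval_primRec_congr rfl rfl fun _ _ => by simp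

@[simp] theorem Tm.eval_mul (a b : Tm Γ Ty.nat) :
    (Tm.mul a b).eval M e = a.eval M e * b.eval M e :=
  Tm.eval_primRec_congr rfl rfl fun _ _ => by simp

end

namespace Struc

theorem prd_zero : prd (0 : M.N) = 0 := rec_zero _ _

theorem prd_suc (n : M.N) : prd (suc n) = n := Tm.eval_primRec_suc (a := Tm.zero) (s := v0) _ n

theorem add_zero' (a : M.N) : a + 0 = a := rec_zero _ _

theorem add_suc (a b : M.N) : a + suc b = suc (a + b) :=
  Tm.eval_primRec_suc (a := v1) (s := Tm.succ v1) (b ∷ a ∷ M.nil) b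

end Struc
end Extensional
-- Closure properties of quantifier-free formulas.
section

variable {Γ : Ctx}

@[simp] theorem Fml.qf_eq (a b : Tm Γ Ty.nat) : (Fml.eq a b).QF := trivial

@[simp] theorem Fml.qf_imp (A B : Fml Γ) : (A →ᶠ B).QF ↔ A.QF ∧ B.QF := Iff.rfl

@[simp] theorem Fml.qf_not (A : Fml Γ) : A.not.QF ↔ A.QF := and_iff_left trivial

@[simp] theorem Fml.qf_and (A B : Fml Γ) : (A ∧ᶠ B).QF ↔ A.QF ∧ B.QF := by simp [Fml.and]

@[simp] theorem Fml.qf_leF (a b : Tm Γ Ty.nat) : (leF a b).QF := trivial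

@[simp] theorem Fml.qf_ltF (a b : Tm Γ Ty.nat) : (ltF a b).QF := trivial

end

/-! ### The ordered semiring of numbers of an extensional model. -/

namespace Struc

variable {M : Struc} [hM : M.Extensional]

theorem mul_zero' (a : M.N) : a * 0 = 0 := rec_zero _ _

theorem mul_suc (a b : M.N) : a * suc b = a * b + a :=
  (Tm.eval_primRec_suc (a := Tm.zero) (s := Tm.add v1 (v1 : Tm [Ty.nat, Ty.nat] _).wk.wk)
    (b ∷ a ∷ M.nil) b).trans (by simp; rfl)

theorem sub_zero' (a : M.N) : a - 0 = a := rec_zero _ _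

theorem sub_suc (a b : M.N) : a - suc b = prd (a - b) :=
  (Tm.eval_primRec_suc (a := v1) (s := Tm.pred v1) (b ∷ a ∷ M.nil) b).trans (by simp; rfl)

theorem suc_ne_zero (a : M.N) : suc a ≠ 0 := by
  simpa [Tm.eval_succ'] using holds (P0.epra (EPRA.succ_ne_zero (Γ := [_]) v0)) (a ∷ M.nil)

theorem zero_add' (a : M.N) : 0 + a = a := by
  have := ind' (A := Fml.eq (Tm.add Tm.zero v0) v0) (by simp) M.nil
  simp only [Fml.eval_eq, Tm.eval_add, Tm.eval_var, cons_z, Tm.eval_zero] at this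
  exact this (add_zero' 0) (fun n h => by rw [add_suc, h]) a

theorem suc_add (a b : M.N) : suc a + b = suc (a + b) := by
  have := ind' (A := Fml.eq (Tm.add (Tm.succ v1) v0) (Tm.succ (Tm.add v1 v0))) (by simp) (a ∷ M.nil)
  simp only [Fml.eval_eq, Tm.eval_add, Tm.eval_var, cons_z, cons_s, Tm.eval_succ'] at this
  exact this (by rw [add_zero', add_zero']) (fun n h => by rw [add_suc, h, add_suc]) b

theorem add_comm' (a b : M.N) : a + b = b + a := by
  have := ind' (A := Fml.eq (Tm.add v1 v0) (Tm.add v0 v1)) (by simp) (a ∷ M.nil)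
  simp only [Fml.eval_eq, Tm.eval_add, Tm.eval_var, cons_z, cons_s] at this
  exact this (by rw [add_zero', zero_add']) (fun n h => by rw [add_suc, h, suc_add]) b

theorem add_assoc' (a b c : M.N) : a + b + c = a + (b + c) := by
  have := ind' (A := Fml.eq (Tm.add (Tm.add v1 v2) v0) (Tm.add v1 (Tm.add v2 v0))) (by simp)
    (a ∷ b ∷ M.nil)
  simp only [Fml.eval_eq, Tm.eval_add, Tm.eval_var, cons_z, cons_s] at this
  exact this (by rw [add_zero', add_zero']) (fun n h => by rw [add_suc, h, add_suc, add_suc]) c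

instance : AddCommMonoid M.N where
  add_assoc := add_assoc'
  zero_add := zero_add'
  add_zero := add_zero'
  add_comm := add_comm'
  nsmul := nsmulRec

theorem zero_mul' (a : M.N) : 0 * a = 0 := by
  have := ind' (A := Fml.eq (Tm.mul Tm.zero v0) Tm.zero) (by simp) M.nil
  simp only [Fml.eval_eq, Tm.eval_mul, Tm.eval_var, cons_z, Tm.eval_zero] at this
  exact this (mul_zero' 0) (fun n h => by rw [mul_suc, h, add_zero]) a

theorem suc_mul (a b : M.N) : suc a * b = a * b + b := by
  have := ind' (A := Fml.eq (Tm.mul (Tm.succ v1) v0) (Tm.add (Tm.mul v1 v0) v0)) (by simp)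
    (a ∷ M.nil)
  simp only [Fml.eval_eq, Tm.eval_add, Tm.eval_mul, Tm.eval_var, cons_z, cons_s,
    Tm.eval_succ'] at this
  refine this (by rw [mul_zero', mul_zero', add_zero]) (fun n h => ?_) b
  rw [mul_suc, h, mul_suc, add_suc, add_suc, add_right_comm]

theorem mul_comm' (a b : M.N) : a * b = b * a := by
  have := ind' (A := Fml.eq (Tm.mul v1 v0) (Tm.mul v0 v1)) (by simp) (a ∷ M.nil)
  simp only [Fml.eval_eq, Tm.eval_mul, Tm.eval_var, cons_z, cons_s] at this
  exact this (by rw [mul_zero', zero_mul']) (fun n h => by rw [mul_suc, h, suc_mul]) b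

theorem mul_add' (a b c : M.N) : a * (b + c) = a * b + a * c := by
  have := ind' (A := Fml.eq (Tm.mul v1 (Tm.add v2 v0)) (Tm.add (Tm.mul v1 v2) (Tm.mul v1 v0)))
    (by simp) (a ∷ b ∷ M.nil)
  simp only [Fml.eval_eq, Tm.eval_mul, Tm.eval_add, Tm.eval_var, cons_z, cons_s] at this
  refine this (by rw [mul_zero', add_zero, add_zero]) (fun n h => ?_) c
  rw [add_suc, mul_suc, h, mul_suc, add_assoc]

theorem mul_assoc' (a b c : M.N) : a * b * c = a * (b * c) := by
  have := ind' (A := Fml.eq (Tm.mul (Tm.mul v1 v2) v0) (Tm.mul v1 (Tm.mul v2 v0))) (by simp)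
    (a ∷ b ∷ M.nil)
  simp only [Fml.eval_eq, Tm.eval_mul, Tm.eval_var, cons_z, cons_s] at this
  refine this (by rw [mul_zero', mul_zero', mul_zero']) (fun n h => ?_) c
  rw [mul_suc, h, mul_suc, mul_add']

theorem suc_eq (a : M.N) : suc a = a + 1 := by
  rw [show (1 : M.N) = suc 0 from rfl, add_suc, add_zero]

theorem one_mul' (a : M.N) : 1 * a = a := by
  rw [show (1 : M.N) = suc 0 from rfl, suc_mul, zero_mul', zero_add]

instance : CommSemiring M.N where
  mul_assoc := mul_assoc'
  mul_comm := mul_comm'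
  one_mul := one_mul'
  mul_one a := by rw [mul_comm', one_mul']
  zero_mul := zero_mul'
  mul_zero := mul_zero'
  left_distrib := mul_add'
  right_distrib a b c := by rw [mul_comm', mul_add', mul_comm', mul_comm' c]

/-- Induction for quantifier-free formulas. -/
theorem ind {Γ : Ctx} {A : Fml (Ty.nat :: Γ)} (hA : A.QF) (e : M.Env Γ) (h0 : A.eval M (0 ∷ e))
    (hs : ∀ n, A.eval M (n ∷ e) → A.eval M ((n + 1) ∷ e)) (n : M.N) : A.eval M (n ∷ e) :=
  ind' hA e h0 (fun n h => by rw [suc_eq]; exact hs n h) n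

theorem add_one_ne_zero (a : M.N) : a + 1 ≠ 0 := by
  rw [← suc_eq]
  exact suc_ne_zero a

theorem prd_add_one (a : M.N) : prd (a + 1) = a := by
  rw [← suc_eq, prd_suc]

theorem eq_zero_or_exists_add_one (a : M.N) : a = 0 ∨ ∃ b, a = b + 1 := by
  have := ind (A := (Fml.eq v0 Tm.zero).not →ᶠ Fml.eq v0 (Tm.succ (Tm.pred v0)))
    (by simp) M.nil
  simp only [Fml.eval_imp, Fml.eval_not, Fml.eval_eq, Tm.eval_succ', Tm.eval_pred, Tm.eval_var,
    cons_z, Tm.eval_zero, suc_eq, prd_add_one] at this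
  have h := this (fun h => (h trivial).elim) (fun _ _ _ => trivial) a
  by_cases h0 : a = 0
  · exact Or.inl h0
  · exact Or.inr ⟨_, h h0⟩

theorem sub_add_one (a b : M.N) : a - (b + 1) = prd (a - b) := by
  rw [← suc_eq, sub_suc]

theorem add_one_sub_add_one (a b : M.N) : a + 1 - (b + 1) = a - b := by
  have := ind (A := Fml.eq (Tm.sub (Tm.succ v1) (Tm.succ v0)) (Tm.sub v1 v0)) (by simp) (a ∷ M.nil)
  simp only [Fml.eval_eq, Tm.eval_sub, Tm.eval_succ', Tm.eval_var, cons_z, cons_s, suc_eq] at this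
  refine this (by rw [sub_add_one, sub_zero', sub_zero', prd_add_one]) (fun n h => ?_) b
  rw [sub_add_one, h, sub_add_one]

theorem add_sub_cancel_left'' (a c : M.N) : a + c - a = c := by
  have := ind (A := Fml.eq (Tm.sub (Tm.add v0 v1) v0) v1) (by simp) (c ∷ M.nil)
  simp only [Fml.eval_eq, Tm.eval_sub, Tm.eval_add, Tm.eval_var, cons_z, cons_s] at this
  exact this (by rw [sub_zero', zero_add])
    (fun n h => by rw [add_right_comm, add_one_sub_add_one, h]) a

theorem zero_sub' (a : M.N) : 0 - a = 0 := by
  have := ind (A := Fml.eq (Tm.sub Tm.zero v0) Tm.zero) (by simp) M.nil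
  simp only [Fml.eval_eq, Tm.eval_sub, Tm.eval_zero, Tm.eval_var, cons_z] at this
  exact this (sub_zero' 0) (fun n h => by rw [sub_add_one, h, prd_zero]) a

theorem sub_add_right (a c : M.N) : a - (a + c) = 0 := by
  have := ind (A := Fml.eq (Tm.sub v0 (Tm.add v0 v1)) Tm.zero) (by simp) (c ∷ M.nil)
  simp only [Fml.eval_eq, Tm.eval_sub, Tm.eval_add, Tm.eval_zero, Tm.eval_var, cons_z,
    cons_s] at this
  exact this (zero_sub' _) (fun n h => by rw [add_right_comm, add_one_sub_add_one, h]) a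

/-- This yields the totality of the order, by induction on `a`. The disjunction is put as an
implication from a negation, which is one of the primitive connectives and keeps the formula
quantifier-free. -/
theorem add_sub_or (a b : M.N) : a + (b - a) = b ∨ b + (a - b) = a := by
  have := ind (A := (Fml.eq (Tm.add v0 (Tm.sub v1 v0)) v1).not →ᶠ
    Fml.eq (Tm.add v1 (Tm.sub v0 v1)) v0) (by simp) (b ∷ M.nil)
  simp only [Fml.eval_imp, Fml.eval_not, Fml.eval_eq, Tm.eval_sub, Tm.eval_add, Tm.eval_var,
    cons_z, cons_s] at this
  have h := this (fun h => (h (by rw [zero_add, sub_zero'])).elim) (fun n h h1 => ?_) a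
  · by_cases h0 : a + (b - a) = b
    · exact Or.inl h0
    · exact Or.inr (h h0)
  · by_cases h0 : n + (b - n) = b
    -- If `b - n` vanishes, then `n = b` and the second alternative holds at `n + 1`; if it is a
    -- successor, the first alternative persists.
    · rcases eq_zero_or_exists_add_one (b - n) with h2 | ⟨d, h2⟩
      · rw [h2, add_zero] at h0
        rw [h0, add_sub_cancel_left'']
      · rw [h2] at h0
        refine (h1 ?_).elim
        rw [← h0, ← add_assoc, add_right_comm n d 1, add_sub_cancel_left'']
    · have h2 := h h0
      rw [← h2, add_assoc, add_sub_cancel_left'']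

instance : LE M.N := ⟨fun a b => a - b = 0⟩

theorem le_def {M : Struc} [M.Extensional] (a b : M.N) : a ≤ b ↔ a - b = 0 := Iff.rfl

theorem le_iff_exists_add' {a b : M.N} : a ≤ b ↔ ∃ c, b = a + c := by
  constructor
  · intro h
    rw [le_def] at h
    rcases add_sub_or a b with h1 | h1
    · exact ⟨_, h1.symm⟩
    · rw [h, add_zero] at h1
      exact ⟨0, by rw [h1, add_zero]⟩
  · rintro ⟨c, rfl⟩
    exact sub_add_right a c

theorem add_left_cancel' {a b c : M.N} (h : a + b = a + c) : b = c := by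
  rw [← add_sub_cancel_left'' a b, h, add_sub_cancel_left'']

theorem eq_zero_of_add {a b : M.N} (h : a + b = 0) : a = 0 := by
  rcases eq_zero_or_exists_add_one a with h1 | ⟨c, rfl⟩
  · exact h1
  · rw [add_right_comm] at h
    exact (add_one_ne_zero _ h).elim

open Classical in
noncomputable instance : LinearOrder M.N where
  le_refl a := le_iff_exists_add'.2 ⟨0, (add_zero a).symm⟩
  le_trans a b c h h' := by
    obtain ⟨x, rfl⟩ := le_iff_exists_add'.1 h
    obtain ⟨y, rfl⟩ := le_iff_exists_add'.1 h'
    exact le_iff_exists_add'.2 ⟨x + y, add_assoc _ _ _⟩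
  le_antisymm a b h h' := by
    obtain ⟨x, rfl⟩ := le_iff_exists_add'.1 h
    obtain ⟨y, hy⟩ := le_iff_exists_add'.1 h'
    have h1 : a + 0 = a + (x + y) := by rw [add_zero, ← add_assoc, ← hy]
    rw [eq_zero_of_add (add_left_cancel' h1).symm, add_zero]
  le_total a b := by
    rcases add_sub_or a b with h | h
    · exact Or.inl (le_iff_exists_add'.2 ⟨_, h.symm⟩)
    · exact Or.inr (le_iff_exists_add'.2 ⟨_, h.symm⟩)
  toDecidableLE := inferInstance

instance : IsOrderedAddMonoid M.N where
  add_le_add_left a b h c := by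
    obtain ⟨x, rfl⟩ := le_iff_exists_add'.1 h
    exact le_iff_exists_add'.2 ⟨x, by rw [add_right_comm]⟩

instance : CanonicallyOrderedAdd M.N where
  exists_add_of_le h := le_iff_exists_add'.1 h
  le_self_add _ b := le_iff_exists_add'.2 ⟨b, rfl⟩
  le_add_self _ b := le_iff_exists_add'.2 ⟨b, add_comm _ _⟩

instance : IsCancelAdd M.N where
  add_left_cancel _ _ _ h := add_left_cancel' h
  add_right_cancel a b c h := add_left_cancel' (a := a) (by rwa [add_comm a, add_comm a])

theorem lt_iff_exists_add_one {a b : M.N} : a < b ↔ ∃ c, b = a + c + 1 := by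
  constructor
  · intro h
    obtain ⟨c, rfl⟩ := le_iff_exists_add'.1 h.le
    rcases eq_zero_or_exists_add_one c with rfl | ⟨d, rfl⟩
    · rw [add_zero] at h
      exact (lt_irrefl _ h).elim
    · exact ⟨d, (add_assoc _ _ _).symm⟩
  · rintro ⟨c, rfl⟩
    refine lt_of_le_of_ne (le_iff_exists_add'.2 ⟨c + 1, add_assoc _ _ _⟩) fun h => ?_
    rw [add_assoc] at h
    exact add_one_ne_zero c (add_left_cancel' (a := a) (by rw [← h, add_zero]))

theorem add_one_le_iff {a b : M.N} : a + 1 ≤ b ↔ a < b := by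
  rw [lt_iff_exists_add_one, le_iff_exists_add']
  simp only [add_right_comm]

theorem lt_add_one_iff {a b : M.N} : a < b + 1 ↔ a ≤ b := by
  rw [← add_one_le_iff, add_le_add_iff_right]

instance : IsStrictOrderedRing M.N where
  le_of_add_le_add_left a b c h := le_of_add_le_add_left h
  zero_le_one := zero_le
  exists_pair_ne := ⟨0, 1, fun h => suc_ne_zero (0 : M.N) h.symm⟩
  mul_lt_mul_of_pos_left a ha b c h := by
    obtain ⟨x, rfl⟩ := lt_iff_exists_add_one.1 h
    obtain ⟨y, rfl⟩ := lt_iff_exists_add_one.1 ha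
    -- With a = y + 1, one has a(b + x + 1) = ab + (ax + y) + 1.
    refine lt_iff_exists_add_one.2 ⟨(0 + y + 1) * x + y, ?_⟩
    ring
  mul_lt_mul_of_pos_right a ha b c h := by
    obtain ⟨x, rfl⟩ := lt_iff_exists_add_one.1 h
    obtain ⟨y, rfl⟩ := lt_iff_exists_add_one.1 ha
    refine lt_iff_exists_add_one.2 ⟨(0 + y + 1) * x + y, ?_⟩
    ring

instance : OrderedSub M.N where
  tsub_le_iff_right a b c := by
    rcases le_total a b with h | h
    · rw [(le_def a b).1 h]
      exact ⟨fun _ => h.trans le_add_self, fun _ => zero_le⟩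
    · obtain ⟨x, rfl⟩ := le_iff_exists_add'.1 h
      rw [add_sub_cancel_left'', add_comm b x, add_le_add_iff_right]

end Struc

section

variable {M : Struc} [hM : M.Extensional] {Γ : Ctx} (e : M.Env Γ)

@[simp] theorem Tm.eval_succ (t : Tm Γ Ty.nat) : (Tm.succ t).eval M e = t.eval M e + 1 :=
  Struc.suc_eq _

@[simp] theorem Fml.eval_leF (a b : Tm Γ Ty.nat) :
    (leF a b).eval M e ↔ a.eval M e ≤ b.eval M e := by
  simp [leF, Struc.le_def]

@[simp] theorem Fml.eval_ltF_iff (a b : Tm Γ Ty.nat) :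
    (ltF a b).eval M e ↔ a.eval M e < b.eval M e := by
  simp [ltF, Struc.add_one_le_iff]

end

/-! The field of fractions of differences of an ordered semiring. -/

/-- `⟨a, b, c, _⟩` represents `(a - b) / c`. -/
structure PreFrac (α : Type) [CommSemiring α] [LT α] where
  pos : α
  neg : α
  den : α
  den_pos : 0 < den

variable {α : Type} [CommSemiring α] [LinearOrder α] [IsStrictOrderedRing α]

namespace PreFrac

theorem eq_of_mul_right {a b c : α} (hc : 0 < c) (h : a * c = b * c) : a = b :=
  le_antisymm (le_of_mul_le_mul_right h.le hc) (le_of_mul_le_mul_right h.ge hc)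

instance setoid : Setoid (PreFrac α) where
  r x y := x.pos * y.den + y.neg * x.den = y.pos * x.den + x.neg * y.den
  iseqv := ⟨fun _ => rfl, fun h => h.symm, fun {x y z} h h' => by
    refine eq_of_mul_right y.den_pos ?_
    linear_combination z.den * h + x.den * h'⟩

theorem equiv_def (x y : PreFrac α) :
    x ≈ y ↔ x.pos * y.den + y.neg * x.den = y.pos * x.den + x.neg * y.den := Iff.rfl

end PreFrac

/-- Differences and quotients are formed in one step, matching the codes (a - b)/(c + 1). The result
is an ordered field, where linear arithmetic on approximations becomes available. -/
def Frac (α : Type) [CommSemiring α] [LinearOrder α] [IsStrictOrderedRing α] : Type :=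
  Quotient (PreFrac.setoid (α := α))

namespace Frac

open PreFrac

/-- `(a - b) / c`. -/
def mk (x : PreFrac α) : Frac α := Quotient.mk _ x

theorem mk_eq {x y : PreFrac α} :
    mk x = mk y ↔ x.pos * y.den + y.neg * x.den = y.pos * x.den + x.neg * y.den :=
  Quotient.eq

theorem ind {p : Frac α → Prop} (h : ∀ x, p (mk x)) (x : Frac α) : p x := Quotient.ind h x

instance : Zero (Frac α) := ⟨mk ⟨0, 0, 1, one_pos⟩⟩
instance : One (Frac α) := ⟨mk ⟨1, 0, 1, one_pos⟩⟩

instance : Add (Frac α) where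
  add := Quotient.map₂ (fun x y => ⟨x.pos * y.den + y.pos * x.den, x.neg * y.den + y.neg * x.den,
    x.den * y.den, mul_pos x.den_pos y.den_pos⟩) (by
      intro x x' hx y y' hy
      rw [equiv_def] at *
      dsimp only
      linear_combination (y.den * y'.den) * hx + (x.den * x'.den) * hy)

instance : Mul (Frac α) where
  mul := Quotient.map₂ (fun x y => ⟨x.pos * y.pos + x.neg * y.neg, x.pos * y.neg + x.neg * y.pos,
    x.den * y.den, mul_pos x.den_pos y.den_pos⟩) (by
      intro x x' hx y y' hy
      rw [equiv_def] at *
      dsimp only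
      -- Without subtraction the factors are exchanged one at a time, through the intermediate
      -- product of `x'` and `y`, whose denominator is cancelled at the end.
      have h1 : (x.pos * y.pos + x.neg * y.neg) * (x'.den * y.den) +
          (x'.pos * y.neg + x'.neg * y.pos) * (x.den * y.den) =
          (x'.pos * y.pos + x'.neg * y.neg) * (x.den * y.den) +
          (x.pos * y.neg + x.neg * y.pos) * (x'.den * y.den) := by
        linear_combination (y.den * y.pos) * hx + (y.den * y.neg) * hx.symm
      have h2 : (x'.pos * y.pos + x'.neg * y.neg) * (x'.den * y'.den) +
          (x'.pos * y'.neg + x'.neg * y'.pos) * (x'.den * y.den) =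
          (x'.pos * y'.pos + x'.neg * y'.neg) * (x'.den * y.den) +
          (x'.pos * y.neg + x'.neg * y.pos) * (x'.den * y'.den) := by
        linear_combination (x'.den * x'.pos) * hy + (x'.den * x'.neg) * hy.symm
      refine eq_of_mul_right (mul_pos x'.den_pos y.den_pos) ?_
      linear_combination (x'.den * y'.den) * h1 + (x.den * y.den) * h2)

instance : Neg (Frac α) where
  neg := Quotient.map (fun x => ⟨x.neg, x.pos, x.den, x.den_pos⟩) (by
      intro x x' hx
      rw [equiv_def] at *
      dsimp only
      linear_combination hx.symm)

instance : LE (Frac α) where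
  le := Quotient.lift₂ (fun x y => x.pos * y.den + y.neg * x.den ≤ y.pos * x.den + x.neg * y.den) (by
      intro x y x' y' hx hy
      rw [equiv_def] at *
      apply propext
      constructor
      · intro h
        refine le_of_mul_le_mul_right ?_ (mul_pos x.den_pos y.den_pos)
        have := x'.den_pos.le
        have := y'.den_pos.le
        linear_combination (x'.den * y'.den) * h + (y.den * y'.den) * hx.symm +
          (x.den * x'.den) * hy
      · intro h
        refine le_of_mul_le_mul_right ?_ (mul_pos x'.den_pos y'.den_pos)
        have := x.den_pos.le
        have := y.den_pos.le
        linear_combination (x.den * y.den) * h + (y.den * y'.den) * hx +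
          (x.den * x'.den) * hy.symm)

theorem zero_def : (0 : Frac α) = mk ⟨0, 0, 1, one_pos⟩ := rfl

theorem one_def : (1 : Frac α) = mk ⟨1, 0, 1, one_pos⟩ := rfl

theorem mk_add (x y : PreFrac α) : mk x + mk y =
    mk ⟨x.pos * y.den + y.pos * x.den, x.neg * y.den + y.neg * x.den,
      x.den * y.den, mul_pos x.den_pos y.den_pos⟩ := rfl

theorem mk_mul (x y : PreFrac α) : mk x * mk y =
    mk ⟨x.pos * y.pos + x.neg * y.neg, x.pos * y.neg + x.neg * y.pos,
    x.den * y.den, mul_pos x.den_pos y.den_pos⟩ := rfl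

theorem neg_mk (x : PreFrac α) : -mk x = mk ⟨x.neg, x.pos, x.den, x.den_pos⟩ := rfl

theorem mk_le {x y : PreFrac α} :
    mk x ≤ mk y ↔ x.pos * y.den + y.neg * x.den ≤ y.pos * x.den + x.neg * y.den := Iff.rfl

instance : CommRing (Frac α) where
  add_assoc x y z := by
    induction x using ind; induction y using ind; induction z using ind
    simp only [mk_add, mk_eq]; ring
  zero_add x := by
    induction x using ind
    simp only [zero_def, mk_add, mk_eq]; ring
  add_zero x := by
    induction x using ind
    simp only [zero_def, mk_add, mk_eq]; ring
  add_comm x y := by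
    induction x using ind; induction y using ind
    simp only [mk_add, mk_eq]; ring
  neg_add_cancel x := by
    induction x using ind
    simp only [zero_def, neg_mk, mk_add, mk_eq]; ring
  mul_assoc x y z := by
    induction x using ind; induction y using ind; induction z using ind
    simp only [mk_mul, mk_eq]; ring
  one_mul x := by
    induction x using ind
    simp only [one_def, mk_mul, mk_eq]; ring
  mul_one x := by
    induction x using ind
    simp only [one_def, mk_mul, mk_eq]; ring
  zero_mul x := by
    induction x using ind
    simp only [zero_def, mk_mul, mk_eq]; ring
  mul_zero x := by
    induction x using ind
    simp only [zero_def, mk_mul, mk_eq]; ring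
  mul_comm x y := by
    induction x using ind; induction y using ind
    simp only [mk_mul, mk_eq]; ring
  left_distrib x y z := by
    induction x using ind; induction y using ind; induction z using ind
    simp only [mk_mul, mk_add, mk_eq]; ring
  right_distrib x y z := by
    induction x using ind; induction y using ind; induction z using ind
    simp only [mk_mul, mk_add, mk_eq]; ring
  nsmul := nsmulRec
  zsmul := zsmulRec

open Classical in
noncomputable instance : LinearOrder (Frac α) where
  le_refl x := by
    induction x using ind
    exact mk_le.2 le_rfl
  le_trans x y z h h' := by
    induction x using ind with | _ x
    induction y using ind with | _ y
    induction z using ind with | _ z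
    rw [mk_le] at *
    refine le_of_mul_le_mul_right ?_ y.den_pos
    have := z.den_pos.le
    have := x.den_pos.le
    linear_combination z.den * h + x.den * h'
  le_antisymm x y h h' := by
    induction x using ind; induction y using ind
    rw [mk_le] at *
    exact mk_eq.2 (le_antisymm h h')
  le_total x y := by
    induction x using ind; induction y using ind
    simp only [mk_le]
    exact le_total _ _
  toDecidableLE := inferInstance

theorem mk_pos_iff {x : PreFrac α} : 0 < mk x ↔ x.neg < x.pos := by
  rw [← not_le, zero_def, mk_le, ← not_le]
  simp

instance : IsOrderedAddMonoid (Frac α) where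
  add_le_add_left x y h z := by
    induction x using ind with | _ x
    induction y using ind with | _ y
    induction z using ind with | _ z
    rw [mk_le] at h
    rw [mk_add, mk_add, mk_le]
    dsimp only
    have := z.den_pos.le
    linear_combination (z.den * z.den) * h

instance : Nontrivial (Frac α) := ⟨0, 1, by simp [zero_def, one_def, mk_eq]⟩

instance : ZeroLEOneClass (Frac α) := ⟨by rw [zero_def, one_def, mk_le]; simp⟩

variable [ExistsAddOfLE α]

instance : IsStrictOrderedRing (Frac α) := IsStrictOrderedRing.of_mul_pos fun x y hx hy => by
  induction x using ind with | _ x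
  induction y using ind with | _ y
  rw [mk_mul]
  rw [mk_pos_iff] at *
  obtain ⟨c, hc, hc'⟩ := lt_iff_exists_pos_add.1 hx
  obtain ⟨d, hd, hd'⟩ := lt_iff_exists_pos_add.1 hy
  dsimp only
  rw [← hc', ← hd']
  linear_combination mul_pos hc hd

/-- For a ≠ b one of the two is the other plus a positive element, and that element becomes the
denominator of the inverse of (a - b)/c. -/
theorem exists_mul_eq_one {x : Frac α} (hx : x ≠ 0) : ∃ y, x * y = 1 := by
  induction x using ind with | _ x
  have h : x.pos ≠ x.neg := fun h => hx (by simp [zero_def, mk_eq, h])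
  rcases lt_or_gt_of_ne h with h | h
  · obtain ⟨c, hc, hc'⟩ := lt_iff_exists_pos_add.1 h
    refine ⟨mk ⟨0, x.den, c, hc⟩, ?_⟩
    simp only [one_def, mk_mul, mk_eq, ← hc']
    ring
  · obtain ⟨c, hc, hc'⟩ := lt_iff_exists_pos_add.1 h
    refine ⟨mk ⟨x.den, 0, c, hc⟩, ?_⟩
    simp only [one_def, mk_mul, mk_eq, ← hc']
    ring

open Classical in
noncomputable instance : Field (Frac α) where
  inv x := if h : x = 0 then 0 else (exists_mul_eq_one h).choose
  mul_inv_cancel x hx := by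
    simp only [dif_neg hx]
    exact (exists_mul_eq_one hx).choose_spec
  inv_zero := dif_pos rfl
  nnqsmul := _
  nnqsmul_def := fun _ _ => rfl
  qsmul := _
  qsmul_def := fun _ _ => rfl

/-- The embedding of the semiring. -/
def of : α →+* Frac α where
  toFun a := mk ⟨a, 0, 1, one_pos⟩
  map_zero' := rfl
  map_one' := rfl
  map_add' a b := by simp only [mk_add, mk_eq]; ring
  map_mul' a b := by simp only [mk_mul, mk_eq]; ring

theorem of_le {a b : α} : of a ≤ of b ↔ a ≤ b := by
  change mk _ ≤ mk _ ↔ _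
  simp [mk_le]

theorem of_lt {a b : α} : of a < of b ↔ a < b := lt_iff_lt_of_le_iff_le of_le

end Frac

/-! Elementary functions in extensional models. -/

section Functions

variable {M : Struc} [hM : M.Extensional] {Γ : Ctx}

theorem Struc.rec_add_one (n a : M.N) (f : M.carrier (Ty.nat ⇒ Ty.nat ⇒ Ty.nat)) :
    Struc.recN (n + 1) a f = f ⬝ₘ Struc.recN n a f ⬝ₘ n := by
  rw [← Struc.suc_eq, Struc.rec_suc]

/-- The value of a recursion as a function of the recursion argument. -/
def Tm.recVal (e : M.Env Γ) (a : Tm Γ Ty.nat) (s : Tm (Ty.nat :: Ty.nat :: Γ) Ty.nat) (n : M.N) :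
    M.N :=
  Struc.recN n (a.eval M e) (s.lam.lam.eval M e)

theorem Tm.recVal_zero (e : M.Env Γ) (a : Tm Γ Ty.nat) (s : Tm (Ty.nat :: Ty.nat :: Γ) Ty.nat) :
    Tm.recVal e a s 0 = a.eval M e := Struc.rec_zero _ _

theorem Tm.recVal_add_one (e : M.Env Γ) (a : Tm Γ Ty.nat)
    (s : Tm (Ty.nat :: Ty.nat :: Γ) Ty.nat) (n : M.N) :
    Tm.recVal e a s (n + 1) = s.eval M (n ∷ Tm.recVal e a s n ∷ e) := by
  rw [Tm.recVal, Struc.rec_add_one, Tm.eval_lam, Tm.eval_lam]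
  rfl

open Classical in
@[simp] theorem Tm.eval_cond (e : M.Env Γ) (c a b : Tm Γ Ty.nat) :
    (Tm.cond c a b).eval M e = if c.eval M e = 0 then a.eval M e else b.eval M e := by
  rw [Tm.cond, Tm.eval_primRec]
  rcases Struc.eq_zero_or_exists_add_one (c.eval M e) with h | ⟨d, h⟩
  · rw [if_pos h, h, Struc.rec_zero]
  · rw [if_neg (h ▸ Struc.add_one_ne_zero d), h, Struc.rec_add_one, Tm.eval_lam, Tm.eval_lam,
      Tm.eval_wk, Tm.eval_wk]

namespace Struc

def pow2 (n : M.N) : M.N := (Tm.pow2 v0).eval M (n ∷ M.nil)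

def tri (n : M.N) : M.N := (Tm.tri v0).eval M (n ∷ M.nil)

def diag (n : M.N) : M.N := (Tm.diag v0).eval M (n ∷ M.nil)

def pair (a b : M.N) : M.N := tri (a + b) + b

def snd (z : M.N) : M.N := z - tri (diag z)

def fst (z : M.N) : M.N := diag z - snd z

/-- The least `i < n` with `f(i) = 0`, and `n` if there is none. -/
def mu (f : M.carrier Ty.one) (n : M.N) : M.N :=
  (Tm.primRec v0 Tm.zero (Tm.cond (Tm.var (Var.s (Var.s (Var.s Var.z))) ⬝ₜ v1) v1 (Tm.succ v0))).eval
    M (n ∷ f ∷ M.nil)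

/-- `f(0) + … + f(n-1)`. -/
def sum (f : M.carrier Ty.one) (n : M.N) : M.N :=
  (Tm.primRec v0 Tm.zero (Tm.add v1 (Tm.var (Var.s (Var.s (Var.s Var.z))) ⬝ₜ v0))).eval
    M (n ∷ f ∷ M.nil)

end Struc

def Tm.mu (f : Tm Γ Ty.one) (n : Tm Γ Ty.nat) : Tm Γ Ty.nat :=
  Tm.primRec n Tm.zero (Tm.cond (f.wk.wk ⬝ₜ v1) v1 (Tm.succ v0))

def Tm.sum (f : Tm Γ Ty.one) (n : Tm Γ Ty.nat) : Tm Γ Ty.nat :=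
  Tm.primRec n Tm.zero (Tm.add v1 (f.wk.wk ⬝ₜ v0))

section

variable (e : M.Env Γ)

@[simp] theorem Tm.eval_pow2 (t : Tm Γ Ty.nat) :
    (Tm.pow2 t).eval M e = Struc.pow2 (t.eval M e) :=
  Tm.eval_primRec_congr rfl (by simp) fun _ _ => by simp

@[simp] theorem Tm.eval_tri (t : Tm Γ Ty.nat) : (Tm.tri t).eval M e = Struc.tri (t.eval M e) :=
  Tm.eval_primRec_congr rfl (by simp) fun _ _ => by simp

@[simp] theorem Tm.eval_diag (t : Tm Γ Ty.nat) : (Tm.diag t).eval M e = Struc.diag (t.eval M e) :=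
  Tm.eval_primRec_congr rfl (by simp) fun _ _ => by simp

@[simp] theorem Tm.eval_pair (a b : Tm Γ Ty.nat) :
    (Tm.pair a b).eval M e = Struc.pair (a.eval M e) (b.eval M e) := by
  simp [Tm.pair, Struc.pair]

@[simp] theorem Tm.eval_snd (t : Tm Γ Ty.nat) : (Tm.snd t).eval M e = Struc.snd (t.eval M e) := by
  simp [Tm.snd, Struc.snd]

@[simp] theorem Tm.eval_fst (t : Tm Γ Ty.nat) : (Tm.fst t).eval M e = Struc.fst (t.eval M e) := by
  simp [Tm.fst, Struc.fst]

@[simp] theorem Tm.eval_mu (f : Tm Γ Ty.one) (n : Tm Γ Ty.nat) :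
    (Tm.mu f n).eval M e = Struc.mu (f.eval M e) (n.eval M e) :=
  Tm.eval_primRec_congr rfl (by simp) fun _ _ => by simp

@[simp] theorem Tm.eval_sum (f : Tm Γ Ty.one) (n : Tm Γ Ty.nat) :
    (Tm.sum f n).eval M e = Struc.sum (f.eval M e) (n.eval M e) :=
  Tm.eval_primRec_congr rfl (by simp) fun _ _ => by simp

end

namespace Struc

theorem pow2_zero : pow2 (0 : M.N) = 1 := by
  refine (Tm.recVal_zero _ _ _).trans ?_
  simp

theorem pow2_add_one (n : M.N) : pow2 (n + 1) = pow2 n + pow2 n := by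
  refine (Tm.recVal_add_one _ _ _ n).trans ?_
  simp only [Tm.eval_add, Tm.eval_var, cons_s, cons_z]
  rfl

theorem lt_pow2 (n : M.N) : n < pow2 n := by
  have := ind (A := ltF v0 (Tm.pow2 v0)) (by simp) M.nil
  simp only [Fml.eval_ltF_iff, Tm.eval_pow2, Tm.eval_var, cons_z] at this
  refine this (by rw [pow2_zero]; exact zero_lt_one) (fun n h => ?_) n
  rw [pow2_add_one]
  exact add_lt_add_of_lt_of_le h (add_one_le_iff.2 (zero_le.trans_lt h) |>.trans' (by simp))

theorem pow2_pos (n : M.N) : 0 < pow2 n := zero_le.trans_lt (lt_pow2 n)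

theorem pow2_mono {n m : M.N} (h : n ≤ m) : pow2 n ≤ pow2 m := by
  obtain ⟨c, rfl⟩ := le_iff_exists_add'.1 h
  have := ind (A := leF (Tm.pow2 v1) (Tm.pow2 (Tm.add v1 v0))) (by simp) (n ∷ M.nil)
  simp only [Fml.eval_leF, Tm.eval_pow2, Tm.eval_add, Tm.eval_var, cons_z, cons_s] at this
  refine this (by rw [add_zero]) (fun m h => h.trans ?_) c
  rw [← add_assoc, pow2_add_one]
  exact le_self_add

theorem tri_add_one (n : M.N) : tri (n + 1) = tri n + (n + 1) := by
  refine (Tm.recVal_add_one _ _ _ n).trans ?_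
  simp only [Tm.eval_add, Tm.eval_succ, Tm.eval_var, cons_s, cons_z]
  rfl

theorem tri_zero : tri (0 : M.N) = 0 := Tm.recVal_zero _ _ _

theorem tri_mono {n m : M.N} (h : n ≤ m) : tri n ≤ tri m := by
  obtain ⟨c, rfl⟩ := le_iff_exists_add'.1 h
  have := ind (A := leF (Tm.tri v1) (Tm.tri (Tm.add v1 v0))) (by simp) (n ∷ M.nil)
  simp only [Fml.eval_leF, Tm.eval_tri, Tm.eval_add, Tm.eval_var, cons_z, cons_s] at this
  refine this (by rw [add_zero]) (fun m h => h.trans ?_) c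
  rw [← add_assoc, tri_add_one]
  exact le_self_add

theorem diag_zero : diag (0 : M.N) = 0 := Tm.recVal_zero _ _ _

open Classical in
theorem diag_add_one (z : M.N) :
    diag (z + 1) = if tri (diag z + 1) ≤ z + 1 then diag z + 1 else diag z := by
  refine (Tm.recVal_add_one _ _ _ z).trans ?_
  simp only [Tm.eval_cond, Tm.eval_sub, Tm.eval_tri, Tm.eval_succ, Tm.eval_var, cons_s, cons_z,
    ← le_def]
  rfl

/-- The pair of inequalities is the invariant of the recursion: the index steps up exactly when the
next triangular number is reached. -/
theorem tri_diag (z : M.N) : tri (diag z) ≤ z ∧ z < tri (diag z + 1) := by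
  have := ind (A := leF (Tm.tri (Tm.diag v0)) v0 ∧ᶠ ltF v0 (Tm.tri (Tm.succ (Tm.diag v0))))
    (by simp) M.nil
  simp only [Fml.eval_and, Fml.eval_leF, Fml.eval_ltF_iff, Tm.eval_tri, Tm.eval_diag, Tm.eval_succ,
    Tm.eval_var, cons_z] at this
  refine this ?_ (fun n h => ?_) z
  · rw [diag_zero, tri_add_one, tri_zero]
    simp
  · rw [diag_add_one]
    split_ifs with h1
    · refine ⟨h1, ?_⟩
      rw [tri_add_one (diag n + 1)]
      exact lt_of_le_of_lt (add_one_le_iff.2 h.2)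
        (lt_add_of_pos_right _ (zero_le.trans_lt (lt_add_one _)))
    · exact ⟨h.1.trans le_self_add, not_le.1 h1⟩

theorem diag_pair (a b : M.N) : diag (pair a b) = a + b := by
  obtain ⟨h1, h2⟩ := tri_diag (pair a b)
  apply le_antisymm
  · by_contra h
    have h3 := tri_mono (add_one_le_iff.2 (not_le.1 h))
    have h4 := h3.trans h1
    rw [tri_add_one, pair, add_le_add_iff_left] at h4
    exact absurd (h4.trans (le_add_self : b ≤ a + b)) (not_le.2 (lt_add_one _))
  · by_contra h
    have h3 := tri_mono (add_one_le_iff.2 (not_le.1 h))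
    exact absurd (h2.trans_le (h3.trans le_self_add)) (lt_irrefl _)

@[simp] theorem snd_pair (a b : M.N) : snd (pair a b) = b := by
  rw [snd, diag_pair, pair, add_sub_cancel_left'']

@[simp] theorem fst_pair (a b : M.N) : fst (pair a b) = a := by
  rw [fst, snd_pair, diag_pair, add_comm, add_sub_cancel_left'']

theorem pair_lt {a b n : M.N} (h : a + b < n) : pair a b < tri n := by
  refine lt_of_lt_of_le ?_ (tri_mono (add_one_le_iff.2 h))
  rw [pair, tri_add_one]
  exact (add_lt_add_iff_left _).2 (lt_add_one_iff.2 le_add_self)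

open Classical in
theorem mu_add_one (f : M.carrier Ty.one) (n : M.N) :
    mu f (n + 1) = if f ⬝ₘ mu f n = 0 then mu f n else n + 1 := by
  refine (Tm.recVal_add_one _ _ _ n).trans ?_
  simp only [Tm.eval_cond, Tm.eval_succ, Tm.eval_app, Tm.eval_var, cons_s, cons_z]
  rfl

theorem mu_zero (f : M.carrier Ty.one) : mu f 0 = 0 := Tm.recVal_zero _ _ _

theorem mu_le_and (f : M.carrier Ty.one) (n : M.N) :
    mu f n ≤ n ∧ (mu f n < n → f ⬝ₘ mu f n = 0) := by
  have := ind (A := leF (Tm.mu v1 v0) v0 ∧ᶠ (ltF (Tm.mu v1 v0) v0 →ᶠ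
    Fml.eq (v1 ⬝ₜ Tm.mu v1 v0) Tm.zero)) (by simp) (f ∷ M.nil)
  simp only [Fml.eval_and, Fml.eval_imp, Fml.eval_eq, Fml.eval_leF, Fml.eval_ltF_iff, Tm.eval_mu,
    Tm.eval_app, Tm.eval_zero, Tm.eval_var, cons_z, cons_s] at this
  refine this ?_ (fun n h => ?_) n
  · rw [mu_zero]
    exact ⟨le_rfl, fun h => (lt_irrefl _ h).elim⟩
  · rw [mu_add_one]
    split_ifs with h1
    · exact ⟨h.1.trans le_self_add, fun _ => h1⟩
    · exact ⟨le_rfl, fun h => (lt_irrefl _ h).elim⟩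

theorem mu_le (f : M.carrier Ty.one) (n : M.N) : mu f n ≤ n := (mu_le_and f n).1

theorem app_mu {f : M.carrier Ty.one} {n : M.N} (h : mu f n < n) : f ⬝ₘ mu f n = 0 :=
  (mu_le_and f n).2 h

theorem app_ne_zero_of_lt_mu {f : M.carrier Ty.one} {i n : M.N} (h : i < mu f n) :
    f ⬝ₘ i ≠ 0 := by
  have := ind (A := ltF v1 (Tm.mu v2 v0) →ᶠ (Fml.eq (v2 ⬝ₜ v1) Tm.zero).not) (by simp)
    (i ∷ f ∷ M.nil)
  simp only [Fml.eval_imp, Fml.eval_not, Fml.eval_eq, Fml.eval_ltF_iff, Tm.eval_mu,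
    Tm.eval_app, Tm.eval_zero, Tm.eval_var, cons_z, cons_s] at this
  refine this (fun h => ?_) (fun n ih h => ?_) n h
  · rw [mu_zero] at h
    exact (not_lt.2 zero_le h).elim
  · rw [mu_add_one] at h
    split_ifs at h with h1
    · exact ih h
    -- The search found no zero below `n`, so it stands at `n`; the only new index to check is `n`,
    -- which is not a zero either.
    · have h2 : mu f n = n := (mu_le f n).antisymm (not_lt.1 fun h2 => h1 (app_mu h2))
      rw [h2] at h1 ih
      rcases (lt_add_one_iff.1 h).lt_or_eq with h3 | rfl
      · exact ih h3
      · exact h1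

theorem mu_lt_iff {f : M.carrier Ty.one} {n : M.N} : mu f n < n ↔ ∃ i < n, f ⬝ₘ i = 0 := by
  constructor
  · exact fun h => ⟨_, h, app_mu h⟩
  · rintro ⟨i, hi, h0⟩
    exact lt_of_le_of_lt (not_lt.1 fun h => app_ne_zero_of_lt_mu h h0) hi

theorem mu_le_of {f : M.carrier Ty.one} {n i : M.N} (h : f ⬝ₘ i = 0) : mu f n ≤ i :=
  not_lt.1 fun h' => app_ne_zero_of_lt_mu h' h

theorem sum_add_one (f : M.carrier Ty.one) (n : M.N) : sum f (n + 1) = sum f n + f ⬝ₘ n := by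
  refine (Tm.recVal_add_one _ _ _ n).trans ?_
  simp only [Tm.eval_add, Tm.eval_app, Tm.eval_var, cons_s, cons_z]
  rfl

theorem le_sum {f : M.carrier Ty.one} {i n : M.N} (h : i < n) : f ⬝ₘ i ≤ sum f n := by
  have := ind (A := ltF v1 v0 →ᶠ leF (v2 ⬝ₜ v1) (Tm.sum v2 v0)) (by simp) (i ∷ f ∷ M.nil)
  simp only [Fml.eval_imp, Fml.eval_leF, Fml.eval_ltF_iff, Tm.eval_sum,
    Tm.eval_app, Tm.eval_var, cons_z, cons_s] at this
  refine this (fun h => (not_lt.2 zero_le h).elim) (fun n ih h => ?_) n h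
  rw [sum_add_one]
  rcases (lt_add_one_iff.1 h).lt_or_eq with h3 | rfl
  · exact (ih h3).trans le_self_add
  · exact le_add_self

end Struc

/-! Quantifier-free formulas as decidable predicates. -/

/-- A term that vanishes exactly if the quantifier-free formula holds. -/
def Fml.chi : {Γ : Ctx} → Fml Γ → Tm Γ Ty.nat
  | _, Fml.bot => Tm.succ Tm.zero
  | _, Fml.eq a b => Tm.add (Tm.sub a b) (Tm.sub b a)
  | _, Fml.st _ => Tm.zero
  | _, Fml.imp A B => Tm.cond A.chi B.chi Tm.zero
  | _, Fml.all _ _ => Tm.zero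

theorem Fml.eval_chi {A : Fml Γ} (hA : A.QF) (e : M.Env Γ) : A.chi.eval M e = 0 ↔ A.eval M e := by
  induction A with
  | bot => simp [Fml.chi]
  | eq a b =>
    simp only [Fml.chi, Tm.eval_add, Tm.eval_sub, Fml.eval_eq, add_eq_zero, ← Struc.le_def]
    exact le_antisymm_iff.symm
  | st a => exact hA.elim
  | imp A B ihA ihB =>
    simp only [Fml.chi, Tm.eval_cond, Fml.eval_imp, ← ihA hA.1, ← ihB hA.2, Tm.eval_zero]
    split_ifs with h
    · exact ⟨fun h' _ => h', fun h' => h' h⟩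
    · exact ⟨fun _ h' => (h h').elim, fun _ => rfl⟩
  | all σ A => exact hA.elim

/-- The least `i < n` with `A(i)`, and `n` if there is none. -/
def Fml.least (A : Fml (Ty.nat :: Γ)) (n : Tm Γ Ty.nat) : Tm Γ Ty.nat := Tm.mu A.chi.lam n

/-- `(∃ i < n) A(i)` as a quantifier-free formula. -/
def Fml.bex (n : Tm Γ Ty.nat) (A : Fml (Ty.nat :: Γ)) : Fml Γ := ltF (A.least n) n

-- A bounded existential quantifier is an equation between terms by means of the search, so it may
-- occur in induction and in `Struc.overspill`.
@[simp] theorem Fml.qf_bex (n : Tm Γ Ty.nat) (A : Fml (Ty.nat :: Γ)) : (Fml.bex n A).QF := trivial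

section

variable {A : Fml (Ty.nat :: Γ)} {n : Tm Γ Ty.nat} {e : M.Env Γ}

theorem Fml.eval_bex (hA : A.QF) (n : Tm Γ Ty.nat) (e : M.Env Γ) :
    (Fml.bex n A).eval M e ↔ ∃ i < n.eval M e, A.eval M (i ∷ e) := by
  simp only [Fml.bex, Fml.least, Fml.eval_ltF_iff, Tm.eval_mu, Struc.mu_lt_iff, Tm.eval_lam,
    Fml.eval_chi hA]

theorem Fml.eval_least_of_lt (hA : A.QF) (h : (A.least n).eval M e < n.eval M e) :
    A.eval M ((A.least n).eval M e ∷ e) := by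
  simp only [Fml.least, Tm.eval_mu] at h ⊢
  rw [← Fml.eval_chi hA, ← Tm.eval_lam]
  exact Struc.app_mu h

theorem Fml.eval_least_lt_iff (hA : A.QF) :
    (A.least n).eval M e < n.eval M e ↔ ∃ i < n.eval M e, A.eval M (i ∷ e) := by
  rw [← Fml.eval_bex hA, Fml.bex, Fml.eval_ltF_iff]

theorem Fml.eval_least_le (hA : A.QF) {i : M.N} (h : A.eval M (i ∷ e)) :
    (A.least n).eval M e ≤ i := by
  simp only [Fml.least, Tm.eval_mu]
  refine Struc.mu_le_of ?_
  rwa [Tm.eval_lam, Fml.eval_chi hA]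

end

end Functions

/-! Rational and real numbers in extensional models. -/

section Reals

variable {M : Struc} [hM : M.Extensional] {Γ : Ctx}

/-- The field in which the values of rational codes live. -/
abbrev Struc.Q (M : Struc) [M.Extensional] : Type := Frac M.N

namespace Struc

open Frac

/-- The rational number coded by `q`. -/
noncomputable def qval (q : M.N) : M.Q := (of (fst (fst q)) - of (snd (fst q))) / (of (snd q) + 1)

theorem of_nonneg (a : M.N) : 0 ≤ of a := by
  rw [← map_zero of, of_le]
  exact zero_le

theorem of_add_one_pos (a : M.N) : 0 < of a + 1 := by
  have := of_nonneg a
  linarith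

/-- `2^{-n}`. -/
noncomputable def tp (n : M.N) : M.Q := (of (pow2 n))⁻¹

theorem of_pow2_pos (n : M.N) : 0 < of (pow2 n) := by
  rw [← map_zero of, of_lt]
  exact pow2_pos n

theorem tp_pos (n : M.N) : 0 < tp n := inv_pos.2 (of_pow2_pos n)

theorem tp_mono {n m : M.N} (h : n ≤ m) : tp m ≤ tp n :=
  inv_anti₀ (of_pow2_pos n) (of_le.2 (pow2_mono h))

theorem tp_add_one (n : M.N) : tp (n + 1) = tp n / 2 := by
  rw [tp, tp, pow2_add_one, map_add]
  have := (of_pow2_pos n).ne'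
  field_simp
  norm_num

theorem tp_le_inv {k : M.N} (hk : 0 < k) : tp k ≤ (of k)⁻¹ := by
  refine inv_anti₀ ?_ (of_le.2 (lt_pow2 k).le)
  rwa [← map_zero of, of_lt]

end Struc

section

open Struc Frac

variable (e : M.Env Γ) (a b c q r : Tm Γ Ty.nat)

theorem eval_qLe : (qLe q r).eval M e ↔ qval (q.eval M e) ≤ qval (r.eval M e) := by
  simp only [qLe, qLhs, qPos, qNeg, qDen, Fml.eval_leF, Tm.eval_add, Tm.eval_mul, Tm.eval_fst,
    Tm.eval_snd, Tm.eval_succ, qval]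
  rw [div_le_div_iff₀ (of_add_one_pos _) (of_add_one_pos _), ← of_le]
  simp only [map_add, map_mul, map_one]
  constructor <;> intro h <;> linarith

theorem eval_qLtTest :
    (qLtTest q r).eval M e = 0 ↔ qval (q.eval M e) < qval (r.eval M e) := by
  simp only [qLtTest, qLhs, qPos, qNeg, qDen, Tm.eval_add, Tm.eval_mul, Tm.eval_fst,
    Tm.eval_snd, Tm.eval_succ, Tm.eval_sub, qval]
  rw [div_lt_div_iff₀ (of_add_one_pos _) (of_add_one_pos _), ← le_def, add_one_le_iff, ← of_lt]
  simp only [map_add, map_mul, map_one]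
  constructor <;> intro h <;> linarith

theorem qval_qCode : qval ((qCode a b c).eval M e) =
    (of (a.eval M e) - of (b.eval M e)) / (of (c.eval M e) + 1) := by
  simp [qCode, qval]

theorem prd_add_one_of_pos {n : M.N} (h : 0 < n) : prd n + 1 = n := by
  rcases eq_zero_or_exists_add_one n with rfl | ⟨m, rfl⟩
  · exact (lt_irrefl _ h).elim
  · rw [prd_add_one]

theorem qval_qAdd :
    qval ((qAdd q r).eval M e) = qval (q.eval M e) + qval (r.eval M e) := by
  rw [qAdd, qval_qCode, ← map_one of, ← map_add]
  simp only [qPos, qNeg, qDen, Tm.eval_add, Tm.eval_mul, Tm.eval_fst, Tm.eval_pred,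
    Tm.eval_snd, Tm.eval_succ]
  rw [prd_add_one_of_pos (mul_pos (zero_le.trans_lt (lt_add_one _))
    (zero_le.trans_lt (lt_add_one _)))]
  simp only [map_add, map_mul, map_one, qval]
  have h1 := (of_add_one_pos (snd (q.eval M e))).ne'
  have h2 := (of_add_one_pos (snd (r.eval M e))).ne'
  field_simp
  ring

theorem qval_qTwoNeg : qval ((qTwoNeg a).eval M e) = tp (a.eval M e) := by
  rw [qTwoNeg, qval_qCode, ← map_one of, ← map_add]
  simp only [Tm.eval_pred, Tm.eval_pow2, Tm.eval_succ, Tm.eval_zero]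
  rw [prd_add_one_of_pos (pow2_pos _)]
  simp [tp]

theorem qval_qInv (h : 0 < a.eval M e) : qval ((qInv a).eval M e) = (of (a.eval M e))⁻¹ := by
  rw [qInv, qval_qCode, ← map_one of, ← map_add]
  simp only [Tm.eval_pred, Tm.eval_succ, Tm.eval_zero]
  rw [prd_add_one_of_pos h]
  simp

end

/-- The recursion step of `hatIdx`. -/
def hatStep (x : Tm Γ Ty.one) : Tm (Ty.nat :: Ty.nat :: Γ) Ty.nat :=
  Tm.cond
    (Tm.add (Tm.add (Tm.sub v1 v0) (Tm.sub v0 v1))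
      (Tm.add
        (qLtTest (x.wk.wk ⬝ₜ v0) (qAdd (x.wk.wk ⬝ₜ Tm.succ v0) (qTwoNeg (Tm.succ v0))))
        (qLtTest (x.wk.wk ⬝ₜ Tm.succ v0) (qAdd (x.wk.wk ⬝ₜ v0) (qTwoNeg (Tm.succ v0))))))
    (Tm.succ v0) v1

namespace Struc

open Frac

def hat (x : M.carrier Ty.one) (n : M.N) : M.N := Tm.recVal (x ∷ M.nil) Tm.zero (hatStep v0) n

/-- The value of the `n`-th rational approximation of `x`. -/
noncomputable def rv (x : M.carrier Ty.one) (n : M.N) : M.Q := qval (x ⬝ₘ hat x n)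

end Struc

section

open Struc Frac

variable (e : M.Env Γ)

theorem eval_qAdd_congr {Δ : Ctx} {e : M.Env Γ} {e' : M.Env Δ} {q r : Tm Γ Ty.nat}
    {q' r' : Tm Δ Ty.nat} (hq : q.eval M e = q'.eval M e') (hr : r.eval M e = r'.eval M e') :
    (qAdd q r).eval M e = (qAdd q' r').eval M e' := by
  simp [qAdd, qCode, qPos, qNeg, qDen, hq, hr]

theorem eval_qLtTest_congr {Δ : Ctx} {e : M.Env Γ} {e' : M.Env Δ} {q r : Tm Γ Ty.nat}
    {q' r' : Tm Δ Ty.nat} (hq : q.eval M e = q'.eval M e') (hr : r.eval M e = r'.eval M e') :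
    (qLtTest q r).eval M e = (qLtTest q' r').eval M e' := by
  simp [qLtTest, qLhs, qPos, qNeg, qDen, hq, hr]

theorem eval_qTwoNeg_congr {Δ : Ctx} {e : M.Env Γ} {e' : M.Env Δ} {q : Tm Γ Ty.nat}
    {q' : Tm Δ Ty.nat} (hq : q.eval M e = q'.eval M e') :
    (qTwoNeg q).eval M e = (qTwoNeg q').eval M e' := by
  simp [qTwoNeg, qCode, hq]

theorem Tm.eval_hatIdx (x : Tm Γ Ty.one) (n : Tm Γ Ty.nat) :
    (hatIdx x n).eval M e = hat (x.eval M e) (n.eval M e) := by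
  rw [hatIdx, Tm.eval_primRec, hat, Tm.recVal]
  refine congrArg (recN _ _) (app_ext fun p => app_ext fun i => ?_)
  simp only [Tm.eval_lam, hatStep, Tm.eval_cond, Tm.eval_add]
  rw [eval_qLtTest_congr (Γ := Ty.nat :: Ty.nat :: Γ) (e' := i ∷ p ∷ x.eval M e ∷ M.nil)
      (q' := (v0 : Tm [Ty.one] Ty.one).wk.wk ⬝ₜ v0) (by simp)
      (eval_qAdd_congr (q' := (v0 : Tm [Ty.one] Ty.one).wk.wk ⬝ₜ Tm.succ v0) (by simp)
        (eval_qTwoNeg_congr (q' := Tm.succ v0) (by simp))),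
    eval_qLtTest_congr (Γ := Ty.nat :: Ty.nat :: Γ) (e' := i ∷ p ∷ x.eval M e ∷ M.nil)
      (q' := (v0 : Tm [Ty.one] Ty.one).wk.wk ⬝ₜ Tm.succ v0) (by simp)
      (eval_qAdd_congr (q' := (v0 : Tm [Ty.one] Ty.one).wk.wk ⬝ₜ v0) (by simp)
        (eval_qTwoNeg_congr (q' := Tm.succ v0) (by simp)))]
  simp

theorem qval_apx (x : Tm Γ Ty.one) (n : Tm Γ Ty.nat) :
    qval ((apx x n).eval M e) = rv (x.eval M e) (n.eval M e) := by
  rw [apx, Tm.eval_app, Tm.eval_hatIdx]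
  rfl

end

namespace Struc

open Frac

theorem hat_zero (x : M.carrier Ty.one) : hat x 0 = 0 := Tm.recVal_zero _ _ _

open Classical in
theorem hat_add_one (x : M.carrier Ty.one) (n : M.N) :
    hat x (n + 1) = if hat x n = n ∧ |qval (x ⬝ₘ n) - qval (x ⬝ₘ (n + 1))| < tp (n + 1) then n + 1
      else hat x n := by
  refine (Tm.recVal_add_one _ _ _ n).trans ?_
  rw [hatStep, Tm.eval_cond, ← hatStep, ← hat]
  simp only [Tm.eval_add, add_eq_zero, eval_qLtTest, qval_qAdd, qval_qTwoNeg, Tm.eval_sub,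
    ← le_def, Tm.eval_app, Tm.eval_wk, Tm.eval_succ, Tm.eval_var, cons_z, cons_s]
  refine if_congr ?_ rfl rfl
  rw [← le_antisymm_iff, abs_lt]
  refine and_congr Iff.rfl ⟨fun h => ⟨?_, ?_⟩, fun h => ⟨?_, ?_⟩⟩ <;> linarith [h.1, h.2]

/-- The hat function freezes the sequence before the first step that is too large, so this holds for
every object of type 1. -/
theorem abs_rv_sub_add_one_lt (x : M.carrier Ty.one) (n : M.N) :
    |rv x n - rv x (n + 1)| < tp (n + 1) := by
  rw [rv, rv, hat_add_one]
  split_ifs with h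
  · rw [h.1]
    exact h.2
  · rw [sub_self, abs_zero]
    exact tp_pos _

theorem abs_rv_sub_le {n m : M.N} (x : M.carrier Ty.one) (h : n ≤ m) :
    |rv x n - rv x m| ≤ tp n := by
  obtain ⟨c, rfl⟩ := le_iff_exists_add'.1 h
  -- The induction is on the telescoping bound 2^{-n} - 2^{-(n+c)}, with its negative terms moved
  -- across the inequalities.
  have := ind (A := qLe (qAdd (apx v2 v1) (qTwoNeg (Tm.add v1 v0)))
      (qAdd (apx v2 (Tm.add v1 v0)) (qTwoNeg v1)) ∧ᶠ
    qLe (qAdd (apx v2 (Tm.add v1 v0)) (qTwoNeg (Tm.add v1 v0))) (qAdd (apx v2 v1) (qTwoNeg v1)))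
    (by simp [qLe]) (n ∷ x ∷ M.nil)
  simp only [Fml.eval_and, eval_qLe, qval_qAdd, qval_apx, qval_qTwoNeg, Tm.eval_add,
    Tm.eval_var, cons_z, cons_s] at this
  have h1 := this (by simp) (fun m h => ?_) c
  · have := tp_pos (n + c)
    rw [abs_le]
    constructor <;> linarith [h1.1, h1.2]
  · have h2 := abs_lt.1 (abs_rv_sub_add_one_lt x (n + m))
    rw [← add_assoc]
    rw [tp_add_one] at *
    constructor <;> linarith [h.1, h.2, h2.1, h2.2]

theorem hat_eq {x : M.carrier Ty.one}
    (h : ∀ n, |qval (x ⬝ₘ n) - qval (x ⬝ₘ (n + 1))| < tp (n + 1)) (n : M.N) : hat x n = n := by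
  have := ind (A := Fml.eq (hatIdx v1 v0) v0) (by simp) (x ∷ M.nil)
  simp only [Fml.eval_eq, Tm.eval_hatIdx, Tm.eval_var, cons_z, cons_s] at this
  exact this (hat_zero x) (fun n hn => by rw [hat_add_one, if_pos ⟨hn, h n⟩]) n

end Struc

section

open Struc Frac

variable (e : M.Env Γ)

theorem rv_realOf (q : Tm Γ Ty.nat) (n : M.N) :
    rv ((realOf q).eval M e) n = qval (q.eval M e) := by
  rw [rv, realOf, Tm.eval_lam, Tm.eval_wk]

theorem rv_realZero (n : M.N) : rv ((realZero : Tm Γ Ty.one).eval M e) n = 0 := by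
  rw [realZero, rv_realOf, qval_qCode]
  simp

theorem rv_realAdd (x y : Tm Γ Ty.one) (n : M.N) :
    rv ((realAdd x y).eval M e) n = rv (x.eval M e) (n + 1) + rv (y.eval M e) (n + 1) := by
  have h : ∀ n, qval ((realAdd x y).eval M e ⬝ₘ n) =
      rv (x.eval M e) (n + 1) + rv (y.eval M e) (n + 1) := by
    intro n
    rw [realAdd, Tm.eval_lam, qval_qAdd, qval_apx, qval_apx]
    simp
  -- The index shift in the sum makes it converge fast enough by itself, so the hat function leaves
  -- it unchanged.
  rw [rv, hat_eq, h]
  intro n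
  rw [h, h]
  have h1 := abs_lt.1 (abs_rv_sub_add_one_lt (x.eval M e) (n + 1))
  have h2 := abs_lt.1 (abs_rv_sub_add_one_lt (y.eval M e) (n + 1))
  rw [tp_add_one (n + 1)] at h1 h2
  rw [abs_lt]
  constructor <;> linarith [h1.1, h1.2, h2.1, h2.2]

theorem eval_realLe (x y : Tm Γ Ty.one) :
    (realLe x y).eval M e ↔ ∀ n : M.N, rv (x.eval M e) (n + 1) ≤ rv (y.eval M e) (n + 1) + tp n := by
  simp only [realLe, Fml.eval_all, eval_qLe, qval_qAdd, qval_apx, qval_qTwoNeg, Tm.eval_wk,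
    Tm.eval_succ, Tm.eval_var, cons_z]

theorem eval_realApprox (x y : Tm Γ Ty.one) :
    (realApprox x y).eval M e ↔ ∀ n : M.N, M.st n →
      |rv (x.eval M e) (n + 1) - rv (y.eval M e) (n + 1)| ≤ tp n := by
  simp only [realApprox, Fml.eval_allSt, Fml.eval_and, eval_qLe, qval_qAdd, qval_apx,
    qval_qTwoNeg, Tm.eval_wk, Tm.eval_succ, Tm.eval_var, cons_z, abs_le]
  refine forall_congr' fun n => forall_congr' fun _ => ?_
  constructor <;> intro h <;> constructor <;> linarith [h.1, h.2]

end

end Reals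

/-! Standardness, choice and idealisation in extensional models. -/

section Standard

variable {M : Struc} {Γ : Ctx}

namespace Struc

/-- All entries of the environment are standard. -/
def StdEnv (e : M.Env Γ) : Prop := ∀ σ (x : Var Γ σ), M.st (e σ x)

theorem stdEnv_nil : StdEnv M.nil := fun _ x => nomatch x

theorem StdEnv.cons {σ : Ty} {a : M.carrier σ} {e : M.Env Γ} (ha : M.st a) (he : StdEnv e) :
    StdEnv (a ∷ e) := fun τ x => by
  cases x with
  | z => exact ha
  | s x => exact he τ x

end Struc

open Struc

theorem Fml.eval_under2 {a b c : Ty} (A : Fml (a :: b :: Γ)) (x : M.carrier a) (y : M.carrier b)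
    (z : M.carrier c) (e : M.Env Γ) :
    (A.ren Ren.under2).eval M (x ∷ y ∷ z ∷ e) ↔ A.eval M (x ∷ y ∷ e) := by
  rw [Fml.eval_ren]
  apply iff_of_eq
  congr 1
  funext σ v
  rcases v with _ | _ | v <;> rfl

theorem Fml.QF.internal {A : Fml Γ} (h : A.QF) : A.Internal := by
  induction A with
  | bot => trivial
  | eq a b => trivial
  | st a => exact h.elim
  | imp A B hA hB => exact ⟨hA h.1, hB h.2⟩
  | all σ A hA => exact h.elim

variable [hM : M.Extensional]

namespace Struc

theorem st_con {σ : Ty} (c : Con σ) : M.st (M.con c) := holds (P0.st_con (Γ := []) c) M.nil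

theorem st_app {σ τ : Ty} {f : M.carrier (σ ⇒ τ)} {a : M.carrier σ} (hf : M.st f) (ha : M.st a) :
    M.st (f ⬝ₘ a) :=
  holds (P0.st_app (Γ := [σ ⇒ τ, σ]) v0 v1) (f ∷ a ∷ M.nil) hf ha

theorem StdEnv.st_eval {e : M.Env Γ} (he : StdEnv e) {σ : Ty} (t : Tm Γ σ) : M.st (t.eval M e) := by
  induction t with
  | var x => exact he _ x
  | con c => exact st_con c
  | app f a hf ha => exact st_app hf ha

theorem st_zero : M.st (0 : M.N) := st_con _

theorem st_add_one {n : M.N} (h : M.st n) : M.st (n + 1) := by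
  rw [← suc_eq]
  exact st_app (st_con _) h

theorem st_natCast (n : ℕ) : M.st (n : M.N) := by
  induction n with
  | zero => rw [Nat.cast_zero]; exact st_zero
  | succ n ih => rw [Nat.cast_succ]; exact st_add_one ih

theorem st_add {a b : M.N} (ha : M.st a) (hb : M.st b) : M.st (a + b) := by
  simpa using ((stdEnv_nil.cons hb).cons ha).st_eval (Tm.add v0 v1)

theorem st_pow2 {a : M.N} (ha : M.st a) : M.st (pow2 a) :=
  (stdEnv_nil.cons ha).st_eval (Tm.pow2 v0)

@[simp] theorem len_mkSeq {σ : Ty} (n : M.N) (f : M.carrier (Ty.nat ⇒ σ)) :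
    len (mkSeq n f) = n := by
  simpa using holds (P0.epra (EPRA.len_mk (Γ := [_, _]) v0 v1)) (n ∷ f ∷ M.nil)

theorem proj_mkSeq {σ : Ty} {n i : M.N} (f : M.carrier (Ty.nat ⇒ σ)) (h : i < n) :
    proj (mkSeq n f) i = f ⬝ₘ i := by
  have := holds (P0.epra (EPRA.proj_mk (Γ := [_, _, _]) v0 v1 v2)) (n ∷ i ∷ f ∷ M.nil)
  simp only [Fml.eval_imp, Fml.eval_ltF_iff, Fml.eval_eqF_iff] at this
  exact this h

end Struc

open Struc

theorem Fml.eval_memF (e : M.Env Γ) {σ : Ty} (x : Tm Γ σ) (s : Tm Γ σ.seq) :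
    (memF x s).eval M e ↔ ∃ i < len (s.eval M e), proj (s.eval M e) i = x.eval M e := by
  simp [memF]

theorem Struc.herbrand_choice {ρ τ : Ty} {A : Fml (τ :: ρ :: Γ)} (hA : A.Internal) {e : M.Env Γ}
    (h : ∀ x, M.st x → ∃ y, M.st y ∧ A.eval M (y ∷ x ∷ e)) :
    ∃ F : M.carrier (ρ ⇒ τ.seq), M.st F ∧
      ∀ x, M.st x → ∃ i < len (F ⬝ₘ x), A.eval M (proj (F ⬝ₘ x) i ∷ x ∷ e) := by
  have := holds (P0.hac A hA) e
  simp only [Fml.eval_imp, Fml.eval_allSt, Fml.eval_exSt, Fml.eval_ex, Fml.eval_and, Fml.eval_memF,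
    Fml.eval_under2, Tm.eval_app, Tm.eval_var, cons_z, cons_s] at this
  obtain ⟨F, hF, h'⟩ := this h
  refine ⟨F, hF, fun x hx => ?_⟩
  obtain ⟨y, ⟨i, hi, rfl⟩, hy⟩ := h' x hx
  exact ⟨i, hi, hy⟩

/-- The contrapositive of the idealisation axiom for the negated formula, in the form of a
compactness principle: standard witnesses for all `y` can be taken from one standard finite
sequence. -/
theorem Struc.idealisation {σ τ : Ty} {A : Fml (σ :: τ :: Γ)} (hA : A.Internal) {e : M.Env Γ}
    (h : ∀ y, ∃ x, M.st x ∧ A.eval M (x ∷ y ∷ e)) :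
    ∃ w : M.carrier σ.seq, M.st w ∧ ∀ y, ∃ i < len w, A.eval M (proj w i ∷ y ∷ e) := by
  have := holds (P0.ideal A.not ⟨hA, trivial⟩) e
  simp only [Fml.eval_imp, Fml.eval_allSt, Fml.eval_ex, Fml.eval_all, Fml.eval_memF, Fml.eval_not,
    Fml.eval_under2, Tm.eval_var, cons_z, cons_s] at this
  by_contra hw
  push Not at hw
  obtain ⟨y, hy⟩ := this fun w hw' => by
    obtain ⟨y, hy⟩ := hw w hw'
    refine ⟨y, ?_⟩
    rintro _ ⟨i, hi, rfl⟩
    exact hy i hi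
  obtain ⟨x, hx, hxy⟩ := h y
  exact hy x hx hxy

/-- `n` exceeds all standard numbers. -/
def Struc.Infinite (m : M.N) : Prop := ∀ n, M.st n → n ≤ m

theorem Struc.exists_infinite : ∃ m : M.N, Struc.Infinite m := by
  by_contra h
  simp only [Struc.Infinite] at h
  push Not at h
  obtain ⟨w, -, hw⟩ := Struc.idealisation (M := M) (A := (leF v0 v1 : Fml [Ty.nat, Ty.nat]).not) (e := M.nil)
    (Fml.QF.internal ⟨trivial, trivial⟩) (fun y => by simpa using h y)
  -- The sum of all entries of `w` bounds each of them, so it is exceeded by none.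
  obtain ⟨i, hi, h'⟩ := hw (sum (M.con (Con.proj Ty.nat) ⬝ₘ w) (len w))
  simp only [Fml.eval_not, Fml.eval_leF, Tm.eval_var, cons_z, cons_s] at h'
  exact h' (le_sum hi)

/-- If a quantifier-free formula holds for all standard positive numbers, then below each
infinite number it holds for some infinite number. -/
theorem Struc.overspill {A : Fml (Ty.nat :: Γ)} (hA : A.QF) {e : M.Env Γ}
    (h : ∀ k, M.st k → 0 < k → A.eval M (k ∷ e)) {m : M.N} (hm : Infinite m) :
    ∃ k ≤ m, Infinite k ∧ A.eval M (k ∷ e) := by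
  let f := A.chi.lam.eval M e
  have hf : ∀ k, f ⬝ₘ k = 0 ↔ A.eval M (k ∷ e) := fun k => by
    rw [Tm.eval_lam, Fml.eval_chi hA]
  -- The search runs downwards from `m` and finds the largest k ≤ m with the property. Every
  -- standard positive number has the property, hence is at most this k.
  let r := (Tm.lam (v1 ⬝ₜ Tm.sub v2 v0) : Tm [Ty.one, Ty.nat] Ty.one).eval M (f ∷ m ∷ M.nil)
  have hr : ∀ j, r ⬝ₘ j = f ⬝ₘ (m - j) := fun j => by simp [r]
  have hle : ∀ n, M.st n → 0 < n → mu r (m + 1) ≤ m - n := fun n hn h0 => by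
    refine mu_le_of ?_
    rw [hr, hf, tsub_tsub_cancel_of_le (hm n hn)]
    exact h n hn h0
  have h1 := hle 1 (by simpa using st_add_one (M := M) st_zero) zero_lt_one
  refine ⟨m - mu r (m + 1), tsub_le_self, fun n hn => ?_, ?_⟩
  · rcases eq_or_lt_of_le (zero_le (a := n)) with rfl | h0
    · exact zero_le
    · exact (le_tsub_iff_le_tsub ((hle n hn h0).trans tsub_le_self) (hm n hn)).1 (hle n hn h0)
  · rw [← hf, ← hr]
    exact app_mu (lt_add_one_iff.2 (h1.trans tsub_le_self))

end Standard

/-! Flattening of sequences of sequences. -/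

section Flat

variable {M : Struc} [hM : M.Extensional] {Γ : Ctx} {ρ : Ty}

open Struc

@[simp] theorem Fml.qf_inSet (X : Tm Γ (ρ ⇒ Ty.nat)) (x : Tm Γ ρ) : (inSet X x).QF := trivial

@[simp] theorem Fml.eval_inSet (e : M.Env Γ) (X : Tm Γ (ρ ⇒ Ty.nat)) (x : Tm Γ ρ) :
    (inSet X x).eval M e ↔ X.eval M e ⬝ₘ x.eval M e = 1 := by
  simp [inSet]

/-- The entry of `W` with the index `n`, coding a pair. -/
def Tm.entry (W : Tm Γ ρ.seq.seq) (n : Tm Γ Ty.nat) : Tm Γ ρ := (W.proj n.fst).proj n.snd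

/-- A strict bound for the indices of the entries of `W`. -/
def Tm.entryBound (W : Tm Γ ρ.seq.seq) : Tm Γ Ty.nat :=
  Tm.tri (Tm.add W.len (Tm.sum (Tm.lam (W.wk.proj v0).len) W.len))

/-- The least index of an entry of `W` in `X`. -/
def Tm.firstEntry (X : Tm Γ (ρ ⇒ Ty.nat)) (W : Tm Γ ρ.seq.seq) : Tm Γ Ty.nat :=
  (inSet X.wk (W.wk.entry v0)).least W.entryBound

/-- A sequence of all entries of `W` that are in `X`. -/
def Tm.flat (X : Tm Γ (ρ ⇒ Ty.nat)) (W : Tm Γ ρ.seq.seq) : Tm Γ ρ.seq :=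
  Tm.mk (Tm.cond (Tm.sub (Tm.succ (Tm.firstEntry X W)) W.entryBound) W.entryBound Tm.zero)
    (Tm.lam (W.wk.entry
      (Tm.cond (inSet X.wk (W.wk.entry v0)).chi v0 (Tm.firstEntry X W).wk)))

variable (e : M.Env Γ) (X : Tm Γ (ρ ⇒ Ty.nat)) (W : Tm Γ ρ.seq.seq)

@[simp] theorem Tm.eval_entry (n : Tm Γ Ty.nat) : (W.entry n).eval M e =
    Struc.proj (Struc.proj (W.eval M e) (Struc.fst (n.eval M e))) (Struc.snd (n.eval M e)) := by
  simp [Tm.entry]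

theorem pair_lt_entryBound {i j : M.N} (hi : i < len (W.eval M e))
    (hj : j < len (proj (W.eval M e) i)) : pair i j < W.entryBound.eval M e := by
  simp only [Tm.entryBound, Tm.eval_tri, Tm.eval_add, Tm.eval_len, Tm.eval_sum]
  refine pair_lt (add_lt_add hi (hj.trans_le ?_))
  refine le_trans (le_of_eq ?_) (le_sum hi)
  simp

open Classical in
theorem len_flat : len ((Tm.flat X W).eval M e) =
    if (Tm.firstEntry X W).eval M e < W.entryBound.eval M e then W.entryBound.eval M e else 0 := by
  simp only [Tm.flat, Tm.eval_mk, len_mkSeq, Tm.eval_cond, Tm.eval_sub, Tm.eval_succ,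
    ← le_def, add_one_le_iff, Tm.eval_zero]

open Classical in
theorem proj_flat {n : M.N} (h : n < len ((Tm.flat X W).eval M e)) :
    proj ((Tm.flat X W).eval M e) n = (W.wk.entry v0).eval M
      ((if X.eval M e ⬝ₘ (W.wk.entry v0).eval M (n ∷ e) = 1 then n
        else (Tm.firstEntry X W).eval M e) ∷ e) := by
  simp only [Tm.flat, Tm.eval_mk, len_mkSeq] at h ⊢
  rw [proj_mkSeq _ h, Tm.eval_lam, Tm.eval_entry, Tm.eval_entry, Tm.eval_cond,
    Tm.eval_wk, Tm.eval_wk, Tm.eval_wk]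
  simp only [Fml.eval_chi (Fml.qf_inSet _ _), Fml.eval_inSet, Tm.eval_wk, Tm.eval_var, cons_z]

/-- Recursion of type 0 cannot concatenate sequences, so `Tm.flat` is indexed by codes of pairs up
to a bound. An index whose object is not in `X` is redirected to the first index below the bound
whose object is in `X`; if there is none, the length is set to 0. -/
theorem flat_mem {n : M.N} (h : n < len ((Tm.flat X W).eval M e)) :
    X.eval M e ⬝ₘ proj ((Tm.flat X W).eval M e) n = 1 := by
  rw [proj_flat _ _ _ h]
  split_ifs with h1
  · exact h1
  · rw [len_flat] at h
    split_ifs at h with h2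
    · have := Fml.eval_least_of_lt (Fml.qf_inSet _ _) h2
      rwa [Fml.eval_inSet, Tm.eval_wk] at this
    · exact (not_lt.2 zero_le h).elim

theorem exists_flat {i j : M.N} (hi : i < len (W.eval M e))
    (hj : j < len (proj (W.eval M e) i)) (h : X.eval M e ⬝ₘ proj (proj (W.eval M e) i) j = 1) :
    ∃ n < len ((Tm.flat X W).eval M e),
      proj ((Tm.flat X W).eval M e) n = proj (proj (W.eval M e) i) j := by
  have h1 := pair_lt_entryBound e W hi hj
  have h2 : (Tm.firstEntry X W).eval M e < W.entryBound.eval M e :=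
    (Fml.eval_least_lt_iff (Fml.qf_inSet _ _)).2 ⟨_, h1, by simpa using h⟩
  have h3 : pair i j < len ((Tm.flat X W).eval M e) := by rwa [len_flat, if_pos h2]
  refine ⟨_, h3, ?_⟩
  rw [proj_flat _ _ _ h3, if_pos (by simpa using h)]
  simp

end Flat

/-- Denominators are at least 1 and the subtracted part is nonnegative, so the positive part of the
numerator is a bound. -/
theorem Frac.exists_le_of {α : Type} [CommSemiring α] [LinearOrder α] [IsStrictOrderedRing α]
    [CanonicallyOrderedAdd α] (h : ∀ a : α, 0 < a → 1 ≤ a) (x : Frac α) :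
    ∃ n, x ≤ of n := by
  induction x using ind with | _ x
  refine ⟨x.pos, ?_⟩
  change mk _ ≤ mk _
  rw [mk_le]
  simp only [mul_one, zero_mul, add_zero]
  exact (le_mul_of_one_le_right zero_le (h _ x.den_pos)).trans le_self_add

/-! Rational bounds of real numbers. -/

section Bounds

variable {M : Struc} [hM : M.Extensional] {Γ : Ctx} {ρ : Ty}

namespace Struc

open Frac

theorem of_pos {k : M.N} (hk : 0 < k) : 0 < of k := by rwa [← map_zero of, of_lt]

theorem exists_tp_le {ε : M.Q} (h : 0 < ε) : ∃ n : M.N, tp n ≤ ε := by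
  obtain ⟨n, hn⟩ := exists_le_of (fun a ha => by simpa using add_one_le_iff.2 ha) ε⁻¹
  have h0 : 0 < n := of_lt.1 (by rw [map_zero]; exact (inv_pos.2 h).trans_le hn)
  exact ⟨n, (tp_le_inv h0).trans (inv_le_of_inv_le₀ h hn)⟩

/-- Here `n` ranges over all numbers of the model, infinite ones included, and `M.Q` has no positive
element below all the powers `tp n`. -/
theorem le_of_forall_tp {a b : M.Q} (m : M.N) (h : ∀ n, m ≤ n → a ≤ b + 4 * tp n) : a ≤ b := by
  by_contra hab
  obtain ⟨n, hn⟩ := exists_tp_le (ε := (a - b) / 8) (by linarith)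
  have h1 := h (max m n) (le_max_left _ _)
  have h2 := tp_mono (le_max_right m n)
  linarith

/-- The rational number `q` is an upper bound of the real number `x`. -/
def Below (x : M.carrier Ty.one) (q : M.Q) : Prop := ∀ n, rv x n ≤ q + tp n

variable {x : M.carrier Ty.one} {p q : M.Q}

theorem below_of (h : ∀ n, rv x (n + 1) ≤ q + 2 * tp n) : Below x q := by
  intro n
  refine le_of_forall_tp n fun m hm => ?_
  have h1 := abs_le.1 (abs_rv_sub_le x (hm.trans (lt_add_one m).le))
  have := h m
  have := tp_pos m
  linarith [h1.2]

theorem below_rv (x : M.carrier Ty.one) (n : M.N) : Below x (rv x n + tp n) := by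
  refine below_of fun m => ?_
  rcases le_total n (m + 1) with h | h
  · have h1 := abs_le.1 (abs_rv_sub_le x h)
    have := tp_pos m
    linarith [h1.1]
  · have h1 := abs_le.1 (abs_rv_sub_le x h)
    have := tp_pos n
    have := tp_pos m
    rw [tp_add_one] at h1
    linarith [h1.2]

theorem Below.mono (h : Below x p) (hpq : p ≤ q) : Below x q := fun n => by linarith [h n]

end Struc

end Bounds

/-! Metric spaces. -/

section Metric

variable {M : Struc} [hM : M.Extensional] {Γ : Ctx} {ρ : Ty}

open Struc Frac

/-- `q` is an upper bound of the distance of `x` and `y`. -/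
def Struc.DistLe (d : M.carrier (ρ ⇒ ρ ⇒ Ty.one)) (x y : M.carrier ρ) (q : M.Q) : Prop :=
  Below (d ⬝ₘ x ⬝ₘ y) q

/-- The laws of a pseudometric. -/
structure Struc.Metric (X : M.carrier (ρ ⇒ Ty.nat)) (d : M.carrier (ρ ⇒ ρ ⇒ Ty.one)) : Prop where
  self : ∀ x, X ⬝ₘ x = 1 → ∀ n, |rv (d ⬝ₘ x ⬝ₘ x) (n + 1)| ≤ tp n
  symm : ∀ x, X ⬝ₘ x = 1 → ∀ y, X ⬝ₘ y = 1 → ∀ q, DistLe d x y q → DistLe d y x q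
  triangle : ∀ x, X ⬝ₘ x = 1 → ∀ y, X ⬝ₘ y = 1 → ∀ z, X ⬝ₘ z = 1 → ∀ p q,
    DistLe d x y p → DistLe d y z q → DistLe d x z (p + q)

theorem eval_isMetric (e : M.Env Γ) (X : Tm Γ (ρ ⇒ Ty.nat)) (d : Tm Γ (ρ ⇒ ρ ⇒ Ty.one))
    (h : (isMetric X d).eval M e) : Metric (X.eval M e) (d.eval M e) := by
  simp only [isMetric, allIn, realEq, Fml.eval_and, Fml.eval_all, Fml.eval_imp, Fml.eval_inSet,
    eval_realLe, rv_realZero, rv_realAdd, Tm.eval_app, Tm.eval_wk, Tm.eval_var, cons_z,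
    cons_s] at h
  obtain ⟨h1, h2, h3⟩ := h
  refine ⟨fun x hx n => ?_, fun x hx y hy q hq => ?_, fun x hx y hy z hz p q hp hq => ?_⟩
  · have := h1 x hx
    rw [abs_le]
    constructor <;> linarith [this.1 n, this.2 n]
  · refine below_of fun n => ?_
    have h4 := (h2 x hx y hy).2 n
    have h5 := hq (n + 1)
    have := tp_pos n
    rw [tp_add_one] at h5
    linarith
  · refine below_of fun n => ?_
    have h4 := h3 x hx y hy z hz n
    have h5 := hp (n + 1 + 1)
    have h6 := hq (n + 1 + 1)
    have := tp_pos n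
    rw [tp_add_one, tp_add_one] at h5 h6
    linarith

/-- `x` and `y` are infinitesimally close. -/
def Struc.Near (d : M.carrier (ρ ⇒ ρ ⇒ Ty.one)) (x y : M.carrier ρ) : Prop :=
  ∀ n, M.st n → DistLe d x y (tp n)

variable {X : M.carrier (ρ ⇒ Ty.nat)} {d : M.carrier (ρ ⇒ ρ ⇒ Ty.one)} {x y z : M.carrier ρ}

namespace Struc.Metric

/-- By symmetry and the triangle inequality, `q + q` bounds d(x,x), which is zero. -/
theorem nonneg (hd : Metric X d) (hx : X ⬝ₘ x = 1) (hy : X ⬝ₘ y = 1) {q : M.Q}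
    (h : DistLe d x y q) : 0 ≤ q := by
  have h1 := hd.triangle x hx y hy x hx q q h (hd.symm x hx y hy q h)
  have : 0 ≤ q + q := by
    refine le_of_forall_tp 0 fun n _ => ?_
    have h2 := abs_le.1 (hd.self x hx n)
    have h3 := h1 (n + 1)
    have := tp_pos n
    rw [tp_add_one] at h3
    linarith [h2.1]
  linarith

/-- The formula bounds approximations on both sides, `Near` only from above; nonnegativity of the
metric supplies the lower bound. -/
theorem eval_near_iff (hd : Metric X d) (hx : X ⬝ₘ x = 1) (hy : X ⬝ₘ y = 1) (e : M.Env Γ)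
    {d' : Tm Γ (ρ ⇒ ρ ⇒ Ty.one)} {x' y' : Tm Γ ρ} (h1 : d'.eval M e = d) (h2 : x'.eval M e = x)
    (h3 : y'.eval M e = y) : (near d' x' y').eval M e ↔ Near d x y := by
  simp only [near, eval_realApprox, rv_realZero, Tm.eval_app, h1, h2, h3, sub_zero]
  constructor
  · intro h n hn
    refine (below_rv (d ⬝ₘ x ⬝ₘ y) (n + 1 + 1)).mono ?_
    have h4 := (abs_le.1 (h (n + 1) (st_add_one hn))).2
    have := tp_pos n
    rw [tp_add_one (n + 1)]
    rw [tp_add_one n] at h4 ⊢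
    linarith
  · intro h n hn
    have h4 := h (n + 1) (st_add_one hn) (n + 1)
    have h5 := hd.nonneg hx hy (below_rv (d ⬝ₘ x ⬝ₘ y) (n + 1))
    have := tp_pos n
    rw [tp_add_one] at h4 h5
    rw [abs_le]
    constructor <;> linarith

end Struc.Metric

theorem eval_realLe_realOf (e : M.Env Γ) (x : Tm Γ Ty.one) (q : Tm Γ Ty.nat) :
    (realLe x (realOf q)).eval M e ↔ Below (x.eval M e) (qval (q.eval M e)) := by
  simp only [eval_realLe, rv_realOf]
  refine ⟨fun h => below_of fun n => ?_, fun h n => ?_⟩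
  · have := tp_pos n
    linarith [h n]
  · have := tp_pos n
    have h1 := h (n + 1)
    rw [tp_add_one] at h1
    linarith

theorem eval_isNet (e : M.Env Γ) (X : Tm Γ (ρ ⇒ Ty.nat)) (d : Tm Γ (ρ ⇒ ρ ⇒ Ty.one))
    (s : Tm Γ ρ.seq) (k : Tm Γ Ty.nat) (hk : 0 < k.eval M e) :
    (isNet X d s k).eval M e ↔ ∀ x, X.eval M e ⬝ₘ x = 1 → ∃ i < Struc.len (s.eval M e),
      X.eval M e ⬝ₘ Struc.proj (s.eval M e) i = 1 ∧
        DistLe (d.eval M e) x (Struc.proj (s.eval M e) i) (of (k.eval M e))⁻¹ := by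
  simp only [isNet, allIn, Fml.eval_and, Fml.eval_all, Fml.eval_imp, Fml.eval_inSet, Fml.eval_ex,
    Fml.eval_ltF_iff, eval_realLe_realOf, Tm.eval_app, Tm.eval_wk, Tm.eval_var, cons_z,
    cons_s, Tm.eval_len, Tm.eval_proj]
  refine forall_congr' fun x => forall_congr' fun hx => exists_congr fun i => and_congr_right
    fun _ => and_congr_right fun _ => ?_
  rw [qval_qInv _ _ (by simpa using hk), Tm.eval_wk, Tm.eval_wk]
  rfl

theorem Struc.Metric.eval_isInfNet (e : M.Env Γ) (X : Tm Γ (ρ ⇒ Ty.nat))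
    (d : Tm Γ (ρ ⇒ ρ ⇒ Ty.one)) (hd : Metric (X.eval M e) (d.eval M e)) (s : Tm Γ ρ.seq) :
    (isInfNet X d s).eval M e ↔ ∀ x, X.eval M e ⬝ₘ x = 1 → ∃ i < Struc.len (s.eval M e),
      X.eval M e ⬝ₘ Struc.proj (s.eval M e) i = 1 ∧
        Near (d.eval M e) x (Struc.proj (s.eval M e) i) := by
  simp only [isInfNet, allIn, Fml.eval_and, Fml.eval_all, Fml.eval_imp, Fml.eval_inSet, Fml.eval_ex,
    Fml.eval_ltF_iff, Tm.eval_wk, Tm.eval_var, cons_z, Tm.eval_len, Tm.eval_proj]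
  refine forall_congr' fun x => forall_congr' fun hx => exists_congr fun i => and_congr_right
    fun _ => and_congr_right fun h => ?_
  exact hd.eval_near_iff hx h _ (by simp) (by simp) (by simp)

theorem Struc.Metric.eval_nsCompact (e : M.Env Γ) (X : Tm Γ (ρ ⇒ Ty.nat))
    (d : Tm Γ (ρ ⇒ ρ ⇒ Ty.one)) (hd : Metric (X.eval M e) (d.eval M e)) :
    (nsCompact X d).eval M e ↔ ∀ x, X.eval M e ⬝ₘ x = 1 → ∃ y, M.st y ∧
      X.eval M e ⬝ₘ y = 1 ∧ Near (d.eval M e) x y := by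
  simp only [nsCompact, allIn, Fml.eval_and, Fml.eval_all, Fml.eval_imp, Fml.eval_inSet,
    Fml.eval_exSt, Tm.eval_wk, Tm.eval_var, cons_z]
  refine forall_congr' fun x => forall_congr' fun hx => exists_congr fun i => and_congr_right
    fun _ => and_congr_right fun h => ?_
  exact hd.eval_near_iff hx h _ (by simp) (by simp) (by simp)

/-- All entries of all values of `h` are in `X`. -/
def Struc.ValuesIn (X : M.carrier (ρ ⇒ Ty.nat)) (h : M.carrier (Ty.nat ⇒ ρ.seq)) : Prop :=
  ∀ k, ∀ i < Struc.len (h ⬝ₘ k), X ⬝ₘ Struc.proj (h ⬝ₘ k) i = 1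

@[simp] theorem eval_valuesIn (e : M.Env Γ) (X : Tm Γ (ρ ⇒ Ty.nat)) (h : Tm Γ (Ty.nat ⇒ ρ.seq)) :
    (valuesIn X h).eval M e ↔ ValuesIn (X.eval M e) (h.eval M e) := by
  simp [valuesIn, ValuesIn]

end Metric

/-! ### Internality of the formulas used in choice and idealisation. -/

section Internal

variable {Γ : Ctx}

@[simp] theorem Fml.internal_imp (A B : Fml Γ) : (A →ᶠ B).Internal ↔ A.Internal ∧ B.Internal :=
  Iff.rfl

@[simp] theorem Fml.internal_and (A B : Fml Γ) : (A ∧ᶠ B).Internal ↔ A.Internal ∧ B.Internal :=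
  ⟨fun h => ⟨h.1.1, h.1.2.1⟩, fun h => ⟨⟨h.1, h.2, trivial⟩, trivial⟩⟩

@[simp] theorem Fml.internal_all {σ : Ty} (A : Fml (σ :: Γ)) :
    (Fml.all σ A).Internal ↔ A.Internal := Iff.rfl

@[simp] theorem Fml.internal_ex {σ : Ty} (A : Fml (σ :: Γ)) : (Fml.ex σ A).Internal ↔ A.Internal :=
  ⟨fun h => h.1.1, fun h => ⟨⟨h, trivial⟩, trivial⟩⟩

@[simp] theorem internal_ltF (a b : Tm Γ Ty.nat) : (ltF a b).Internal := trivial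

@[simp] theorem internal_inSet {ρ : Ty} (X : Tm Γ (ρ ⇒ Ty.nat)) (x : Tm Γ ρ) :
    (inSet X x).Internal := trivial

@[simp] theorem internal_realLe (x y : Tm Γ Ty.one) : (realLe x y).Internal := trivial

end Internal

/-! ### Standard search, choice of numbers, and collection of sequences. -/

section Choice

variable {M : Struc} [hM : M.Extensional] {Γ : Ctx} {ρ : Ty} {e : M.Env Γ}

open Struc Frac

/-- Bounded quantifier-free search with standard parameters has standard results. -/
theorem Struc.exists_st_least {A : Fml (Ty.nat :: Γ)} (hA : A.QF) (he : StdEnv e) {n : M.N}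
    (hn : M.st n) (h : ∃ i < n, A.eval M (i ∷ e)) :
    ∃ i, M.st i ∧ i < n ∧ A.eval M (i ∷ e) ∧ ∀ j, A.eval M (j ∷ e) → i ≤ j := by
  let r : Ren (Ty.nat :: Γ) (Ty.nat :: Ty.nat :: Γ) := Ren.wk.lift
  have hr : (A.ren r).QF := by rw [Fml.ren_eq_subst]; exact hA.subst _
  have hev : ∀ i, (A.ren r).eval M (i ∷ n ∷ e) ↔ A.eval M (i ∷ e) := fun i => by
    rw [Fml.eval_ren]
    apply iff_of_eq
    congr 1
    funext σ v
    rcases v with _ | v <;> rfl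
  have hlt : ((A.ren r).least v0).eval M (n ∷ e) < (v0 : Tm (Ty.nat :: Γ) Ty.nat).eval M (n ∷ e) :=
    (Fml.eval_least_lt_iff hr).2 (by simpa only [hev, Tm.eval_var, cons_z] using h)
  refine ⟨_, (he.cons hn).st_eval _, hlt, (hev _).1 (Fml.eval_least_of_lt hr hlt), fun j hj => ?_⟩
  exact Fml.eval_least_le hr ((hev j).2 hj)

/-- Choice of numbers for quantifier-free formulas on the standard numbers. -/
theorem Struc.exists_st_choice {A : Fml (Ty.nat :: Ty.nat :: Γ)} (hA : A.QF) (he : StdEnv e)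
    (h : ∀ k, M.st k → ∃ m, M.st m ∧ A.eval M (m ∷ k ∷ e)) :
    ∃ f : M.carrier Ty.one, M.st f ∧ ∀ k, M.st k → A.eval M (f ⬝ₘ k ∷ k ∷ e) := by
  obtain ⟨F, hF, hF'⟩ := herbrand_choice hA.internal h
  -- The sum of the finitely many candidates in `F k`, plus one, is a strict bound for a witness.
  -- Bounded search then turns Herbrandised choice into a choice of single numbers.
  let n : Tm (Ty.nat :: (Ty.nat ⇒ Ty.nat.seq) :: Γ) Ty.nat :=
    Tm.succ (Tm.sum (Tm.con (Con.proj Ty.nat) ⬝ₜ (v1 ⬝ₜ v0)) (Tm.len (v1 ⬝ₜ v0)))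
  have hr : (A.ren (Ren.under2 (c := Ty.nat ⇒ Ty.nat.seq))).QF := by
    rw [Fml.ren_eq_subst]; exact hA.subst _
  refine ⟨((A.ren Ren.under2).least n).lam.eval M (F ∷ e), (he.cons hF).st_eval _, fun k hk => ?_⟩
  rw [Tm.eval_lam, ← Fml.eval_under2 A _ _ F e]
  refine Fml.eval_least_of_lt hr ((Fml.eval_least_lt_iff hr).2 ?_)
  obtain ⟨i, hi, h'⟩ := hF' k hk
  refine ⟨_, ?_, (Fml.eval_under2 A _ _ F e).2 h'⟩
  simp only [n, Tm.eval_succ, Tm.eval_sum, Tm.eval_app, Tm.eval_con, Tm.eval_len, Tm.eval_var,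
    cons_z, cons_s]
  exact lt_add_one_iff.2 (le_sum hi)

/-- Collection of the entries in `X` of the values of `F`. -/
theorem Struc.exists_flat_fun (X : M.carrier (ρ ⇒ Ty.nat)) (F : M.carrier (Ty.nat ⇒ ρ.seq.seq)) :
    ∃ h : M.carrier (Ty.nat ⇒ ρ.seq), (M.st X → M.st F → M.st h) ∧ ValuesIn X h ∧
      ∀ k, ∀ i < len (F ⬝ₘ k), ∀ j < len (proj (F ⬝ₘ k) i), X ⬝ₘ proj (proj (F ⬝ₘ k) i) j = 1 →
        ∃ n < len (h ⬝ₘ k), proj (h ⬝ₘ k) n = proj (proj (F ⬝ₘ k) i) j := by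
  let t : Tm [Ty.nat, Ty.nat ⇒ ρ.seq.seq, ρ ⇒ Ty.nat] ρ.seq := Tm.flat v2 (v1 ⬝ₜ v0)
  refine ⟨t.lam.eval M (F ∷ X ∷ M.nil),
    fun hX hF => ((stdEnv_nil.cons hX).cons hF).st_eval _, fun k i hi => ?_,
    fun k i hi j hj h => ?_⟩
  · rw [Tm.eval_lam] at hi ⊢
    exact flat_mem (k ∷ F ∷ X ∷ M.nil) v2 _ hi
  · rw [Tm.eval_lam]
    exact exists_flat (k ∷ F ∷ X ∷ M.nil) v2 (v1 ⬝ₜ v0) hi hj h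

/-- Collection of the entries in `X` of the values of `h` up to some number. -/
theorem Struc.exists_collect (X : M.carrier (ρ ⇒ Ty.nat)) (h : M.carrier (Ty.nat ⇒ ρ.seq)) :
    ∃ s : M.carrier (Ty.nat ⇒ ρ.seq), (M.st X → M.st h → M.st s) ∧ ValuesIn X s ∧
      ∀ m, ∀ k ≤ m, ∀ i < len (h ⬝ₘ k), X ⬝ₘ proj (h ⬝ₘ k) i = 1 →
        ∃ n < len (s ⬝ₘ m), proj (s ⬝ₘ m) n = proj (h ⬝ₘ k) i := by
  let t : Tm [Ty.nat, Ty.nat ⇒ ρ.seq] ρ.seq.seq := Tm.mk (Tm.succ v0) v1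
  obtain ⟨s, hs, hs', hs''⟩ := exists_flat_fun X (t.lam.eval M (h ∷ M.nil))
  refine ⟨s, fun hX hh => hs hX ((stdEnv_nil.cons hh).st_eval _), hs', fun m k hk i hi hx => ?_⟩
  have ht : t.lam.eval M (h ∷ M.nil) ⬝ₘ m = mkSeq (m + 1) h := by simp [t, Tm.eval_lam]
  have hp : proj (mkSeq (m + 1) h) k = h ⬝ₘ k := proj_mkSeq h (lt_add_one_iff.2 hk)
  have := hs'' m
  rw [ht] at this
  have := this k (by rw [len_mkSeq]; exact lt_add_one_iff.2 hk) i
  rw [hp] at this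
  exact this hi hx

/-- Filtering a standard sequence through a nonstandard `X` could destroy standardness. In that case
the filter is the whole type, and membership in `X` is left to each net. -/
theorem Struc.exists_st_superset (X : M.carrier (ρ ⇒ Ty.nat)) :
    ∃ X' : M.carrier (ρ ⇒ Ty.nat), M.st X' ∧ (∀ x, X ⬝ₘ x = 1 → X' ⬝ₘ x = 1) ∧
      (M.st X → X' = X) := by
  by_cases hX : M.st X
  · exact ⟨X, hX, fun _ h => h, fun _ => rfl⟩
  · refine ⟨(Tm.lam (Tm.succ Tm.zero)).eval M M.nil, stdEnv_nil.st_eval _, fun x _ => ?_,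
      fun h => (hX h).elim⟩
    simp [Tm.eval_lam]

end Choice

/-! Nets. -/

section Nets

variable {M : Struc} [hM : M.Extensional] {Γ : Ctx} {ρ : Ty}
  {X : M.carrier (ρ ⇒ Ty.nat)} {d : M.carrier (ρ ⇒ ρ ⇒ Ty.one)}

open Struc Frac

/-- `s` contains a net of `X` of mesh `q`. -/
def Struc.Net (X : M.carrier (ρ ⇒ Ty.nat)) (d : M.carrier (ρ ⇒ ρ ⇒ Ty.one)) (s : M.carrier ρ.seq)
    (q : M.Q) : Prop :=
  ∀ x, X ⬝ₘ x = 1 → ∃ i < len s, X ⬝ₘ proj s i = 1 ∧ DistLe d x (proj s i) q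

/-- `s` contains a net of `X` of infinitesimal mesh. -/
def Struc.InfNet (X : M.carrier (ρ ⇒ Ty.nat)) (d : M.carrier (ρ ⇒ ρ ⇒ Ty.one))
    (s : M.carrier ρ.seq) : Prop :=
  ∀ x, X ⬝ₘ x = 1 → ∃ i < len s, X ⬝ₘ proj s i = 1 ∧ Near d x (proj s i)

/-- Nonstandard compactness implies effective total boundedness. -/
theorem Struc.exists_nets_of_nsCompact
    (hc : ∀ x, X ⬝ₘ x = 1 → ∃ y, M.st y ∧ X ⬝ₘ y = 1 ∧ Near d x y) :
    ∃ h : M.carrier (Ty.nat ⇒ ρ.seq), M.st h ∧ (M.st X → ValuesIn X h) ∧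
      ∀ k, M.st k → 0 < k → Net X d (h ⬝ₘ k) (of k)⁻¹ := by
  have h1 : ∀ k : M.N, M.st k → 0 < k → ∃ s, M.st s ∧ Net X d s (of k)⁻¹ := by
    intro k hk h0
    let A : Fml [ρ, ρ, Ty.nat, ρ ⇒ ρ ⇒ Ty.one, ρ ⇒ Ty.nat] :=
      inSet (Tm.var (Var.s (Var.s (Var.s (Var.s Var.z))))) v1 →ᶠ
      inSet (Tm.var (Var.s (Var.s (Var.s (Var.s Var.z))))) v0 ∧ᶠ
        realLe (Tm.var (Var.s (Var.s (Var.s Var.z))) ⬝ₜ v1 ⬝ₜ v0) (realOf (qInv v2))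
    have hA : A.Internal := by simp [A]
    have hev : ∀ y x, A.eval M (y ∷ x ∷ k ∷ d ∷ X ∷ M.nil) ↔
        (X ⬝ₘ x = 1 → X ⬝ₘ y = 1 ∧ DistLe d x y (of k)⁻¹) := by
      intro y x
      simp only [A, Fml.eval_imp, Fml.eval_and, Fml.eval_inSet, eval_realLe_realOf, Tm.eval_app,
        Tm.eval_var, cons_z, cons_s, DistLe]
      rw [qval_qInv _ _ (by simpa using h0)]
      rfl
    -- Points outside `X` make the formula vacuous and receive the zero object, because idealisation
    -- asks for a standard witness at every `x`.
    obtain ⟨w, hw, hw'⟩ := idealisation hA (e := k ∷ d ∷ X ∷ M.nil) (fun x => by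
      by_cases hx : X ⬝ₘ x = 1
      · obtain ⟨y, hy, hy', hxy⟩ := hc x hx
        exact ⟨y, hy, (hev y x).2 fun _ => ⟨hy', (hxy k hk).mono (tp_le_inv h0)⟩⟩
      · exact ⟨_, stdEnv_nil.st_eval (Tm.default ρ), (hev _ x).2 fun h => (hx h).elim⟩)
    refine ⟨w, hw, fun x hx => ?_⟩
    obtain ⟨i, hi, h'⟩ := hw' x
    exact ⟨i, hi, (hev _ x).1 h' hx⟩
  let A : Fml [ρ.seq, Ty.nat, ρ ⇒ ρ ⇒ Ty.one, ρ ⇒ Ty.nat] :=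
    ltF Tm.zero v1 →ᶠ isNet (Tm.var (Var.s (Var.s (Var.s Var.z)))) v2 v0 v1
  have hA : A.Internal := by simp [A, isNet, allIn]
  have hev : ∀ s k, A.eval M (s ∷ k ∷ d ∷ X ∷ M.nil) ↔ (0 < k → Net X d s (of k)⁻¹) := by
    intro s k
    simp only [A, Fml.eval_imp, Fml.eval_ltF_iff, Tm.eval_zero, Tm.eval_var, cons_z, cons_s]
    refine forall_congr' fun hk => ?_
    rw [eval_isNet _ _ _ _ _ (by simpa using hk)]
    rfl
  -- The net property is internal even for nonstandard `X` and `d`, which enter as parameters. The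
  -- value at `k = 0` is irrelevant and filled by the zero sequence.
  obtain ⟨F, hF, hF'⟩ := herbrand_choice hA (e := d ∷ X ∷ M.nil) (fun k hk => by
    by_cases h0 : 0 < k
    · obtain ⟨s, hs, h'⟩ := h1 k hk h0
      exact ⟨s, hs, (hev s k).2 fun _ => h'⟩
    · exact ⟨_, stdEnv_nil.st_eval (Tm.default ρ.seq), (hev _ k).2 fun h => (h0 h).elim⟩)
  -- Which candidate in `F k` is a net need not be known: a sequence that contains the `X`-entries
  -- of all candidates contains such a net.
  obtain ⟨X', hX', hsub, hXX'⟩ := exists_st_superset X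
  obtain ⟨h, hh, hval, hh'⟩ := exists_flat_fun X' F
  refine ⟨h, hh hX' hF, fun hX => by rwa [hXX' hX] at hval, fun k hk h0 x hx => ?_⟩
  obtain ⟨i, hi, h2⟩ := hF' k hk
  obtain ⟨j, hj, h3, h4⟩ := (hev _ k).1 h2 h0 x hx
  obtain ⟨n, hn, h5⟩ := hh' k i hi j hj (hsub _ h3)
  exact ⟨n, hn, by rwa [h5], by rwa [h5]⟩

end Nets

/-! Grids of infinitesimal mesh. -/

section Grids

variable {M : Struc} [hM : M.Extensional] {Γ : Ctx} {ρ : Ty}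
  {X : M.carrier (ρ ⇒ Ty.nat)} {d : M.carrier (ρ ⇒ ρ ⇒ Ty.one)}

open Struc Frac

/-- The `k`-th approximation of the distance of `x` and `y` is at most `c / k`. -/
def apxDistLe (d : Tm Γ (ρ ⇒ ρ ⇒ Ty.one)) (x y : Tm Γ ρ) (c k : Tm Γ Ty.nat) : Fml Γ :=
  qLe (apx (d ⬝ₜ x ⬝ₜ y) k) (qCode c Tm.zero (Tm.pred k))

@[simp] theorem qf_apxDistLe (d : Tm Γ (ρ ⇒ ρ ⇒ Ty.one)) (x y : Tm Γ ρ) (c k : Tm Γ Ty.nat) :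
    (apxDistLe d x y c k).QF := trivial

theorem eval_apxDistLe (e : M.Env Γ) (d : Tm Γ (ρ ⇒ ρ ⇒ Ty.one)) (x y : Tm Γ ρ)
    (c k : Tm Γ Ty.nat) (hk : 0 < k.eval M e) : (apxDistLe d x y c k).eval M e ↔
      rv (d.eval M e ⬝ₘ x.eval M e ⬝ₘ y.eval M e) (k.eval M e) ≤
        of (c.eval M e) / of (k.eval M e) := by
  rw [apxDistLe, eval_qLe, qval_apx, qval_qCode, ← map_one of, ← map_add, Tm.eval_pred,
    prd_add_one_of_pos hk, Tm.eval_zero, map_zero, sub_zero, Tm.eval_app, Tm.eval_app]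

/-- Since 2^{-k} ≤ 1/k, passing from a distance to its k-th approximation costs 1/k, and so does the
way back in `Struc.distLe_of_rv_le`. This accounts for the growing numerators in what follows. -/
theorem Struc.DistLe.rv_le {x y : M.carrier ρ} {k : M.N} (hk : 0 < k) {c : M.Q}
    (h : DistLe d x y (c / of k)) : rv (d ⬝ₘ x ⬝ₘ y) k ≤ (c + 1) / of k := by
  have h1 := h k
  have h2 := tp_le_inv hk
  rw [add_div, one_div]
  linarith

theorem Struc.distLe_of_rv_le {x y : M.carrier ρ} {k : M.N} (hk : 0 < k) {c : M.Q}
    (h : rv (d ⬝ₘ x ⬝ₘ y) k ≤ c / of k) : DistLe d x y ((c + 1) / of k) := by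
  refine (below_rv _ k).mono ?_
  have h2 := tp_le_inv hk
  rw [add_div, one_div]
  linarith

/-- A point with bounds `c / k` for its distances to the sequences `S(k)`, for all standard `k`, is
infinitesimally close to an entry of some `S(k)`, with `k` below any given infinite number. -/
theorem Struc.exists_near {S : M.carrier (Ty.nat ⇒ ρ.seq)} {x : M.carrier ρ} {c : M.N}
    (hc : M.st c) (h : ∀ k, M.st k → 0 < k → ∃ i < len (S ⬝ₘ k), X ⬝ₘ proj (S ⬝ₘ k) i = 1 ∧
      DistLe d x (proj (S ⬝ₘ k) i) (of c / of k)) {m : M.N} (hm : Infinite m) :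
    ∃ k ≤ m, ∃ i < len (S ⬝ₘ k), X ⬝ₘ proj (S ⬝ₘ k) i = 1 ∧ Near d x (proj (S ⬝ₘ k) i) := by
  let B : Fml [Ty.nat, Ty.nat, Ty.nat ⇒ ρ.seq, ρ, ρ ⇒ ρ ⇒ Ty.one, ρ ⇒ Ty.nat, Ty.nat] :=
    inSet (Tm.var (Var.s (Var.s (Var.s (Var.s (Var.s Var.z)))))) (Tm.proj (v2 ⬝ₜ v1) v0) ∧ᶠ
      apxDistLe (Tm.var (Var.s (Var.s (Var.s (Var.s Var.z))))) (Tm.var (Var.s (Var.s (Var.s Var.z))))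
        (Tm.proj (v2 ⬝ₜ v1) v0)
        (Tm.succ (Tm.var (Var.s (Var.s (Var.s (Var.s (Var.s (Var.s Var.z)))))))) v1
  have hB : B.QF := by simp [B]
  have hev : ∀ i k, 0 < k → (B.eval M (i ∷ k ∷ S ∷ x ∷ d ∷ X ∷ c ∷ M.nil) ↔
      X ⬝ₘ proj (S ⬝ₘ k) i = 1 ∧
        rv (d ⬝ₘ x ⬝ₘ proj (S ⬝ₘ k) i) k ≤ (of c + 1) / of k) := by
    intro i k hk
    simp only [B, Fml.eval_and, Fml.eval_inSet]
    rw [eval_apxDistLe _ _ _ _ _ _ (by simpa using hk)]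
    simp
  let e := S ∷ x ∷ d ∷ X ∷ c ∷ M.nil
  -- The inequality between reals has an unbounded quantifier, so overspill is applied to the k-th
  -- approximations, with numerator c + 1.
  obtain ⟨k, hkm, hk, h1⟩ := overspill (A := Fml.bex (Tm.len (v1 ⬝ₜ v0)) B) (Fml.qf_bex _ _) (e := e)
    (fun k hk h0 => by
      obtain ⟨i, hi, hx, hd⟩ := h k hk h0
      exact (Fml.eval_bex hB _ _).2 ⟨i, by simpa [e] using hi, (hev i k h0).2 ⟨hx, hd.rv_le h0⟩⟩) hm
  obtain ⟨i, hi, h2⟩ := (Fml.eval_bex hB _ _).1 h1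
  have h0 : 0 < k := by
    have := hk 1 (by simpa using st_add_one (M := M) st_zero)
    exact zero_lt_one.trans_le this
  obtain ⟨hx, hd⟩ := (hev i k h0).1 h2
  refine ⟨k, hkm, i, by simpa [e] using hi, hx, fun n hn => (distLe_of_rv_le h0 hd).mono ?_⟩
  have h3 : ∀ b, M.st b → ∀ a : M.N, M.st a → M.st (a * b) := fun b hb a ha => by
    simpa using ((stdEnv_nil.cons ha).cons hb).st_eval (Tm.mul v1 v0)
  -- The infinite `k` exceeds (c + 2)·2^n for every standard `n`, so (c + 2)/k ≤ 2^{-n}.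
  have h4 := of_le.2 (hk _ (h3 (c + 1 + 1) (st_add_one (st_add_one hc)) _ (st_pow2 hn)))
  simp only [map_mul, map_add, map_one] at h4
  rw [div_le_iff₀ (of_pos h0), tp, inv_mul_eq_div, le_div_iff₀ (of_pow2_pos n)]
  linarith

/-- From nets of all standard meshes one gets, for each infinite number, a net of infinitesimal
mesh. -/
theorem Struc.exists_grid {h : M.carrier (Ty.nat ⇒ ρ.seq)} (hh : M.st h)
    (hnet : ∀ k, M.st k → 0 < k → Net X d (h ⬝ₘ k) (of k)⁻¹) :
    ∃ s : M.carrier (Ty.nat ⇒ ρ.seq), M.st s ∧ (M.st X → ValuesIn X s) ∧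
      ∀ m, Infinite m → InfNet X d (s ⬝ₘ m) := by
  obtain ⟨X', hX', hsub, hXX'⟩ := exists_st_superset X
  -- The infinite stage produced by overspill depends on the point; collecting all stages up to `m`
  -- covers every point at once.
  obtain ⟨s, hs, hval, hs'⟩ := exists_collect X' h
  refine ⟨s, hs hX' hh, fun hX => by rwa [hXX' hX] at hval, fun m hm x hx => ?_⟩
  obtain ⟨k, hkm, i, hi, h1, h2⟩ := exists_near (c := 1) (S := h) (X := X) (d := d) (x := x)
    (by simpa using st_add_one (M := M) st_zero) (fun k hk h0 => by
      obtain ⟨i, hi, h1, h2⟩ := hnet k hk h0 x hx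
      exact ⟨i, hi, h1, by rwa [map_one, one_div]⟩) hm
  obtain ⟨n, hn, h3⟩ := hs' m k hkm i hi (hsub _ h1)
  exact ⟨n, hn, by rwa [h3], by rwa [h3]⟩

/-- All approximate distances of `x` to the entries of `s` are greater than `4 / m`. -/
def Struc.Far (d : M.carrier (ρ ⇒ ρ ⇒ Ty.one)) (x : M.carrier ρ) (s : M.carrier ρ.seq) (m : M.N) :
    Prop := ∀ l < len s, ¬ rv (d ⬝ₘ x ⬝ₘ proj s l) m ≤ 4 / of m

/-- Positivity of `m` is included because the fraction 4/m is coded with the predecessor of `m`. -/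
def farF (d : Tm Γ (ρ ⇒ ρ ⇒ Ty.one)) (x : Tm Γ ρ) (s : Tm Γ ρ.seq) (m : Tm Γ Ty.nat) : Fml Γ :=
  ltF Tm.zero m ∧ᶠ (Fml.bex s.len (apxDistLe d.wk x.wk (s.wk.proj v0)
    (Tm.succ (Tm.succ (Tm.succ (Tm.succ Tm.zero)))) m.wk)).not

@[simp] theorem qf_farF (d : Tm Γ (ρ ⇒ ρ ⇒ Ty.one)) (x : Tm Γ ρ) (s : Tm Γ ρ.seq)
    (m : Tm Γ Ty.nat) : (farF d x s m).QF := by simp [farF]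

theorem eval_farF (e : M.Env Γ) (d : Tm Γ (ρ ⇒ ρ ⇒ Ty.one)) (x : Tm Γ ρ) (s : Tm Γ ρ.seq)
    (m : Tm Γ Ty.nat) : (farF d x s m).eval M e ↔
      0 < m.eval M e ∧ Far (d.eval M e) (x.eval M e) (s.eval M e) (m.eval M e) := by
  simp only [farF, Fml.eval_and, Fml.eval_ltF_iff, Tm.eval_zero, Fml.eval_not,
    Fml.eval_bex (qf_apxDistLe _ _ _ _ _), Tm.eval_len]
  refine and_congr_right fun hm => ?_
  have h := fun i : M.N => eval_apxDistLe (i ∷ e) d.wk x.wk (s.wk.proj v0)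
    (Tm.succ (Tm.succ (Tm.succ (Tm.succ Tm.zero)))) m.wk (by rwa [Tm.eval_wk])
  simp only [h, Far, Tm.eval_wk, Tm.eval_proj, Tm.eval_var, cons_z, Tm.eval_succ, Tm.eval_zero,
    map_add, map_one, map_zero]
  norm_num

/-- In a nonstandard compact space, all indices of a standard sequence of standard length and
standard separation are standard. -/
theorem Struc.Metric.st_of_separated (hd : Metric X d) (hst : M.st d)
    (hc : ∀ x, X ⬝ₘ x = 1 → ∃ y, M.st y ∧ X ⬝ₘ y = 1 ∧ Near d x y)
    {x : M.carrier (Ty.nat ⇒ ρ)} (hx : M.st x) {n k : M.N} (hn : M.st n) (hk : M.st k)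
    (h0 : 0 < k) (hX : ∀ j ≤ n, X ⬝ₘ (x ⬝ₘ j) = 1)
    (hsep : ∀ j ≤ n, ∀ i < j, ¬ DistLe d (x ⬝ₘ j) (x ⬝ₘ i) (3 / of k)) {m : M.N} (hm : m ≤ n) :
    M.st m := by
  obtain ⟨y, hy, hyX, hxy⟩ := hc _ (hX m hm)
  let A : Fml [Ty.nat, ρ, Ty.nat, Ty.nat ⇒ ρ, ρ ⇒ ρ ⇒ Ty.one] :=
    apxDistLe (Tm.var (Var.s (Var.s (Var.s (Var.s Var.z)))))
      (Tm.var (Var.s (Var.s (Var.s Var.z))) ⬝ₜ v0) v1 (Tm.succ (Tm.succ Tm.zero)) v2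
  -- At stage 2k an approximation at most 2/(2k) gives a distance at most 3/(2k), and two such
  -- distances add up to the separation 3/k.
  have hk2 : 0 < k + k := add_pos h0 h0
  have hev : ∀ j, A.eval M (j ∷ y ∷ (k + k) ∷ x ∷ d ∷ M.nil) ↔
      rv (d ⬝ₘ (x ⬝ₘ j) ⬝ₘ y) (k + k) ≤ 2 / of (k + k) := fun j => by
    rw [eval_apxDistLe _ _ _ _ _ _ (by simpa using hk2)]
    simp only [Tm.eval_var, Tm.eval_app, Tm.eval_succ, Tm.eval_zero, cons_z, cons_s, map_add,
      map_one, map_zero]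
    norm_num
  have he : StdEnv (y ∷ (k + k) ∷ x ∷ d ∷ M.nil) :=
    (((stdEnv_nil.cons hst).cons hx).cons (st_add hk hk)).cons hy
  have h1 : rv (d ⬝ₘ (x ⬝ₘ m) ⬝ₘ y) (k + k) ≤ 2 / of (k + k) := by
    refine (DistLe.rv_le hk2 (c := 1) ?_).trans (by norm_num)
    exact (hxy _ (st_add hk hk)).mono (by rw [one_div]; exact tp_le_inv hk2)
  -- The least index whose point is close to the standard `y` is standard, and at most `m`. If it
  -- were smaller than `m`, two separated points would be too close to each other.
  obtain ⟨j, hj, hjn, hjA, hjm⟩ := exists_st_least (A := A) (by simp [A]) he (st_add_one hn)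
    ⟨m, lt_add_one_iff.2 hm, (hev m).2 h1⟩
  rcases eq_or_lt_of_le (hjm m ((hev m).2 h1)) with rfl | hlt
  · exact hj
  have hXj := hX j (lt_add_one_iff.1 hjn)
  refine (hsep m hm j hlt ?_).elim
  refine (hd.triangle _ (hX m hm) y hyX _ hXj _ _ (distLe_of_rv_le hk2 h1)
    (hd.symm _ hXj _ hyX _ (distLe_of_rv_le hk2 ((hev j).1 hjA)))).mono (le_of_eq ?_)
  have := (of_pos h0).ne'
  rw [map_add]
  field_simp
  norm_num

/-- If nothing is far from `s` at standard stages, then `s` is a net of infinitesimal mesh. -/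
theorem Struc.Metric.infNet_of_not_far (hd : Metric X d) (hst : M.st d)
    {h : M.carrier (Ty.nat ⇒ ρ.seq)} (hh : M.st h)
    (hnet : ∀ k, M.st k → 0 < k → Net X d (h ⬝ₘ k) (of k)⁻¹) {s : M.carrier ρ.seq} (hs : M.st s)
    (hsX : ∀ i < len s, X ⬝ₘ proj s i = 1)
    (hfar : ∀ m, M.st m → 0 < m → ∀ i, M.st i → i < len (h ⬝ₘ m) →
      ¬ Far d (proj (h ⬝ₘ m) i) s m) : InfNet X d s := by
  -- An index below a standard length need not be standard, but the least index of a far entry is.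
  have hfar' : ∀ m, M.st m → 0 < m → ∀ i < len (h ⬝ₘ m), ¬ Far d (proj (h ⬝ₘ m) i) s m := by
    intro m hm h0 i hi hf
    let A : Fml [Ty.nat, Ty.nat, Ty.nat ⇒ ρ.seq, ρ.seq, ρ ⇒ ρ ⇒ Ty.one] :=
      farF (Tm.var (Var.s (Var.s (Var.s (Var.s Var.z))))) (Tm.proj (v2 ⬝ₜ v1) v0)
        (Tm.var (Var.s (Var.s (Var.s Var.z)))) v1
    have hev : ∀ i, A.eval M (i ∷ m ∷ h ∷ s ∷ d ∷ M.nil) ↔ Far d (proj (h ⬝ₘ m) i) s m := fun i => by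
      rw [eval_farF]
      simp [h0]
    obtain ⟨j, hj, hjn, hjA, -⟩ := exists_st_least (A := A) (by simp [A])
      ((((stdEnv_nil.cons hst).cons hs).cons hh).cons hm)
      (st_app (st_con (Con.len ρ)) (st_app hh hm)) ⟨i, hi, (hev i).2 hf⟩
    exact hfar m hm h0 j hj hjn ((hev j).1 hjA)
  intro x hx
  obtain ⟨m, hm⟩ := exists_infinite (M := M)
  let S := (Tm.lam (v1 : Tm [Ty.nat, ρ.seq] ρ.seq)).eval M (s ∷ M.nil)
  have hS : ∀ k, S ⬝ₘ k = s := fun k => by simp [S, Tm.eval_lam]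
  -- The net contributes 1/m, and an entry that is not far contributes (4 + 1)/m, whence the
  -- constant 6.
  have key : ∀ m, M.st m → 0 < m → ∃ i < len (S ⬝ₘ m), X ⬝ₘ proj (S ⬝ₘ m) i = 1 ∧
      DistLe d x (proj (S ⬝ₘ m) i) (of ((6 : ℕ) : M.N) / of m) := by
    intro m hm h0
    rw [hS]
    obtain ⟨i, hi, hi', hxi⟩ := hnet m hm h0 x hx
    have := hfar' m hm h0 i hi
    rw [Far] at this
    push Not at this
    obtain ⟨l, hl, hl'⟩ := this
    refine ⟨l, hl, hsX l hl, (hd.triangle x hx _ hi' _ (hsX l hl) _ _ hxi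
      (distLe_of_rv_le h0 hl')).mono (le_of_eq ?_)⟩
    have := (of_pos h0).ne'
    rw [map_natCast]
    field_simp
    norm_num
  obtain ⟨k, -, i, hi, h1, h2⟩ := exists_near (st_natCast 6) key hm
  rw [hS] at hi h1 h2
  exact ⟨i, hi, h1, h2⟩

theorem Struc.exists_st_rec {a : M.N} (ha : M.st a) {s : M.carrier (Ty.nat ⇒ Ty.nat ⇒ Ty.nat)}
    (hs : M.st s) : ∃ g : M.carrier Ty.one, M.st g ∧ g ⬝ₘ 0 = a ∧
      ∀ j, g ⬝ₘ (j + 1) = s ⬝ₘ (g ⬝ₘ j) ⬝ₘ j := by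
  refine ⟨(Tm.rec0 v0 v1 v2 : Tm [_, _, _] Ty.nat).lam.eval M (a ∷ s ∷ M.nil),
    ((stdEnv_nil.cons hs).cons ha).st_eval _, ?_, fun j => ?_⟩ <;>
  simp only [Tm.eval_lam, Tm.eval_rec0, Tm.eval_var, cons_z, cons_s]
  · exact rec_zero _ _
  · exact rec_add_one _ _ _

/-- In a standard nonstandard compact space with a nonstandard number that is not infinite, a
standard sequence is a net of infinitesimal mesh. -/
theorem Struc.Metric.exists_st_infNet (hd : Metric X d) (hst : M.st d) (hX : M.st X)
    (hc : ∀ x, X ⬝ₘ x = 1 → ∃ y, M.st y ∧ X ⬝ₘ y = 1 ∧ Near d x y)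
    {m n : M.N} (hm : ¬ M.st m) (hn : M.st n) (hmn : m ≤ n) :
    ∃ s : M.carrier ρ.seq, M.st s ∧ (∀ i < len s, X ⬝ₘ proj s i = 1) ∧ InfNet X d s := by
  obtain ⟨h, hh, hval, hnet⟩ := exists_nets_of_nsCompact hc
  obtain ⟨S, hS, hSX, hcol⟩ := exists_collect X h
  by_contra hno
  -- No `S k` with standard `k` is an infinitesimal net, so some standard pair (m, i) codes an entry
  -- of h(m) far from all of `S k`.
  have hB : ∀ k, M.st k → ∃ p, M.st p ∧ snd p < len (h ⬝ₘ fst p) ∧ 0 < fst p ∧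
      Far d (proj (h ⬝ₘ fst p) (snd p)) (S ⬝ₘ k) (fst p) := by
    intro k hk
    by_contra hk'
    push Not at hk'
    refine hno ⟨S ⬝ₘ k, st_app (hS hX hh) hk, hSX k, hd.infNet_of_not_far hst hh hnet
      (st_app (hS hX hh) hk) (hSX k) fun m hm h0 i hi him => ?_⟩
    have := hk' (pair m i) (by
      simpa using ((stdEnv_nil.cons hm).cons hi).st_eval (Tm.pair v1 v0))
    rw [fst_pair, snd_pair] at this
    exact this him h0
  let A : Fml [Ty.nat, Ty.nat, Ty.nat ⇒ ρ.seq, Ty.nat ⇒ ρ.seq, ρ ⇒ ρ ⇒ Ty.one] :=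
    ltF (Tm.snd v0) (Tm.len (v2 ⬝ₜ Tm.fst v0)) ∧ᶠ
      farF (Tm.var (Var.s (Var.s (Var.s (Var.s Var.z))))) (Tm.proj (v2 ⬝ₜ Tm.fst v0) (Tm.snd v0))
        (Tm.var (Var.s (Var.s (Var.s Var.z))) ⬝ₜ v1) (Tm.fst v0)
  have hA : A.QF := by simp [A]
  have hev : ∀ p k, A.eval M (p ∷ k ∷ h ∷ S ∷ d ∷ M.nil) ↔ snd p < len (h ⬝ₘ fst p) ∧ 0 < fst p ∧
      Far d (proj (h ⬝ₘ fst p) (snd p)) (S ⬝ₘ k) (fst p) := fun p k => by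
    rw [Fml.eval_and, eval_farF]
    simp
  have he : StdEnv (h ∷ S ∷ d ∷ M.nil) := ((stdEnv_nil.cons hst).cons (hS hX hh)).cons hh
  obtain ⟨f, hf, hfA⟩ := exists_st_choice hA he (fun k hk => by simpa only [hev] using hB k hk)
  -- The thresholds g(j) grow by the stage of the entry chosen at g(j). Hence S(g(j+1)) contains
  -- that entry, and later choices are far from it.
  obtain ⟨g, hg, hg0, hg1⟩ := exists_st_rec (M := M) (a := 0) st_zero (s :=
    ((Tm.add v1 (Tm.fst (v2 ⬝ₜ v1)) : Tm [Ty.nat, Ty.nat, Ty.one] Ty.nat).lam.lam).eval M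
      (f ∷ M.nil)) ((stdEnv_nil.cons hf).st_eval _)
  replace hg1 : ∀ j, g ⬝ₘ (j + 1) = g ⬝ₘ j + fst (f ⬝ₘ (g ⬝ₘ j)) := fun j => by
    rw [hg1]
    simp [Tm.eval_lam]
  have hgm : ∀ i c, g ⬝ₘ i ≤ g ⬝ₘ (i + c) := fun i c => by
    have := ind (A := leF (v2 ⬝ₜ v1) (v2 ⬝ₜ Tm.add v1 v0)) (by simp) (i ∷ g ∷ M.nil)
    simp only [Fml.eval_leF, Tm.eval_app, Tm.eval_add, Tm.eval_var, cons_z, cons_s] at this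
    refine this (by simp) (fun c hc => hc.trans ?_) c
    rw [← add_assoc, hg1]
    exact le_self_add
  -- The choice function is correct at standard arguments only. If it failed for some j ≤ n, the
  -- least failing j would be standard, and so would g(j): a contradiction. This extends the
  -- property to all, possibly nonstandard, j ≤ n.
  have hfar : ∀ j ≤ n, snd (f ⬝ₘ (g ⬝ₘ j)) < len (h ⬝ₘ fst (f ⬝ₘ (g ⬝ₘ j))) ∧
      0 < fst (f ⬝ₘ (g ⬝ₘ j)) ∧ Far d (proj (h ⬝ₘ fst (f ⬝ₘ (g ⬝ₘ j))) (snd (f ⬝ₘ (g ⬝ₘ j))))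
        (S ⬝ₘ (g ⬝ₘ j)) (fst (f ⬝ₘ (g ⬝ₘ j))) := by
    intro j hj
    by_contra hjn
    let r : Sub [Ty.nat, Ty.nat, Ty.nat ⇒ ρ.seq, Ty.nat ⇒ ρ.seq, ρ ⇒ ρ ⇒ Ty.one]
      [Ty.nat, Ty.one, Ty.one, Ty.nat ⇒ ρ.seq, Ty.nat ⇒ ρ.seq, ρ ⇒ ρ ⇒ Ty.one] := fun
      | _, Var.z => v2 ⬝ₜ (v1 ⬝ₜ v0)
      | _, Var.s Var.z => v1 ⬝ₜ v0
      | _, Var.s (Var.s x) => Tm.var (Var.s (Var.s (Var.s x)))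
    have hr : ∀ j, (A.subst r).eval M (j ∷ g ∷ f ∷ h ∷ S ∷ d ∷ M.nil) ↔
        A.eval M (f ⬝ₘ (g ⬝ₘ j) ∷ g ⬝ₘ j ∷ h ∷ S ∷ d ∷ M.nil) := fun j => by
      rw [Fml.eval_subst]
      apply iff_of_eq
      congr 1
      funext σ v
      rcases v with _ | _ | v <;> rfl
    obtain ⟨i, hi, -, hiA, -⟩ := exists_st_least (A := (A.subst r).not)
      ((Fml.qf_not _).2 (hA.subst r)) ((he.cons hf).cons hg) (st_add_one hn)
      ⟨j, lt_add_one_iff.2 hj, by rwa [Fml.eval_not, hr, hev]⟩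
    rw [Fml.eval_not, hr] at hiA
    exact hiA (hfA _ (st_app hg hi))
  let x : M.carrier (Ty.nat ⇒ ρ) := (Tm.lam (Tm.proj
    (Tm.var (Var.s (Var.s (Var.s Var.z))) ⬝ₜ Tm.fst (v2 ⬝ₜ (v1 ⬝ₜ v0)))
    (Tm.snd (v2 ⬝ₜ (v1 ⬝ₜ v0))) : Tm [Ty.nat, Ty.one, Ty.one, Ty.nat ⇒ ρ.seq] ρ)).eval M
      (g ∷ f ∷ h ∷ M.nil)
  have hx : ∀ j, x ⬝ₘ j = proj (h ⬝ₘ fst (f ⬝ₘ (g ⬝ₘ j))) (snd (f ⬝ₘ (g ⬝ₘ j))) := fun j => by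
    simp [x, Tm.eval_lam]
  -- The standard number g(n+1) dominates all stages used up to `n`, which gives one standard
  -- separation for all the points.
  have hk : ∀ j ≤ n, fst (f ⬝ₘ (g ⬝ₘ j)) ≤ g ⬝ₘ (n + 1) := fun j hj => by
    obtain ⟨c, rfl⟩ := le_iff_exists_add'.1 hj
    refine le_trans ?_ (hgm (j + 1) c |>.trans_eq (by rw [add_right_comm]))
    rw [hg1]
    exact le_add_self
  have hxX : ∀ j ≤ n, X ⬝ₘ (x ⬝ₘ j) = 1 := fun j hj => by
    rw [hx]
    exact hval hX _ _ (hfar j hj).1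
  refine hm (hd.st_of_separated hst hc (x := x) ((((stdEnv_nil.cons hh).cons hf).cons hg).st_eval _)
    hn (st_app hg (st_add_one hn)) ((hfar m hmn).2.1.trans_le (hk m hmn)) hxX
    (fun j hj i hi hji => ?_) hmn)
  obtain ⟨c, rfl⟩ := lt_iff_exists_add_one.1 hi
  have hin : i ≤ n := hi.le.trans hj
  obtain ⟨l, hl, hl'⟩ := hcol (g ⬝ₘ (i + c + 1)) (fst (f ⬝ₘ (g ⬝ₘ i)))
    (by
      rw [add_right_comm]
      refine le_trans ?_ (hgm _ _)
      rw [hg1]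
      exact le_add_self) _ (hfar i hin).1 (hval hX _ _ (hfar i hin).1)
  obtain ⟨-, h0, hf'⟩ := hfar _ hj
  refine hf' l hl ?_
  rw [hl', ← hx, ← hx]
  -- A distance at most 3/g(n+1) is at most 3 over the stage chosen at `j`, so the approximation is
  -- at most 4 over that stage. This is what `Struc.Far` excludes.
  refine (DistLe.rv_le h0 (c := 3) (hji.mono ?_)).trans (by norm_num)
  exact div_le_div_of_nonneg_left (by norm_num) (of_pos h0) (of_le.2 (hk _ hj))

end Grids

/-! ### Translation of the statement, and standard grids at all nonstandard numbers. -/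

section Main

variable {M : Struc} [hM : M.Extensional] {Γ : Ctx} {ρ : Ty}

open Struc Frac

theorem eval_effTotallyBounded (e : M.Env Γ) (X : Tm Γ (ρ ⇒ Ty.nat))
    (d : Tm Γ (ρ ⇒ ρ ⇒ Ty.one)) : (effTotallyBounded X d).eval M e ↔
      ∃ h : M.carrier (Ty.nat ⇒ ρ.seq), M.st h ∧ (M.st (X.eval M e) → ValuesIn (X.eval M e) h) ∧
        ∀ k, M.st k → 0 < k → Net (X.eval M e) (d.eval M e) (h ⬝ₘ k) (of k)⁻¹ := by
  simp only [effTotallyBounded, Fml.eval_exSt, Fml.eval_and, Fml.eval_imp, Fml.eval_st,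
    eval_valuesIn, Fml.eval_allSt, Fml.eval_ltF_iff, Tm.eval_wk, Tm.eval_var, Tm.eval_zero, cons_z]
  refine exists_congr fun h => and_congr_right fun _ => and_congr_right fun _ =>
    forall_congr' fun k => forall_congr' fun _ => forall_congr' fun hk => ?_
  rw [eval_isNet _ _ _ _ _ (by simpa using hk)]
  simp [Net]

theorem eval_exceedsStandard (e : M.Env Γ) (m : Tm Γ Ty.nat) :
    (exceedsStandard m).eval M e ↔ Struc.Infinite (m.eval M e) := by
  simp [exceedsStandard, Struc.Infinite]

variable (e : M.Env Γ) (X : Tm Γ (ρ ⇒ Ty.nat)) (d : Tm Γ (ρ ⇒ ρ ⇒ Ty.one))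

theorem Struc.Metric.eval_gridLarge (hd : Metric (X.eval M e) (d.eval M e)) : (gridLarge X d).eval M e ↔
      ∃ s : M.carrier (Ty.nat ⇒ ρ.seq), M.st s ∧ (M.st (X.eval M e) → ValuesIn (X.eval M e) s) ∧
        ∀ m, Struc.Infinite m → InfNet (X.eval M e) (d.eval M e) (s ⬝ₘ m) := by
  simp only [gridLarge, Fml.eval_exSt, Fml.eval_and, Fml.eval_imp, Fml.eval_st, eval_valuesIn,
    Fml.eval_all, eval_exceedsStandard, Tm.eval_wk, Tm.eval_var, cons_z]
  refine exists_congr fun s => and_congr_right fun _ => and_congr_right fun _ =>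
    forall_congr' fun m => forall_congr' fun _ => ?_
  rw [Struc.Metric.eval_isInfNet _ _ _ (by simpa using hd)]
  simp [InfNet]

theorem Struc.Metric.eval_gridOmega (hd : Metric (X.eval M e) (d.eval M e)) : (gridOmega X d).eval M e ↔
      ∃ s : M.carrier (Ty.nat ⇒ ρ.seq), M.st s ∧ (M.st (X.eval M e) → ValuesIn (X.eval M e) s) ∧
        ∀ m, ¬ M.st m → InfNet (X.eval M e) (d.eval M e) (s ⬝ₘ m) := by
  simp only [gridOmega, Fml.eval_exSt, Fml.eval_and, Fml.eval_imp, Fml.eval_st, eval_valuesIn,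
    Fml.eval_all, Fml.eval_not, Tm.eval_wk, Tm.eval_var, cons_z]
  refine exists_congr fun s => and_congr_right fun _ => and_congr_right fun _ =>
    forall_congr' fun m => forall_congr' fun _ => ?_
  rw [Struc.Metric.eval_isInfNet _ _ _ (by simpa using hd)]
  simp [InfNet]

/-- A standard nonstandard compact space has a standard grid that is infinitesimal at all
nonstandard numbers. -/
theorem Struc.Metric.exists_grid_of_nsCompact {X : M.carrier (ρ ⇒ Ty.nat)}
    {d : M.carrier (ρ ⇒ ρ ⇒ Ty.one)} (hd : Metric X d) (hX : M.st X) (hst : M.st d)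
    (hc : ∀ x, X ⬝ₘ x = 1 → ∃ y, M.st y ∧ X ⬝ₘ y = 1 ∧ Near d x y) :
    ∃ s : M.carrier (Ty.nat ⇒ ρ.seq), M.st s ∧ (M.st X → ValuesIn X s) ∧
      ∀ m, ¬ M.st m → InfNet X d (s ⬝ₘ m) := by
  by_cases h : ∀ m : M.N, ¬ M.st m → Struc.Infinite m
  · obtain ⟨h', hh, -, hnet⟩ := exists_nets_of_nsCompact hc
    obtain ⟨s, hs, hval, hs'⟩ := exists_grid hh hnet
    exact ⟨s, hs, hval, fun m hm => hs' m (h m hm)⟩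
  · simp only [Struc.Infinite] at h
    push Not at h
    obtain ⟨m, hm, n, hn, hmn⟩ := h
    obtain ⟨s, hs, hsX, hs'⟩ := hd.exists_st_infNet hst hX hc hm hn hmn.le
    -- One standard sequence is already an infinitesimal net, so the grid may be constant.
    let S := (Tm.lam (v1 : Tm [Ty.nat, ρ.seq] ρ.seq)).eval M (s ∷ M.nil)
    have hS : ∀ k, S ⬝ₘ k = s := fun k => by simp [S, Tm.eval_lam]
    refine ⟨S, (stdEnv_nil.cons hs).st_eval _, fun _ k => ?_, fun k _ => ?_⟩
    · rw [hS]
      exact hsX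
    · rw [hS]
      exact hs'

end Main

end NSArith
theorem theorem4p8 (ρ : Ty) :
    P0Proves
      (Fml.all (ρ ⇒ Ty.nat) (Fml.all (ρ ⇒ ρ ⇒ Ty.one)
        (isMetric v1 v0 →ᶠ
          (nsCompact v1 v0 →ᶠ effTotallyBounded v1 v0) ∧ᶠ
          (effTotallyBounded v1 v0 →ᶠ gridLarge v1 v0) ∧ᶠ
          (Fml.st v1 →ᶠ Fml.st v0 →ᶠ nsCompact v1 v0 →ᶠ gridOmega v1 v0)))) := by
  refine P0Proves.of_models fun M hM => ?_
  simp only [Fml.eval_all, Fml.eval_imp, Fml.eval_and, Fml.eval_st]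
  intro X d hmet
  have hd := eval_isMetric _ _ _ hmet
  rw [hd.eval_nsCompact, eval_effTotallyBounded, hd.eval_gridLarge, hd.eval_gridOmega]
  refine ⟨Struc.exists_nets_of_nsCompact, ?_, fun hX hst => hd.exists_grid_of_nsCompact hX hst⟩
  rintro ⟨h, hh, -, hnet⟩
  exact Struc.exists_grid hh hnet
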